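/- Throughout, a Hopf algebra in a braided monoidal category $\mathcal C$ (with braiding $\Psi$) is a bialgebra in $\mathcal C$ with an invertible antipode $S$. For a Hopf algebra $A$ in $\mathcal C$, a right crossed module over $A$ is an object $X$ with a right $A$-module structure $\triangleleft: X\otimes A\to X$ and a right $A$-comodule structure $\beta: X\to X\otimes A$ such that $$(\mathrm{id}_X\otimes\cdot_A)(\Psi_{A,X}\otimes\mathrm{id}_A)(\mathrm{id}_A\otimes\beta)(\mathrm{id}_A\otimes\triangleleft)(\Psi_{X,A}\otimes\mathrm{id}_A)(\mathrm{id}_X\otimes\Delta_A)=(\triangleleft\otimes\cdot_A)(\mathrm{id}_X\otimes\Psi_{A,A}\otimes\mathrm{id}_A)(\beta\otimes\Delta_A).$$ Crossed modules, with the maps of modules and comodules, the diagonal action $(\triangleleft_X\otimes\triangleleft_Y)(\mathrm{id}\otimes\Psi_{Y,A}\otimes\mathrm{id})(\mathrm{id}\otimes\mathrm{id}\otimes\Delta_A)$ and the codiagonal coaction $(\mathrm{id}\otimes\mathrm{id}\otimes\cdot_A)(\mathrm{id}\otimes\Psi_{A,Y}\otimes\mathrm{id})(\beta_X\otimes\beta_Y)$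 on $X\otimes Y$, form a monoidal category $\mathcal C_A^A$, which is braided by $(\mathrm{id}_Y\otimes\triangleleft_X)(\Psi_{X,Y}\otimes\mathrm{id}_A)(\mathrm{id}_X\otimes\beta_Y): X\otimes Y\to Y\otimes X$. For a Hopf algebra $B$ in $\mathcal C_A^A$ put $\sigma=(\mathrm{id}_A\otimes\triangleleft)(\Psi_{B,A}\otimes\mathrm{id}_A)(\mathrm{id}_B\otimes\Delta_A): B\otimes A\to A\otimes B$ and $\tau=(\mathrm{id}_B\otimes\cdot_A)(\Psi_{A,B}\otimes\mathrm{id}_A)(\mathrm{id}_A\otimes\beta): A\otimes B\to B\otimes A$. The cross product $A\ltimes B$ is the object $A\otimes B$ of $\mathcal C$ with unit $\eta_A\otimes\eta_B$, multiplication $(\cdot_A\otimes\cdot_B)(\mathrm{id}_A\otimes\sigma\otimes\mathrm{id}_B)$, counit $\epsilon_A\otimes\epsilon_B$, comultiplication $(\mathrm{id}_A\otimes\tau\otimes\mathrm{id}_B)(\Delta_A\otimes\Delta_B)$ and antipode $\sigma(S_B\otimes S_A)\tau$. **Proposition.** Let $\mathcal C$ be a braided monoidal category in which all idempotents split, let $A,H$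 be Hopf algebras in $\mathcal C$, and let $i_A: A\to H$, $p_A: H\to A$ be Hopf algebra morphisms with $p_A\circ i_A=\mathrm{id}_A$. Then there exist a Hopf algebra $B$ in the braided category $\mathcal C_A^A$ and morphisms $i_B: B\to H$, $p_B: H\to B$ in $\mathcal C$ such that 1. $p_B\circ i_B=\mathrm{id}_B$ and $i_B\circ p_B=\Pi$, where $\Pi=\cdot_H\circ(i_A S_A p_A\otimes\mathrm{id}_H)\circ\Delta_H: H\to H$ (so $\Pi$ is an idempotent and $B$ splits it); 2. $A\ltimes B$ is a Hopf algebra in $\mathcal C$, and $\theta=\cdot_H\circ(i_A\otimes i_B): A\ltimes B\to H$ is an isomorphism of Hopf algebras, with inverse $(p_A\otimes p_B)\circ\Delta_H$. -/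

import Mathlib

open CategoryTheory MonoidalCategory BraidedCategory

set_option linter.unusedSectionVars false

universe v u

namespace BraidedCross
section
variable {C : Type u} [Category.{v} C] [MonoidalCategory C] [BraidedCategory C]

theorem pull_l {P Q R : C} (f : P ⟶ Q ⊗ R) (Z : C) :
    f ▷ Z ⊗≫ Q ◁ (β_ R Z).hom ⊗≫ (β_ Q Z).hom ▷ R = (β_ P Z).hom ≫ Z ◁ f ⊗≫ 𝟙 _ := by
  have h := braiding_naturality_left f Z
  rw [braiding_tensor_left_hom] at h
  calc _ = (f ▷ Z ≫ (α_ Q R Z).hom ≫ Q ◁ (β_ R Z).hom ≫ (α_ Q Z R).inv ≫ (β_ Q Z).hom ▷ R ≫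
        (α_ Z Q R).hom) ⊗≫ 𝟙 _ := by monoidal
    _ = _ := by rw [h]; monoidal

theorem pull_r {P Q R : C} (f : P ⟶ Q ⊗ R) (Z : C) :
    Z ◁ f ⊗≫ (β_ Z Q).hom ▷ R ⊗≫ Q ◁ (β_ Z R).hom = (β_ Z P).hom ≫ f ▷ Z ⊗≫ 𝟙 _ := by
  have h := braiding_naturality_right Z f
  rw [braiding_tensor_right_hom] at h
  calc _ = (Z ◁ f ≫ (α_ Z Q R).inv ≫ (β_ Z Q).hom ▷ R ≫ (α_ Q Z R).hom ≫ Q ◁ (β_ Z R).hom ≫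
        (α_ Q R Z).inv) ⊗≫ 𝟙 _ := by monoidal
    _ = _ := by rw [h]; monoidal

theorem push_l {P Q R : C} (f : Q ⊗ R ⟶ P) (Z : C) :
    f ▷ Z ≫ (β_ P Z).hom = 𝟙 _ ⊗≫ Q ◁ (β_ R Z).hom ⊗≫ (β_ Q Z).hom ▷ R ⊗≫ Z ◁ f := by
  rw [braiding_naturality_left, braiding_tensor_left_hom]
  monoidal

theorem push_r {P Q R : C} (f : Q ⊗ R ⟶ P) (Z : C) :
    Z ◁ f ≫ (β_ Z P).hom = 𝟙 _ ⊗≫ (β_ Z Q).hom ▷ R ⊗≫ Q ◁ (β_ Z R).hom ⊗≫ f ▷ Z := by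
  rw [braiding_naturality_right, braiding_tensor_right_hom]
  monoidal

theorem braid3 (P Q R : C) :
    P ◁ (β_ Q R).hom ⊗≫ (β_ P R).hom ▷ Q ⊗≫ R ◁ (β_ P Q).hom =
      𝟙 _ ⊗≫ (β_ P Q).hom ▷ R ⊗≫ Q ◁ (β_ P R).hom ⊗≫ (β_ Q R).hom ▷ P ⊗≫ 𝟙 _ := by
  have h := yang_baxter P Q R
  calc _ = 𝟙 _ ⊗≫ (P ◁ (β_ Q R).hom ≫ (α_ P R Q).inv ≫ (β_ P R).hom ▷ Q ≫ (α_ R P Q).hom ≫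
        R ◁ (β_ P Q).hom) := by monoidal
    _ = _ := by rw [← h]; monoidal

/-- The diagonal action of `A` on a tensor product of right modules:
`X ⊗ Y ⊗ A ⟶ X ⊗ Y ⊗ A ⊗ A ⟶ X ⊗ A ⊗ Y ⊗ A ⟶ X ⊗ Y`, with the braiding `Y ⊗ A ⟶ A ⊗ Y`. -/
def tensorAct {A X Y : C} (Δ : A ⟶ A ⊗ A) (aX : X ⊗ A ⟶ X) (aY : Y ⊗ A ⟶ Y) :
    (X ⊗ Y) ⊗ A ⟶ X ⊗ Y :=
  (X ⊗ Y) ◁ Δ ≫ tensorμ X Y A A ≫ (aX ⊗ₘ aY)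

/-- The codiagonal coaction on a tensor product. -/
def tensorCoact {A X Y : C} (m : A ⊗ A ⟶ A) (cX : X ⟶ X ⊗ A) (cY : Y ⟶ Y ⊗ A) :
    X ⊗ Y ⟶ (X ⊗ Y) ⊗ A :=
  (cX ⊗ₘ cY) ≫ tensorμ X A Y A ≫ (X ⊗ Y) ◁ m

/-- The braiding `X ⊗ Y ⟶ Y ⊗ X` of crossed modules: coact on `Y`, braid `X` past `Y`, and let the
coefficient act on `X`. -/
def crossedBraid {A X Y : C} (aX : X ⊗ A ⟶ X) (cY : Y ⟶ Y ⊗ A) : X ⊗ Y ⟶ Y ⊗ X :=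
  X ◁ cY ≫ (α_ X Y A).inv ≫ (β_ X Y).hom ▷ A ≫ (α_ Y X A).hom ≫ Y ◁ aX

/-- The compatibility condition of an action and a coaction in a right crossed module. -/
def CrossedCompat {A X : C} (m : A ⊗ A ⟶ A) (Δ : A ⟶ A ⊗ A) (a : X ⊗ A ⟶ X)
    (c : X ⟶ X ⊗ A) : Prop :=
  X ◁ Δ ≫ (α_ X A A).inv ≫ (β_ X A).hom ▷ A ≫ (α_ A X A).hom ≫ A ◁ a ≫
      A ◁ c ≫ (α_ A X A).inv ≫ (β_ A X).hom ▷ A ≫ (α_ X A A).hom ≫ X ◁ m =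
    (c ⊗ₘ Δ) ≫ tensorμ X A A A ≫ (a ⊗ₘ m)

theorem crossedBraid_act {A X Y : C} (m : A ⊗ A ⟶ A) (Δ : A ⟶ A ⊗ A)
    (aX : X ⊗ A ⟶ X) (aY : Y ⊗ A ⟶ Y) (cY : Y ⟶ Y ⊗ A)
    (hX : aX ▷ A ≫ aX = (α_ X A A).hom ≫ X ◁ m ≫ aX) (hY : CrossedCompat m Δ aY cY) :
    tensorAct Δ aX aY ≫ crossedBraid aX cY = crossedBraid aX cY ▷ A ≫ tensorAct Δ aY aX := by
  simp only [tensorAct, crossedBraid, CrossedCompat, tensorμ, MonoidalCategory.tensorHom_def] at *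
  calc _ = 𝟙 _ ⊗≫ X ◁ Y ◁ Δ ⊗≫ X ◁ (β_ Y A).hom ▷ A ⊗≫ (aX ▷ (Y ⊗ A) ≫ X ◁ (aY ≫ cY)) ⊗≫
           (β_ X Y).hom ▷ A ⊗≫ Y ◁ aX := by monoidal
    _ = 𝟙 _ ⊗≫ X ◁ Y ◁ Δ ⊗≫ X ◁ (β_ Y A).hom ▷ A ⊗≫ X ◁ A ◁ (aY ≫ cY) ⊗≫
           (aX ▷ Y ≫ (β_ X Y).hom) ▷ A ⊗≫ Y ◁ aX := by rw [← whisker_exchange]; monoidal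
    _ = 𝟙 _ ⊗≫ X ◁ Y ◁ Δ ⊗≫ X ◁ (β_ Y A).hom ▷ A ⊗≫ X ◁ A ◁ (aY ≫ cY) ⊗≫
           X ◁ (β_ A Y).hom ▷ A ⊗≫ (β_ X Y).hom ▷ A ▷ A ⊗≫ Y ◁ (aX ▷ A ≫ aX) := by
        rw [push_l]; monoidal
    _ = 𝟙 _ ⊗≫ X ◁ Y ◁ Δ ⊗≫ X ◁ (β_ Y A).hom ▷ A ⊗≫ X ◁ A ◁ (aY ≫ cY) ⊗≫
           X ◁ (β_ A Y).hom ▷ A ⊗≫ ((β_ X Y).hom ▷ (A ⊗ A) ≫ (Y ⊗ X) ◁ m) ⊗≫ Y ◁ aX := by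
        rw [hX]; monoidal
    _ = 𝟙 _ ⊗≫ X ◁ (Y ◁ Δ ≫ (α_ Y A A).inv ≫ (β_ Y A).hom ▷ A ≫ (α_ A Y A).hom ≫ A ◁ aY ≫
          A ◁ cY ≫ (α_ A Y A).inv ≫ (β_ A Y).hom ▷ A ≫ (α_ Y A A).hom ≫ Y ◁ m) ⊗≫
           (β_ X Y).hom ▷ A ⊗≫ Y ◁ aX := by
        rw [← whisker_exchange]; monoidal
    _ = 𝟙 _ ⊗≫ X ◁ cY ▷ A ⊗≫ X ◁ Y ◁ A ◁ Δ ⊗≫ X ◁ Y ◁ (β_ A A).hom ▷ A ⊗≫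
          X ◁ aY ▷ (A ⊗ A) ⊗≫ ((X ⊗ Y) ◁ m ≫ (β_ X Y).hom ▷ A) ⊗≫ Y ◁ aX := by
        rw [hY]; monoidal
    _ = 𝟙 _ ⊗≫ X ◁ cY ▷ A ⊗≫ X ◁ Y ◁ A ◁ Δ ⊗≫ X ◁ Y ◁ (β_ A A).hom ▷ A ⊗≫
          (X ◁ aY ≫ (β_ X Y).hom) ▷ A ▷ A ⊗≫ Y ◁ ((α_ X A A).hom ≫ X ◁ m ≫ aX) := by
        rw [whisker_exchange]; monoidal
    _ = 𝟙 _ ⊗≫ X ◁ cY ▷ A ⊗≫ X ◁ Y ◁ A ◁ Δ ⊗≫ ((X ⊗ Y) ◁ (β_ A A).hom ≫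
          (β_ X Y).hom ▷ (A ⊗ A)) ▷ A ⊗≫ Y ◁ (β_ X A).hom ▷ A ▷ A ⊗≫
          (aY ▷ (X ⊗ A) ≫ Y ◁ aX) ▷ A ⊗≫ Y ◁ aX := by
        rw [push_r, ← hX]; monoidal
    _ = 𝟙 _ ⊗≫ X ◁ cY ▷ A ⊗≫ ((X ⊗ Y ⊗ A) ◁ Δ ≫ ((α_ X Y A).inv ≫ (β_ X Y).hom ▷ A) ▷ (A ⊗ A)) ⊗≫
           Y ◁ X ◁ (β_ A A).hom ▷ A ⊗≫ Y ◁ (β_ X A).hom ▷ A ▷ A ⊗≫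
          Y ◁ A ◁ aX ▷ A ⊗≫ (aY ▷ (X ⊗ A)) ⊗≫ Y ◁ aX := by
        rw [whisker_exchange (β_ X Y).hom (β_ A A).hom, ← whisker_exchange aY aX]; monoidal
    _ = 𝟙 _ ⊗≫ X ◁ cY ▷ A ⊗≫ (β_ X Y).hom ▷ A ▷ A ⊗≫ Y ◁ (X ⊗ A) ◁ Δ ⊗≫
           Y ◁ (aX ▷ A ≫ (β_ X A).hom) ▷ A ⊗≫ (aY ▷ (X ⊗ A)) ⊗≫ Y ◁ aX := by
        rw [whisker_exchange, push_l]; monoidal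
    _ = 𝟙 _ ⊗≫ X ◁ cY ▷ A ⊗≫ (β_ X Y).hom ▷ A ▷ A ⊗≫ Y ◁ (aX ▷ A ≫ X ◁ Δ) ⊗≫
           Y ◁ (β_ X A).hom ▷ A ⊗≫ (aY ▷ (X ⊗ A)) ⊗≫ Y ◁ aX := by
        rw [← whisker_exchange]; monoidal
    _ = _ := by monoidal
end
section
open Opposite
variable {C : Type u} [Category.{v} C] [MonoidalCategory C] [BraidedCategory C]
theorem crossedBraid_coact {A X Y : C} (m : A ⊗ A ⟶ A) (Δ : A ⟶ A ⊗ A)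
    (aX : X ⊗ A ⟶ X) (cX : X ⟶ X ⊗ A) (cY : Y ⟶ Y ⊗ A)
    (hY : cY ≫ cY ▷ A = cY ≫ Y ◁ Δ ≫ (α_ Y A A).inv) (hX : CrossedCompat m Δ aX cX) :
    tensorCoact m cX cY ≫ crossedBraid aX cY ▷ A = crossedBraid aX cY ≫ tensorCoact m cY cX := by
  have := congrArg Quiver.Hom.unop (crossedBraid_act (C := Cᵒᵖ) (A := op A) (X := op Y) (Y := op X)
    Δ.op m.op cY.op cX.op aX.op ?_ ?_)
  · simpa [tensorAct, tensorCoact, crossedBraid, tensorμ] using this.symm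
  · simpa using congrArg Quiver.Hom.op hY
  · simpa [CrossedCompat, tensorμ] using congrArg Quiver.Hom.op hX
end

section
open Opposite
variable {C : Type u} [Category.{v} C] [MonoidalCategory C] [BraidedCategory C]

theorem braid_comul {A Y : C} (Δ : A ⟶ A ⊗ A) (a : Y ⊗ A ⟶ Y)
    (hΔ : Δ ≫ Δ ▷ A = Δ ≫ A ◁ Δ ≫ (α_ A A A).inv) :
    crossedBraid a Δ ≫ Δ ▷ Y = Y ◁ Δ ≫ (α_ Y A A).inv ≫ (β_ Y A).hom ▷ A ≫ (α_ A Y A).hom ≫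
      A ◁ crossedBraid a Δ ≫ (α_ A A Y).inv := by
  simp only [crossedBraid]
  calc _ = 𝟙 _ ⊗≫ Y ◁ Δ ⊗≫ (β_ Y A).hom ▷ A ⊗≫ (A ◁ a ≫ Δ ▷ Y) := by monoidal
    _ = 𝟙 _ ⊗≫ Y ◁ Δ ⊗≫ ((β_ Y A).hom ≫ Δ ▷ Y ⊗≫ 𝟙 (A ⊗ A ⊗ Y)) ▷ A ⊗≫ (A ⊗ A) ◁ a := by
        rw [whisker_exchange]; monoidal
    _ = 𝟙 _ ⊗≫ Y ◁ (Δ ≫ Δ ▷ A) ⊗≫ (β_ Y A).hom ▷ A ▷ A ⊗≫ A ◁ (β_ Y A).hom ▷ A ⊗≫ (A ⊗ A) ◁ a := by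
        rw [← pull_r]; monoidal
    _ = 𝟙 _ ⊗≫ Y ◁ Δ ⊗≫ ((Y ⊗ A) ◁ Δ ≫ (β_ Y A).hom ▷ (A ⊗ A)) ⊗≫
          A ◁ (β_ Y A).hom ▷ A ⊗≫ (A ⊗ A) ◁ a := by
        rw [hΔ]; monoidal
    _ = _ := by rw [whisker_exchange]; monoidal

theorem braid_mul {A Y : C} (m : A ⊗ A ⟶ A) (c : Y ⟶ Y ⊗ A)
    (hm : m ▷ A ≫ m = (α_ A A A).hom ≫ A ◁ m ≫ m) :
    m ▷ Y ≫ crossedBraid m c = (α_ A A Y).hom ≫ A ◁ crossedBraid m c ≫ (α_ A Y A).inv ≫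
      (β_ A Y).hom ▷ A ≫ (α_ Y A A).hom ≫ Y ◁ m := by
  have := congrArg Quiver.Hom.unop (braid_comul (C := Cᵒᵖ) (A := op A) (Y := op Y) m.op c.op ?_)
  · simpa [crossedBraid] using this
  · simpa using congrArg Quiver.Hom.op hm

theorem braid_comul_tensor {A X Y : C} (Δ : A ⟶ A ⊗ A) (aX : X ⊗ A ⟶ X) (aY : Y ⊗ A ⟶ Y)
    (hΔ : Δ ≫ Δ ▷ A = Δ ≫ A ◁ Δ ≫ (α_ A A A).inv) :
    crossedBraid (tensorAct Δ aX aY) Δ = (α_ X Y A).hom ≫ X ◁ crossedBraid aY Δ ≫ (α_ X A Y).inv ≫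
      crossedBraid aX Δ ▷ Y ≫ (α_ A X Y).hom := by
  symm
  calc _ = 𝟙 _ ⊗≫ X ◁ (crossedBraid aY Δ ≫ Δ ▷ Y) ⊗≫ (β_ X A).hom ▷ A ▷ Y ⊗≫ A ◁ aX ▷ Y ⊗≫ 𝟙 _ := by
        rw [crossedBraid.eq_def aX Δ]; monoidal
    _ = 𝟙 _ ⊗≫ X ◁ Y ◁ Δ ⊗≫ X ◁ (β_ Y A).hom ▷ A ⊗≫
          ((X ⊗ A) ◁ crossedBraid aY Δ ≫ (β_ X A).hom ▷ (A ⊗ Y)) ⊗≫ A ◁ aX ▷ Y ⊗≫ 𝟙 _ := by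
        rw [braid_comul _ _ hΔ]; monoidal
    _ = 𝟙 _ ⊗≫ X ◁ Y ◁ Δ ⊗≫ X ◁ (β_ Y A).hom ▷ A ⊗≫ (β_ X A).hom ▷ Y ▷ A ⊗≫
          A ◁ X ◁ Y ◁ Δ ⊗≫ A ◁ X ◁ (β_ Y A).hom ▷ A ⊗≫
          A ◁ ((X ⊗ A) ◁ aY ≫ aX ▷ Y) ⊗≫ 𝟙 _ := by
        rw [whisker_exchange, crossedBraid.eq_def aY Δ]; monoidal
    _ = _ := by
        rw [whisker_exchange]
        simp only [crossedBraid, tensorAct, tensorμ, MonoidalCategory.tensorHom_def, braiding_tensor_left_hom]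
        monoidal

theorem braid_mul_tensor {A X Y : C} (m : A ⊗ A ⟶ A) (cX : X ⟶ X ⊗ A) (cY : Y ⟶ Y ⊗ A)
    (hm : m ▷ A ≫ m = (α_ A A A).hom ≫ A ◁ m ≫ m) :
    crossedBraid m (tensorCoact m cX cY) = (α_ A X Y).inv ≫ crossedBraid m cX ▷ Y ≫ (α_ X A Y).hom ≫
      X ◁ crossedBraid m cY ≫ (α_ X Y A).inv := by
  have := congrArg Quiver.Hom.unop (braid_comul_tensor (C := Cᵒᵖ) (A := op A) (X := op X) (Y := op Y)
    m.op cX.op cY.op ?_)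
  · simpa [crossedBraid, tensorAct, tensorCoact, tensorμ] using this
  · simpa using congrArg Quiver.Hom.op hm

theorem crossed_tensor {A X Y : C} (m : A ⊗ A ⟶ A) (Δ : A ⟶ A ⊗ A)
    (aX : X ⊗ A ⟶ X) (cX : X ⟶ X ⊗ A) (aY : Y ⊗ A ⟶ Y) (cY : Y ⟶ Y ⊗ A)
    (hΔ : Δ ≫ Δ ▷ A = Δ ≫ A ◁ Δ ≫ (α_ A A A).inv)
    (hm : m ▷ A ≫ m = (α_ A A A).hom ≫ A ◁ m ≫ m)
    (hX : CrossedCompat m Δ aX cX) (hY : CrossedCompat m Δ aY cY) :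
    CrossedCompat m Δ (tensorAct Δ aX aY) (tensorCoact m cX cY) := by
  have e : ∀ {Z : C} (a : Z ⊗ A ⟶ Z) (c : Z ⟶ Z ⊗ A), CrossedCompat m Δ a c ↔
      crossedBraid a Δ ≫ crossedBraid m c = 𝟙 _ ⊗≫ c ▷ A ⊗≫ Z ◁ A ◁ Δ ⊗≫ Z ◁ (β_ A A).hom ▷ A ⊗≫
        a ▷ A ▷ A ⊗≫ Z ◁ m := by
    intro Z a c
    have : 𝟙 _ ⊗≫ c ▷ A ⊗≫ Z ◁ A ◁ Δ ⊗≫ Z ◁ (β_ A A).hom ▷ A ⊗≫ a ▷ A ▷ A ⊗≫ Z ◁ m =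
        (c ⊗ₘ Δ) ≫ tensorμ Z A A A ≫ (a ⊗ₘ m) := by
      simp only [tensorμ, MonoidalCategory.tensorHom_def]
      monoidal
    rw [this]
    simp only [CrossedCompat, crossedBraid, Category.assoc]
  rw [e] at hX hY ⊢
  rw [braid_comul_tensor _ _ _ hΔ, braid_mul_tensor _ _ _ hm]
  calc _ = 𝟙 _ ⊗≫ X ◁ crossedBraid aY Δ ⊗≫ (crossedBraid aX Δ ≫ crossedBraid m cX) ▷ Y ⊗≫
          X ◁ crossedBraid m cY ⊗≫ 𝟙 _ := by monoidal
    _ = 𝟙 _ ⊗≫ (X ◁ crossedBraid aY Δ ≫ cX ▷ (A ⊗ Y)) ⊗≫ X ◁ A ◁ Δ ▷ Y ⊗≫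
          X ◁ (β_ A A).hom ▷ A ▷ Y ⊗≫ aX ▷ A ▷ A ▷ Y ⊗≫ X ◁ (m ▷ Y ≫ crossedBraid m cY) ⊗≫ 𝟙 _ := by
        rw [hX]; monoidal
    _ = 𝟙 _ ⊗≫ cX ▷ Y ▷ A ⊗≫ X ◁ A ◁ (crossedBraid aY Δ ≫ Δ ▷ Y) ⊗≫ X ◁ (β_ A A).hom ▷ A ▷ Y ⊗≫
          (aX ▷ (A ⊗ A ⊗ Y) ≫ X ◁ A ◁ crossedBraid m cY) ⊗≫
          X ◁ (β_ A Y).hom ▷ A ⊗≫ X ◁ Y ◁ m ⊗≫ 𝟙 _ := by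
        rw [whisker_exchange, braid_mul _ _ hm]; monoidal
    _ = 𝟙 _ ⊗≫ cX ▷ Y ▷ A ⊗≫ X ◁ A ◁ Y ◁ Δ ⊗≫ X ◁ A ◁ (β_ Y A).hom ▷ A ⊗≫
          X ◁ ((A ⊗ A) ◁ crossedBraid aY Δ ≫ (β_ A A).hom ▷ (A ⊗ Y)) ⊗≫
          X ◁ A ◁ A ◁ crossedBraid m cY ⊗≫ aX ▷ A ▷ Y ▷ A ⊗≫
          X ◁ (β_ A Y).hom ▷ A ⊗≫ X ◁ Y ◁ m ⊗≫ 𝟙 _ := by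
        rw [braid_comul _ _ hΔ, ← whisker_exchange]; monoidal
    _ = 𝟙 _ ⊗≫ cX ▷ Y ▷ A ⊗≫ X ◁ A ◁ Y ◁ Δ ⊗≫ X ◁ A ◁ (β_ Y A).hom ▷ A ⊗≫
          X ◁ (β_ A A).hom ▷ Y ▷ A ⊗≫ X ◁ A ◁ A ◁ (crossedBraid aY Δ ≫ crossedBraid m cY) ⊗≫
          aX ▷ A ▷ Y ▷ A ⊗≫ X ◁ (β_ A Y).hom ▷ A ⊗≫ X ◁ Y ◁ m ⊗≫ 𝟙 _ := by
        rw [whisker_exchange]; monoidal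
    _ = 𝟙 _ ⊗≫ cX ▷ Y ▷ A ⊗≫ X ◁ A ◁ Y ◁ Δ ⊗≫ X ◁ A ◁ (β_ Y A).hom ▷ A ⊗≫
          X ◁ ((β_ A A).hom ▷ (Y ⊗ A) ≫ (A ⊗ A) ◁ (cY ▷ A ⊗≫ Y ◁ A ◁ Δ)) ⊗≫
          X ◁ A ◁ A ◁ Y ◁ (β_ A A).hom ▷ A ⊗≫ X ◁ A ◁ A ◁ aY ▷ A ▷ A ⊗≫
          (X ⊗ A) ◁ A ◁ Y ◁ m ⊗≫
          (aX ▷ (A ⊗ Y ⊗ A) ≫ X ◁ ((α_ A Y A).inv ≫ (β_ A Y).hom ▷ A)) ⊗≫ X ◁ Y ◁ m ⊗≫ 𝟙 _ := by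
        rw [hY]; monoidal
    _ = 𝟙 _ ⊗≫ cX ▷ Y ▷ A ⊗≫ X ◁ A ◁ Y ◁ Δ ⊗≫ X ◁ A ◁ ((β_ Y A).hom ≫ A ◁ cY ⊗≫ 𝟙 ((A ⊗ Y) ⊗ A)) ▷ A ⊗≫
          X ◁ A ◁ A ◁ Y ◁ A ◁ Δ ⊗≫ X ◁ (β_ A A).hom ▷ Y ▷ A ▷ A ▷ A ⊗≫
          X ◁ A ◁ A ◁ Y ◁ (β_ A A).hom ▷ A ⊗≫ X ◁ A ◁ A ◁ aY ▷ A ▷ A ⊗≫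
          X ◁ A ◁ ((A ⊗ Y) ◁ m ≫ (β_ A Y).hom ▷ A) ⊗≫ aX ▷ Y ▷ A ▷ A ⊗≫ X ◁ Y ◁ m ⊗≫ 𝟙 _ := by
        rw [← whisker_exchange, ← whisker_exchange]; monoidal
    _ = 𝟙 _ ⊗≫ cX ▷ Y ▷ A ⊗≫ X ◁ A ◁ (Y ◁ Δ ≫ cY ▷ (A ⊗ A)) ⊗≫
          X ◁ A ◁ ((Y ◁ (β_ A A).hom ⊗≫ (β_ Y A).hom ▷ A) ▷ A ≫ ((A ⊗ Y) ⊗ A) ◁ Δ) ⊗≫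
          X ◁ (β_ A A).hom ▷ Y ▷ A ▷ A ▷ A ⊗≫
          X ◁ A ◁ A ◁ Y ◁ (β_ A A).hom ▷ A ⊗≫ X ◁ A ◁ (A ◁ aY ≫ (β_ A Y).hom) ▷ A ▷ A ⊗≫
          X ◁ A ◁ Y ◁ A ◁ m ⊗≫ aX ▷ Y ▷ A ▷ A ⊗≫ X ◁ Y ◁ m ⊗≫ 𝟙 _ := by
        rw [← pull_l, whisker_exchange (β_ A Y).hom m]; monoidal
    _ = 𝟙 _ ⊗≫ cX ▷ Y ▷ A ⊗≫ X ◁ A ◁ cY ▷ A ⊗≫ X ◁ A ◁ Y ◁ A ◁ (Δ ≫ A ◁ Δ) ⊗≫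
          X ◁ A ◁ Y ◁ (β_ A A).hom ▷ A ▷ A ⊗≫ X ◁ A ◁ (β_ Y A).hom ▷ A ▷ A ▷ A ⊗≫
          X ◁ (β_ A A).hom ▷ Y ▷ A ▷ A ▷ A ⊗≫
          X ◁ A ◁ ((A ⊗ Y) ◁ (β_ A A).hom ≫ (β_ A Y).hom ▷ (A ⊗ A)) ▷ A ⊗≫
          X ◁ A ◁ Y ◁ (β_ A A).hom ▷ A ▷ A ⊗≫
          X ◁ A ◁ (aY ▷ (A ⊗ (A ⊗ A)) ≫ Y ◁ A ◁ m) ⊗≫ aX ▷ Y ▷ A ▷ A ⊗≫ X ◁ Y ◁ m ⊗≫ 𝟙 _ := by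
        rw [← whisker_exchange (Y ◁ (β_ A A).hom ⊗≫ (β_ Y A).hom ▷ A) Δ, whisker_exchange cY Δ, push_r]; monoidal
    _ = 𝟙 _ ⊗≫ cX ▷ Y ▷ A ⊗≫ X ◁ A ◁ cY ▷ A ⊗≫ X ◁ A ◁ Y ◁ A ◁ (Δ ≫ A ◁ Δ) ⊗≫
          X ◁ A ◁ Y ◁ (β_ A A).hom ▷ A ▷ A ⊗≫
          X ◁ (A ◁ (β_ Y A).hom ⊗≫ (β_ A A).hom ▷ Y ⊗≫ A ◁ (β_ A Y).hom) ▷ A ▷ A ▷ A ⊗≫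
          X ◁ A ◁ Y ◁ A ◁ (β_ A A).hom ▷ A ⊗≫ X ◁ A ◁ Y ◁ (β_ A A).hom ▷ A ▷ A ⊗≫
          ((X ⊗ A) ◁ (aY ▷ A ▷ A ▷ A ⊗≫ Y ◁ A ◁ m) ≫ aX ▷ (Y ⊗ A ⊗ A)) ⊗≫ X ◁ Y ◁ m ⊗≫ 𝟙 _ := by
        rw [whisker_exchange (β_ A Y).hom (β_ A A).hom]
        monoidal
    _ = 𝟙 _ ⊗≫ cX ▷ Y ▷ A ⊗≫ X ◁ A ◁ cY ▷ A ⊗≫ X ◁ A ◁ Y ◁ A ◁ (Δ ≫ A ◁ Δ) ⊗≫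
          X ◁ A ◁ Y ◁ (β_ A A).hom ▷ A ▷ A ⊗≫
          X ◁ ((β_ A Y).hom ▷ A ⊗≫ Y ◁ (β_ A A).hom ⊗≫ (β_ Y A).hom ▷ A) ▷ A ▷ A ▷ A ⊗≫
          X ◁ A ◁ Y ◁ A ◁ (β_ A A).hom ▷ A ⊗≫ X ◁ A ◁ Y ◁ (β_ A A).hom ▷ A ▷ A ⊗≫
          aX ▷ Y ▷ A ▷ A ▷ A ▷ A ⊗≫ X ◁ aY ▷ A ▷ A ▷ A ⊗≫ X ◁ Y ◁ (A ◁ m ≫ m) ⊗≫ 𝟙 _ := by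
        rw [whisker_exchange aX, braid3]
        monoidal
    _ = _ := by
        symm
        simp only [tensorAct, tensorCoact, tensorμ, MonoidalCategory.tensorHom_def]
        calc _ = 𝟙 _ ⊗≫ cX ▷ Y ▷ A ⊗≫ X ◁ A ◁ cY ▷ A ⊗≫ X ◁ (β_ A Y).hom ▷ A ▷ A ⊗≫
                (X ⊗ Y) ◁ (m ▷ A ≫ A ◁ Δ) ⊗≫ (X ⊗ Y) ◁ (β_ A A).hom ▷ A ⊗≫
                (X ⊗ Y) ◁ Δ ▷ A ▷ A ⊗≫ X ◁ (β_ Y A).hom ▷ A ▷ A ▷ A ⊗≫ aX ▷ Y ▷ A ▷ A ▷ A ⊗≫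
                X ◁ aY ▷ A ▷ A ⊗≫ X ◁ Y ◁ m ⊗≫ 𝟙 _ := by monoidal
          _ = 𝟙 _ ⊗≫ cX ▷ Y ▷ A ⊗≫ X ◁ A ◁ cY ▷ A ⊗≫ X ◁ (β_ A Y).hom ▷ A ▷ A ⊗≫
                (X ⊗ Y) ◁ (A ⊗ A) ◁ Δ ⊗≫ (X ⊗ Y) ◁ A ◁ (β_ A A).hom ▷ A ⊗≫
                (X ⊗ Y) ◁ (β_ A A).hom ▷ A ▷ A ⊗≫
                (X ⊗ Y) ◁ (A ◁ m ≫ Δ ▷ A) ▷ A ⊗≫ X ◁ (β_ Y A).hom ▷ A ▷ A ▷ A ⊗≫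
                aX ▷ Y ▷ A ▷ A ▷ A ⊗≫ X ◁ aY ▷ A ▷ A ⊗≫ X ◁ Y ◁ m ⊗≫ 𝟙 _ := by
              rw [← whisker_exchange m Δ]
              calc _ = 𝟙 _ ⊗≫ cX ▷ Y ▷ A ⊗≫ X ◁ A ◁ cY ▷ A ⊗≫ X ◁ (β_ A Y).hom ▷ A ▷ A ⊗≫
                    (X ⊗ Y) ◁ (A ⊗ A) ◁ Δ ⊗≫ (X ⊗ Y) ◁ (m ▷ A ≫ (β_ A A).hom) ▷ A ⊗≫
                    (X ⊗ Y) ◁ Δ ▷ A ▷ A ⊗≫ X ◁ (β_ Y A).hom ▷ A ▷ A ▷ A ⊗≫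
                    aX ▷ Y ▷ A ▷ A ▷ A ⊗≫ X ◁ aY ▷ A ▷ A ⊗≫ X ◁ Y ◁ m ⊗≫ 𝟙 _ := by monoidal
                _ = _ := by rw [push_l]; monoidal
          _ = 𝟙 _ ⊗≫ cX ▷ Y ▷ A ⊗≫ X ◁ A ◁ cY ▷ A ⊗≫ X ◁ (β_ A Y).hom ▷ A ▷ A ⊗≫
                (X ⊗ Y) ◁ (A ⊗ A) ◁ Δ ⊗≫ (X ⊗ Y) ◁ A ◁ (β_ A A).hom ▷ A ⊗≫
                (X ⊗ Y) ◁ ((β_ A A).hom ≫ Δ ▷ A ⊗≫ 𝟙 (A ⊗ A ⊗ A)) ▷ A ▷ A ⊗≫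
                (X ⊗ Y) ◁ A ◁ A ◁ m ▷ A ⊗≫ X ◁ (β_ Y A).hom ▷ A ▷ A ▷ A ⊗≫
                aX ▷ Y ▷ A ▷ A ▷ A ⊗≫ X ◁ aY ▷ A ▷ A ⊗≫ X ◁ Y ◁ m ⊗≫ 𝟙 _ := by
              rw [whisker_exchange Δ m]; monoidal
          _ = 𝟙 _ ⊗≫ cX ▷ Y ▷ A ⊗≫ X ◁ A ◁ cY ▷ A ⊗≫ X ◁ (β_ A Y).hom ▷ A ▷ A ⊗≫
                (X ⊗ Y) ◁ (A ⊗ A) ◁ Δ ⊗≫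
                (X ⊗ Y) ◁ A ◁ (β_ A A).hom ▷ A ⊗≫ (X ⊗ Y) ◁ A ◁ Δ ▷ A ▷ A ⊗≫
                (X ⊗ Y) ◁ (β_ A A).hom ▷ A ▷ A ▷ A ⊗≫ (X ⊗ Y) ◁ A ◁ (β_ A A).hom ▷ A ▷ A ⊗≫
                (X ⊗ Y) ◁ A ◁ A ◁ m ▷ A ⊗≫ X ◁ (β_ Y A).hom ▷ A ▷ A ▷ A ⊗≫
                aX ▷ Y ▷ A ▷ A ▷ A ⊗≫ X ◁ aY ▷ A ▷ A ⊗≫ X ◁ Y ◁ m ⊗≫ 𝟙 _ := by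
              rw [← pull_r]; monoidal
          _ = 𝟙 _ ⊗≫ cX ▷ Y ▷ A ⊗≫ X ◁ A ◁ cY ▷ A ⊗≫ X ◁ (β_ A Y).hom ▷ A ▷ A ⊗≫
                (X ⊗ Y) ◁ (A ⊗ A) ◁ Δ ⊗≫
                (X ⊗ Y) ◁ A ◁ ((β_ A A).hom ≫ Δ ▷ A ⊗≫ 𝟙 (A ⊗ A ⊗ A)) ▷ A ⊗≫
                (X ⊗ Y) ◁ (β_ A A).hom ▷ A ▷ A ▷ A ⊗≫ (X ⊗ Y) ◁ A ◁ (β_ A A).hom ▷ A ▷ A ⊗≫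
                (X ⊗ Y) ◁ A ◁ A ◁ m ▷ A ⊗≫ X ◁ (β_ Y A).hom ▷ A ▷ A ▷ A ⊗≫
                aX ▷ Y ▷ A ▷ A ▷ A ⊗≫ X ◁ aY ▷ A ▷ A ⊗≫ X ◁ Y ◁ m ⊗≫ 𝟙 _ := by
              monoidal
          _ = 𝟙 _ ⊗≫ cX ▷ Y ▷ A ⊗≫ X ◁ A ◁ cY ▷ A ⊗≫ X ◁ (β_ A Y).hom ▷ A ▷ A ⊗≫
                (X ⊗ Y) ◁ (A ⊗ A) ◁ (Δ ≫ Δ ▷ A) ⊗≫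
                (X ⊗ Y) ◁ A ◁ (β_ A A).hom ▷ A ▷ A ⊗≫
                (X ⊗ Y) ◁ ((A ⊗ A) ◁ (β_ A A).hom ≫ (β_ A A).hom ▷ (A ⊗ A)) ▷ A ⊗≫
                (X ⊗ Y) ◁ A ◁ (β_ A A).hom ▷ A ▷ A ⊗≫
                ((X ⊗ Y ⊗ A ⊗ A) ◁ (m ▷ A) ≫ ((𝟙 _ ⊗≫ X ◁ (β_ Y A).hom ▷ A ⊗≫
                aX ▷ Y ▷ A ⊗≫ X ◁ aY : X ⊗ Y ⊗ A ⊗ A ⟶ X ⊗ Y) ▷ (A ⊗ A)))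
                 ⊗≫ X ◁ Y ◁ m ⊗≫ 𝟙 _ := by
              rw [← pull_r]; monoidal
          _ = 𝟙 _ ⊗≫ cX ▷ Y ▷ A ⊗≫ X ◁ A ◁ cY ▷ A ⊗≫ X ◁ (β_ A Y).hom ▷ A ▷ A ⊗≫
                (X ⊗ Y) ◁ (A ⊗ A) ◁ (Δ ≫ A ◁ Δ) ⊗≫
                (X ⊗ Y) ◁ A ◁ (β_ A A).hom ▷ A ▷ A ⊗≫
                (X ⊗ Y) ◁ (β_ A A).hom ▷ A ▷ A ▷ A ⊗≫
                X ◁ ((Y ⊗ A) ◁ (A ◁ (β_ A A).hom ⊗≫ (β_ A A).hom ▷ A) ≫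
                  (β_ Y A).hom ▷ ((A ⊗ A) ⊗ A)) ▷ A ⊗≫
                aX ▷ Y ▷ A ▷ A ▷ A ▷ A ⊗≫ X ◁ aY ▷ A ▷ A ▷ A
                 ⊗≫ X ◁ Y ◁ (m ▷ A ≫ m) ⊗≫ 𝟙 _ := by
              rw [whisker_exchange _ (m ▷ A), hΔ, whisker_exchange (β_ A A).hom (β_ A A).hom]
              monoidal
          _ = 𝟙 _ ⊗≫ cX ▷ Y ▷ A ⊗≫ X ◁ A ◁ cY ▷ A ⊗≫
                X ◁ ((β_ A Y).hom ▷ (A ⊗ A) ≫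
                (Y ⊗ A) ◁ (A ◁ (Δ ≫ A ◁ Δ) ⊗≫ (β_ A A).hom ▷ A ▷ A)) ⊗≫
                (X ⊗ Y) ◁ (β_ A A).hom ▷ A ▷ A ▷ A ⊗≫
                X ◁ (β_ Y A).hom ▷ A ▷ A ▷ A ▷ A ⊗≫
                X ◁ A ◁ Y ◁ A ◁ (β_ A A).hom ▷ A ⊗≫ X ◁ A ◁ Y ◁ (β_ A A).hom ▷ A ▷ A ⊗≫
                aX ▷ Y ▷ A ▷ A ▷ A ▷ A ⊗≫ X ◁ aY ▷ A ▷ A ▷ A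
                 ⊗≫ X ◁ Y ◁ (m ▷ A ≫ m) ⊗≫ 𝟙 _ := by
              rw [whisker_exchange (β_ Y A).hom]
              monoidal
          _ = _ := by
              rw [← whisker_exchange (β_ A Y).hom, hm]
              monoidal
end

section
open Opposite
variable {C : Type u} [Category.{v} C] [MonoidalCategory C] [BraidedCategory C]

theorem tensorAct_one {A X Y : C} (η : 𝟙_ C ⟶ A) (Δ : A ⟶ A ⊗ A)
    (aX : X ⊗ A ⟶ X) (aY : Y ⊗ A ⟶ Y)
    (h : η ≫ Δ = (λ_ (𝟙_ C)).inv ≫ (η ⊗ₘ η))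
    (hX : X ◁ η ≫ aX = (ρ_ X).hom) (hY : Y ◁ η ≫ aY = (ρ_ Y).hom) :
    (X ⊗ Y) ◁ η ≫ tensorAct Δ aX aY = (ρ_ (X ⊗ Y)).hom := by
  rw [tensorAct, ← whiskerLeft_comp_assoc, h, whiskerLeft_comp_assoc,
    tensorμ_natural_right_assoc, tensorHom_comp_tensorHom, hX, hY, ← tensor_right_unitality]

theorem tensorAct_mul {A X Y : C} (m : A ⊗ A ⟶ A) (Δ : A ⟶ A ⊗ A)
    (aX : X ⊗ A ⟶ X) (aY : Y ⊗ A ⟶ Y)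
    (h : m ≫ Δ = (Δ ⊗ₘ Δ) ≫ tensorμ A A A A ≫ (m ⊗ₘ m))
    (hX : aX ▷ A ≫ aX = (α_ X A A).hom ≫ X ◁ m ≫ aX)
    (hY : aY ▷ A ≫ aY = (α_ Y A A).hom ≫ Y ◁ m ≫ aY) :
    tensorAct Δ aX aY ▷ A ≫ tensorAct Δ aX aY =
      (α_ (X ⊗ Y) A A).hom ≫ (X ⊗ Y) ◁ m ≫ tensorAct Δ aX aY := by
  simp only [tensorAct]
  rw [← whiskerLeft_comp_assoc _ m Δ, h]
  simp only [comp_whiskerRight, whiskerLeft_comp, Category.assoc]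
  rw [← whisker_exchange_assoc, tensorμ_natural_left_assoc, tensorμ_natural_right_assoc,
    tensorHom_comp_tensorHom, tensorHom_comp_tensorHom, hX, hY,
    ← tensorHom_comp_tensorHom, ← tensorHom_comp_tensorHom, ← whisker_exchange_assoc,
    tensor_associativity_assoc, tensorHom_comp_tensorHom]
  simp only [MonoidalCategory.tensorHom_def]
  monoidal

theorem tensorAct_assoc {A X Y Z : C} (Δ : A ⟶ A ⊗ A)
    (aX : X ⊗ A ⟶ X) (aY : Y ⊗ A ⟶ Y) (aZ : Z ⊗ A ⟶ Z)
    (hΔ : Δ ≫ Δ ▷ A = Δ ≫ A ◁ Δ ≫ (α_ A A A).inv) :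
    tensorAct Δ (tensorAct Δ aX aY) aZ ≫ (α_ X Y Z).hom =
      (α_ X Y Z).hom ▷ A ≫ tensorAct Δ aX (tensorAct Δ aY aZ) := by
  have e : tensorAct Δ (tensorAct Δ aX aY) aZ =
      ((X ⊗ Y) ⊗ Z) ◁ (Δ ≫ (Δ ⊗ₘ 𝟙 A)) ≫ tensorμ (X ⊗ Y) Z (A ⊗ A) A ≫
        tensorμ X Y A A ▷ (Z ⊗ A) ≫ ((aX ⊗ₘ aY) ⊗ₘ aZ) := by
    rw [tensorAct, whiskerLeft_comp_assoc, tensorμ_natural_right_assoc]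
    simp only [tensorAct, MonoidalCategory.tensorHom_def]
    monoidal
  have e' : tensorAct Δ aX (tensorAct Δ aY aZ) =
      (X ⊗ Y ⊗ Z) ◁ (Δ ≫ (𝟙 A ⊗ₘ Δ)) ≫ tensorμ X (Y ⊗ Z) A (A ⊗ A) ≫
        (X ⊗ A) ◁ tensorμ Y Z A A ≫ (aX ⊗ₘ (aY ⊗ₘ aZ)) := by
    rw [tensorAct, whiskerLeft_comp_assoc, tensorμ_natural_right_assoc]
    simp only [tensorAct, MonoidalCategory.tensorHom_def']
    monoidal
  rw [e, e']
  simp only [Category.assoc, associator_naturality]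
  rw [associator_monoidal_assoc, tensorHom_id, hΔ, id_tensorHom]
  calc _ = ((X ⊗ Y) ⊗ Z) ◁ (Δ ≫ A ◁ Δ ≫ (α_ A A A).inv ≫ (α_ A A A).hom) ≫
          (α_ X Y Z).hom ▷ (A ⊗ A ⊗ A) ≫ tensorμ X (Y ⊗ Z) A (A ⊗ A) ≫
          (X ⊗ A) ◁ tensorμ Y Z A A ≫ (aX ⊗ₘ (aY ⊗ₘ aZ)) := by
        simp only [MonoidalCategory.tensorHom_def]
        monoidal
    _ = _ := by
        rw [Iso.inv_hom_id, Category.comp_id, whisker_exchange_assoc]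

theorem hexagon_fwd {A X Y Z : C} (m : A ⊗ A ⟶ A)
    (aX : X ⊗ A ⟶ X) (cY : Y ⟶ Y ⊗ A) (cZ : Z ⟶ Z ⊗ A)
    (hX : aX ▷ A ≫ aX = (α_ X A A).hom ≫ X ◁ m ≫ aX) :
    (α_ X Y Z).hom ≫ crossedBraid aX (tensorCoact m cY cZ) ≫ (α_ Y Z X).hom =
      crossedBraid aX cY ▷ Z ≫ (α_ Y X Z).hom ≫ Y ◁ crossedBraid aX cZ := by
  symm
  simp only [crossedBraid, tensorCoact, tensorμ, MonoidalCategory.tensorHom_def,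
    braiding_tensor_right_hom]
  calc _ = 𝟙 _ ⊗≫ X ◁ cY ▷ Z ⊗≫ (β_ X Y).hom ▷ A ▷ Z ⊗≫ Y ◁ (aX ▷ Z ≫ X ◁ cZ) ⊗≫
          Y ◁ (β_ X Z).hom ▷ A ⊗≫ Y ◁ Z ◁ aX ⊗≫ 𝟙 _ := by monoidal
    _ = 𝟙 _ ⊗≫ X ◁ cY ▷ Z ⊗≫ (β_ X Y).hom ▷ A ▷ Z ⊗≫ Y ◁ X ◁ A ◁ cZ ⊗≫
          Y ◁ (aX ▷ Z ≫ (β_ X Z).hom) ▷ A ⊗≫ Y ◁ Z ◁ aX ⊗≫ 𝟙 _ := by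
        rw [← whisker_exchange]; monoidal
    _ = 𝟙 _ ⊗≫ X ◁ cY ▷ Z ⊗≫ ((β_ X Y).hom ▷ (A ⊗ Z) ≫ (Y ⊗ X) ◁ (A ◁ cZ ⊗≫
          (β_ A Z).hom ▷ A)) ⊗≫ Y ◁ (β_ X Z).hom ▷ A ▷ A ⊗≫ Y ◁ Z ◁ (aX ▷ A ≫ aX) ⊗≫ 𝟙 _ := by
        rw [push_l]; monoidal
    _ = 𝟙 _ ⊗≫ X ◁ cY ▷ Z ⊗≫ X ◁ Y ◁ A ◁ cZ ⊗≫ X ◁ Y ◁ (β_ A Z).hom ▷ A ⊗≫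
          (β_ X Y).hom ▷ Z ▷ A ▷ A ⊗≫
          Y ◁ ((β_ X Z).hom ▷ (A ⊗ A) ≫ (Z ⊗ X) ◁ m) ⊗≫ Y ◁ Z ◁ aX ⊗≫ 𝟙 _ := by
        rw [← whisker_exchange, hX]; monoidal
    _ = 𝟙 _ ⊗≫ X ◁ cY ▷ Z ⊗≫ X ◁ Y ◁ A ◁ cZ ⊗≫ X ◁ Y ◁ (β_ A Z).hom ▷ A ⊗≫
          ((β_ X Y).hom ▷ (Z ⊗ A ⊗ A) ≫ (Y ⊗ X) ◁ Z ◁ m) ⊗≫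
          Y ◁ (β_ X Z).hom ▷ A ⊗≫ Y ◁ Z ◁ aX ⊗≫ 𝟙 _ := by
        rw [← whisker_exchange]; monoidal
    _ = _ := by
        rw [← whisker_exchange]; monoidal

theorem hexagon_rev {A X Y Z : C} (Δ : A ⟶ A ⊗ A)
    (aX : X ⊗ A ⟶ X) (aY : Y ⊗ A ⟶ Y) (cZ : Z ⟶ Z ⊗ A)
    (hZ : cZ ≫ cZ ▷ A = cZ ≫ Z ◁ Δ ≫ (α_ Z A A).inv) :
    (α_ X Y Z).inv ≫ crossedBraid (tensorAct Δ aX aY) cZ ≫ (α_ Z X Y).inv =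
      X ◁ crossedBraid aY cZ ≫ (α_ X Z Y).inv ≫ crossedBraid aX cZ ▷ Y := by
  have := congrArg Quiver.Hom.unop (hexagon_fwd (C := Cᵒᵖ) (A := op A) (X := op Z) (Y := op X)
    (Z := op Y) Δ.op cZ.op aX.op aY.op ?_)
  · simpa [tensorAct, tensorCoact, crossedBraid, tensorμ] using this
  · simpa using congrArg Quiver.Hom.op hZ

theorem tensorCoact_counit {A X Y : C} (ε : A ⟶ 𝟙_ C) (m : A ⊗ A ⟶ A)
    (cX : X ⟶ X ⊗ A) (cY : Y ⟶ Y ⊗ A)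
    (h : m ≫ ε = (ε ⊗ₘ ε) ≫ (λ_ (𝟙_ C)).hom)
    (hX : cX ≫ X ◁ ε = (ρ_ X).inv) (hY : cY ≫ Y ◁ ε = (ρ_ Y).inv) :
    tensorCoact m cX cY ≫ (X ⊗ Y) ◁ ε = (ρ_ (X ⊗ Y)).inv := by
  have := congrArg Quiver.Hom.unop (tensorAct_one (C := Cᵒᵖ) (A := op A) (X := op X) (Y := op Y)
    ε.op m.op cX.op cY.op ?_ ?_ ?_)
  · simpa [tensorAct, tensorCoact, tensorμ] using this
  · simpa using congrArg Quiver.Hom.op h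
  · simpa using congrArg Quiver.Hom.op hX
  · simpa using congrArg Quiver.Hom.op hY

theorem tensorCoact_comul {A X Y : C} (m : A ⊗ A ⟶ A) (Δ : A ⟶ A ⊗ A)
    (cX : X ⟶ X ⊗ A) (cY : Y ⟶ Y ⊗ A)
    (h : m ≫ Δ = (Δ ⊗ₘ Δ) ≫ tensorμ A A A A ≫ (m ⊗ₘ m))
    (hX : cX ≫ cX ▷ A = cX ≫ X ◁ Δ ≫ (α_ X A A).inv)
    (hY : cY ≫ cY ▷ A = cY ≫ Y ◁ Δ ≫ (α_ Y A A).inv) :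
    tensorCoact m cX cY ≫ tensorCoact m cX cY ▷ A =
      tensorCoact m cX cY ≫ (X ⊗ Y) ◁ Δ ≫ (α_ (X ⊗ Y) A A).inv := by
  have := congrArg Quiver.Hom.unop (tensorAct_mul (C := Cᵒᵖ) (A := op A) (X := op X) (Y := op Y)
    Δ.op m.op cX.op cY.op ?_ ?_ ?_)
  · simpa [tensorAct, tensorCoact, tensorμ] using this
  · simpa [tensorμ] using congrArg Quiver.Hom.op h
  · simpa using congrArg Quiver.Hom.op hX
  · simpa using congrArg Quiver.Hom.op hY

theorem tensorCoact_assoc {A X Y Z : C} (m : A ⊗ A ⟶ A)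
    (cX : X ⟶ X ⊗ A) (cY : Y ⟶ Y ⊗ A) (cZ : Z ⟶ Z ⊗ A)
    (hm : m ▷ A ≫ m = (α_ A A A).hom ≫ A ◁ m ≫ m) :
    tensorCoact m (tensorCoact m cX cY) cZ ≫ (α_ X Y Z).hom ▷ A =
      (α_ X Y Z).hom ≫ tensorCoact m cX (tensorCoact m cY cZ) := by
  have := congrArg Quiver.Hom.unop (tensorAct_assoc (C := Cᵒᵖ) (A := op A) (X := op X) (Y := op Y)
    (Z := op Z) m.op cX.op cY.op cZ.op ?_)
  · have h2 : (α_ X Y Z).inv ≫ tensorCoact m (tensorCoact m cX cY) cZ =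
        tensorCoact m cX (tensorCoact m cY cZ) ≫ (α_ X Y Z).inv ▷ A := by
      simpa [tensorAct, tensorCoact, tensorμ] using this
    rw [← Iso.inv_comp_eq, ← Category.assoc, h2]
    simp
  · simpa using congrArg Quiver.Hom.op hm

/-- Auxiliary map: with `f = 𝟙 A` it is the braiding of crossed modules up to the braiding of `C`,
with `f` the inverse of the antipode it is the inverse of that map. -/
def braidAux {A X Y : C} (f : A ⟶ A) (a : X ⊗ A ⟶ X) (c : Y ⟶ Y ⊗ A) : X ⊗ Y ⟶ X ⊗ Y :=
  X ◁ (c ≫ Y ◁ f ≫ (β_ A Y).inv) ≫ (α_ X A Y).inv ≫ a ▷ Y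

theorem crossedBraid_eq {A X Y : C} (a : X ⊗ A ⟶ X) (c : Y ⟶ Y ⊗ A) :
    crossedBraid a c = braidAux (𝟙 A) a c ≫ (β_ X Y).hom := by
  symm
  calc _ = 𝟙 _ ⊗≫ X ◁ c ⊗≫ X ◁ (β_ A Y).inv ⊗≫ (a ▷ Y ≫ (β_ X Y).hom) := by
        simp only [braidAux]; monoidal
    _ = 𝟙 _ ⊗≫ X ◁ c ⊗≫ X ◁ ((β_ A Y).inv ≫ (β_ A Y).hom) ⊗≫ (β_ X Y).hom ▷ A ⊗≫ Y ◁ a := by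
        rw [push_l]; monoidal
    _ = _ := by rw [Iso.inv_hom_id]; simp only [crossedBraid]; monoidal

theorem braidAux_comp {A X Y : C} (m : A ⊗ A ⟶ A) (Δ : A ⟶ A ⊗ A) (f g : A ⟶ A)
    (a : X ⊗ A ⟶ X) (c : Y ⟶ Y ⊗ A)
    (hX : a ▷ A ≫ a = (α_ X A A).hom ≫ X ◁ m ≫ a)
    (hY : c ≫ c ▷ A = c ≫ Y ◁ Δ ≫ (α_ Y A A).inv) :
    braidAux f a c ≫ braidAux g a c = braidAux (Δ ≫ (β_ A A).inv ≫ (f ⊗ₘ g) ≫ m) a c := by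
  have h1 := braiding_inv_naturality_left c A
  rw [braiding_tensor_right_inv] at h1
  have h2 := braiding_inv_naturality_right Y m
  rw [braiding_tensor_left_inv] at h2
  calc _ = 𝟙 _ ⊗≫ X ◁ c ⊗≫ X ◁ Y ◁ f ⊗≫ X ◁ (β_ A Y).inv ⊗≫
          (a ▷ Y ≫ X ◁ (c ≫ Y ◁ g ≫ (β_ A Y).inv)) ⊗≫ a ▷ Y := by
        simp only [braidAux]; monoidal
    _ = 𝟙 _ ⊗≫ X ◁ c ⊗≫ X ◁ Y ◁ f ⊗≫ X ◁ ((β_ A Y).inv ≫ A ◁ c) ⊗≫ X ◁ A ◁ Y ◁ g ⊗≫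
          X ◁ A ◁ (β_ A Y).inv ⊗≫ (a ▷ A ≫ a) ▷ Y := by
        rw [← whisker_exchange]; monoidal
    _ = 𝟙 _ ⊗≫ X ◁ c ⊗≫ X ◁ (Y ◁ f ≫ c ▷ A) ⊗≫ X ◁ Y ◁ (β_ A A).inv ⊗≫
          X ◁ ((β_ A Y).inv ▷ A ≫ (A ⊗ Y) ◁ g) ⊗≫
          X ◁ A ◁ (β_ A Y).inv ⊗≫ X ◁ m ▷ Y ⊗≫ a ▷ Y := by
        rw [← h1, hX]; monoidal
    _ = 𝟙 _ ⊗≫ X ◁ (c ≫ c ▷ A) ⊗≫ X ◁ Y ◁ (A ◁ f ≫ (β_ A A).inv) ⊗≫ X ◁ Y ◁ A ◁ g ⊗≫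
          X ◁ (((α_ Y A A).inv ≫ (β_ A Y).inv ▷ A ≫ (α_ A Y A).hom ≫ A ◁ (β_ A Y).inv ≫
          (α_ A A Y).inv) ≫ m ▷ Y) ⊗≫ a ▷ Y := by
        rw [whisker_exchange c f, ← whisker_exchange (β_ A Y).inv g]; monoidal
    _ = _ := by
        rw [hY, braiding_inv_naturality_right]
        calc _ = 𝟙 _ ⊗≫ X ◁ c ⊗≫ X ◁ Y ◁ Δ ⊗≫ X ◁ Y ◁ (β_ A A).inv ⊗≫ X ◁ Y ◁ f ▷ A ⊗≫
              X ◁ Y ◁ A ◁ g ⊗≫ X ◁ (((α_ Y A A).inv ≫ (β_ A Y).inv ▷ A ≫ (α_ A Y A).hom ≫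
              A ◁ (β_ A Y).inv ≫ (α_ A A Y).inv) ≫ m ▷ Y) ⊗≫ a ▷ Y := by monoidal
          _ = _ := by
            rw [← h2]
            simp only [braidAux, MonoidalCategory.tensorHom_def]
            monoidal

theorem braidAux_unit {A X Y : C} (η : 𝟙_ C ⟶ A) (ε : A ⟶ 𝟙_ C)
    (a : X ⊗ A ⟶ X) (c : Y ⟶ Y ⊗ A)
    (hX : X ◁ η ≫ a = (ρ_ X).hom) (hY : c ≫ Y ◁ ε = (ρ_ Y).inv) :
    braidAux (ε ≫ η) a c = 𝟙 _ := by
  rw [braidAux, whiskerLeft_comp_assoc Y, braiding_inv_naturality_right, reassoc_of% hY,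
    braiding_inv_tensorUnit_left]
  calc _ = 𝟙 _ ⊗≫ (X ◁ η ≫ a) ▷ Y := by monoidal
    _ = _ := by rw [hX]; monoidal

theorem unit_crossed {A : C} (η : 𝟙_ C ⟶ A) (ε : A ⟶ 𝟙_ C) (m : A ⊗ A ⟶ A) (Δ : A ⟶ A ⊗ A)
    (h1 : Δ ≫ A ◁ ε = (ρ_ A).inv) (h2 : Δ ≫ ε ▷ A = (λ_ A).inv)
    (h3 : A ◁ η ≫ m = (ρ_ A).hom) (h4 : η ▷ A ≫ m = (λ_ A).hom) :
    CrossedCompat m Δ (𝟙_ C ◁ ε ≫ (λ_ (𝟙_ C)).hom) ((λ_ (𝟙_ C)).inv ≫ 𝟙_ C ◁ η) := by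
  simp only [CrossedCompat, braiding_tensorUnit_left, braiding_tensorUnit_right, tensorμ,
    MonoidalCategory.tensorHom_def]
  calc _ = 𝟙 _ ⊗≫ (Δ ≫ A ◁ ε) ⊗≫ (A ◁ η ≫ m) ⊗≫ 𝟙 _ := by monoidal
    _ = 𝟙 _ := by rw [h1, h3]; monoidal
    _ = 𝟙 _ ⊗≫ (Δ ≫ ε ▷ A) ⊗≫ (η ▷ A ≫ m) ⊗≫ 𝟙 _ := by rw [h2, h4]; monoidal
    _ = 𝟙 _ ⊗≫ Δ ⊗≫ (ε ▷ A ≫ 𝟙_ C ◁ ((λ_ A).inv ≫ η ▷ A)) ⊗≫ m ⊗≫ 𝟙 _ := by monoidal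
    _ = 𝟙 _ ⊗≫ Δ ⊗≫ ((β_ (𝟙_ C) A).hom ≫ A ◁ η) ▷ A ⊗≫ ε ▷ A ▷ A ⊗≫ m ⊗≫ 𝟙 _ := by
        rw [← whisker_exchange, braiding_tensorUnit_left]; monoidal
    _ = 𝟙 _ ⊗≫ (𝟙_ C ◁ Δ ≫ η ▷ (A ⊗ A)) ⊗≫ (β_ A A).hom ▷ A ⊗≫ ε ▷ A ▷ A ⊗≫ m ⊗≫ 𝟙 _ := by
        rw [← braiding_naturality_left]; monoidal
    _ = _ := by rw [whisker_exchange]; monoidal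

theorem unit_act_mul {A : C} (ε : A ⟶ 𝟙_ C) (m : A ⊗ A ⟶ A)
    (h : m ≫ ε = (ε ⊗ₘ ε) ≫ (λ_ (𝟙_ C)).hom) :
    (𝟙_ C ◁ ε ≫ (λ_ (𝟙_ C)).hom) ▷ A ≫ (𝟙_ C ◁ ε ≫ (λ_ (𝟙_ C)).hom) =
      (α_ (𝟙_ C) A A).hom ≫ 𝟙_ C ◁ m ≫ (𝟙_ C ◁ ε ≫ (λ_ (𝟙_ C)).hom) := by
  rw [← whiskerLeft_comp_assoc _ m, h, MonoidalCategory.tensorHom_def]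
  monoidal

theorem unit_coact_comul {A : C} (η : 𝟙_ C ⟶ A) (Δ : A ⟶ A ⊗ A)
    (h : η ≫ Δ = (λ_ (𝟙_ C)).inv ≫ (η ⊗ₘ η)) :
    ((λ_ (𝟙_ C)).inv ≫ 𝟙_ C ◁ η) ≫ ((λ_ (𝟙_ C)).inv ≫ 𝟙_ C ◁ η) ▷ A =
      ((λ_ (𝟙_ C)).inv ≫ 𝟙_ C ◁ η) ≫ 𝟙_ C ◁ Δ ≫ (α_ (𝟙_ C) A A).inv := by
  rw [Category.assoc, Category.assoc, ← whiskerLeft_comp_assoc _ η Δ, h,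
    MonoidalCategory.tensorHom_def']
  monoidal

theorem leftUnitor_act {A X : C} (ε : A ⟶ 𝟙_ C) (Δ : A ⟶ A ⊗ A) (a : X ⊗ A ⟶ X)
    (h2 : Δ ≫ ε ▷ A = (λ_ A).inv) :
    tensorAct Δ (𝟙_ C ◁ ε ≫ (λ_ (𝟙_ C)).hom) a ≫ (λ_ X).hom = (λ_ X).hom ▷ A ≫ a := by
  simp only [tensorAct, tensorμ, MonoidalCategory.tensorHom_def]
  calc _ = 𝟙 _ ⊗≫ X ◁ Δ ⊗≫ ((β_ X A).hom ≫ ε ▷ X) ▷ A ⊗≫ a ⊗≫ 𝟙 _ := by monoidal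
    _ = 𝟙 _ ⊗≫ X ◁ (Δ ≫ ε ▷ A) ⊗≫ a ⊗≫ 𝟙 _ := by
        rw [← braiding_naturality_right, braiding_tensorUnit_right]; monoidal
    _ = _ := by rw [h2]; monoidal

theorem rightUnitor_act {A X : C} (ε : A ⟶ 𝟙_ C) (Δ : A ⟶ A ⊗ A) (a : X ⊗ A ⟶ X)
    (h1 : Δ ≫ A ◁ ε = (ρ_ A).inv) :
    tensorAct Δ a (𝟙_ C ◁ ε ≫ (λ_ (𝟙_ C)).hom) ≫ (ρ_ X).hom = (ρ_ X).hom ▷ A ≫ a := by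
  simp only [tensorAct, tensorμ, MonoidalCategory.tensorHom_def, braiding_tensorUnit_left]
  calc _ = 𝟙 _ ⊗≫ X ◁ Δ ⊗≫ (a ▷ A ≫ X ◁ ε) ⊗≫ 𝟙 _ := by monoidal
    _ = 𝟙 _ ⊗≫ X ◁ (Δ ≫ A ◁ ε) ⊗≫ a ⊗≫ 𝟙 _ := by
        rw [← whisker_exchange]; monoidal
    _ = _ := by rw [h1]; monoidal

theorem leftUnitor_coact {A X : C} (η : 𝟙_ C ⟶ A) (m : A ⊗ A ⟶ A) (c : X ⟶ X ⊗ A)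
    (h4 : η ▷ A ≫ m = (λ_ A).hom) :
    tensorCoact m ((λ_ (𝟙_ C)).inv ≫ 𝟙_ C ◁ η) c ≫ (λ_ X).hom ▷ A = (λ_ X).hom ≫ c := by
  simp only [tensorCoact, tensorμ, MonoidalCategory.tensorHom_def']
  calc _ = 𝟙 _ ⊗≫ c ⊗≫ (η ▷ X ≫ (β_ A X).hom) ▷ A ⊗≫ X ◁ m ⊗≫ 𝟙 _ := by monoidal
    _ = 𝟙 _ ⊗≫ c ⊗≫ X ◁ (η ▷ A ≫ m) ⊗≫ 𝟙 _ := by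
        rw [braiding_naturality_left, braiding_tensorUnit_left]; monoidal
    _ = _ := by rw [h4]; monoidal

theorem rightUnitor_coact {A X : C} (η : 𝟙_ C ⟶ A) (m : A ⊗ A ⟶ A) (c : X ⟶ X ⊗ A)
    (h3 : A ◁ η ≫ m = (ρ_ A).hom) :
    tensorCoact m c ((λ_ (𝟙_ C)).inv ≫ 𝟙_ C ◁ η) ≫ (ρ_ X).hom ▷ A = (ρ_ X).hom ≫ c := by
  simp only [tensorCoact, tensorμ, MonoidalCategory.tensorHom_def', braiding_tensorUnit_right]
  calc _ = 𝟙 _ ⊗≫ (X ◁ η ≫ c ▷ A) ⊗≫ X ◁ m ⊗≫ 𝟙 _ := by monoidal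
    _ = 𝟙 _ ⊗≫ c ⊗≫ X ◁ (A ◁ η ≫ m) ⊗≫ 𝟙 _ := by
        rw [whisker_exchange]; monoidal
    _ = _ := by rw [h3]; monoidal

theorem tensorAct_natural {A X X' Y Y' : C} (Δ : A ⟶ A ⊗ A)
    (aX : X ⊗ A ⟶ X) (aX' : X' ⊗ A ⟶ X') (aY : Y ⊗ A ⟶ Y) (aY' : Y' ⊗ A ⟶ Y')
    (f : X ⟶ X') (g : Y ⟶ Y') (hf : aX ≫ f = f ▷ A ≫ aX') (hg : aY ≫ g = g ▷ A ≫ aY') :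
    tensorAct Δ aX aY ≫ (f ⊗ₘ g) = (f ⊗ₘ g) ▷ A ≫ tensorAct Δ aX' aY' := by
  simp only [tensorAct, Category.assoc]
  rw [← whisker_exchange_assoc, tensorμ_natural_left_assoc, tensorHom_comp_tensorHom,
    tensorHom_comp_tensorHom, hf, hg]

theorem tensorCoact_natural {A X X' Y Y' : C} (m : A ⊗ A ⟶ A)
    (cX : X ⟶ X ⊗ A) (cX' : X' ⟶ X' ⊗ A) (cY : Y ⟶ Y ⊗ A) (cY' : Y' ⟶ Y' ⊗ A)
    (f : X ⟶ X') (g : Y ⟶ Y') (hf : cX ≫ f ▷ A = f ≫ cX') (hg : cY ≫ g ▷ A = g ≫ cY') :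
    tensorCoact m cX cY ≫ (f ⊗ₘ g) ▷ A = (f ⊗ₘ g) ≫ tensorCoact m cX' cY' := by
  have := congrArg Quiver.Hom.unop (tensorAct_natural (C := Cᵒᵖ) (A := op A) (X := op X')
    (X' := op X) (Y := op Y') (Y' := op Y) m.op cX'.op cX.op cY'.op cY.op f.op g.op ?_ ?_)
  · simpa [tensorAct, tensorCoact, tensorμ] using this.symm
  · simpa using congrArg Quiver.Hom.op hf.symm
  · simpa using congrArg Quiver.Hom.op hg.symm

theorem crossedBraid_natural_right {A X Y Y' : C} (aX : X ⊗ A ⟶ X)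
    (cY : Y ⟶ Y ⊗ A) (cY' : Y' ⟶ Y' ⊗ A) (f : Y ⟶ Y') (h : cY ≫ f ▷ A = f ≫ cY') :
    X ◁ f ≫ crossedBraid aX cY' = crossedBraid aX cY ≫ f ▷ X := by
  simp only [crossedBraid, Category.assoc]
  rw [← whiskerLeft_comp_assoc X f, ← h, whisker_exchange]
  calc _ = 𝟙 _ ⊗≫ X ◁ cY ⊗≫ (X ◁ f ≫ (β_ X Y').hom) ▷ A ⊗≫ Y' ◁ aX := by monoidal
    _ = _ := by rw [braiding_naturality_right]; monoidal

theorem crossedBraid_natural_left {A X X' Y : C} (aX : X ⊗ A ⟶ X) (aX' : X' ⊗ A ⟶ X')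
    (cY : Y ⟶ Y ⊗ A) (f : X ⟶ X') (h : aX ≫ f = f ▷ A ≫ aX') :
    f ▷ Y ≫ crossedBraid aX' cY = crossedBraid aX cY ≫ Y ◁ f := by
  simp only [crossedBraid, Category.assoc]
  rw [← whiskerLeft_comp Y aX, h, ← whisker_exchange_assoc]
  calc _ = 𝟙 _ ⊗≫ X ◁ cY ⊗≫ (f ▷ Y ≫ (β_ X' Y).hom) ▷ A ⊗≫ Y ◁ aX' := by monoidal
    _ = _ := by rw [braiding_naturality_left]; monoidal
end

open scoped MonObj ComonObj HopfObj

section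
variable {C : Type u} [Category.{v} C] [MonoidalCategory C] [BraidedCategory C]

theorem antipode_inv_conv_right (A : C) [HopfObj A] [IsIso 𝒮[A]] :
    Δ[A] ≫ (β_ A A).inv ≫ (𝟙 A ⊗ₘ inv 𝒮[A]) ≫ μ[A] = ε[A] ≫ η[A] := by
  rw [← cancel_mono 𝒮[A]]
  simp only [Category.assoc, HopfObj.mul_antipode, HopfObj.one_antipode]
  rw [tensorHom_comp_tensorHom_assoc, Category.id_comp, IsIso.inv_hom_id,
    braiding_naturality_assoc, Iso.inv_hom_id_assoc, id_tensorHom, HopfObj.antipode_right]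

theorem antipode_inv_conv_left (A : C) [HopfObj A] [IsIso 𝒮[A]] :
    Δ[A] ≫ (β_ A A).inv ≫ (inv 𝒮[A] ⊗ₘ 𝟙 A) ≫ μ[A] = ε[A] ≫ η[A] := by
  rw [← cancel_mono 𝒮[A]]
  simp only [Category.assoc, HopfObj.mul_antipode, HopfObj.one_antipode]
  rw [tensorHom_comp_tensorHom_assoc, Category.id_comp, IsIso.inv_hom_id,
    braiding_naturality_assoc, Iso.inv_hom_id_assoc, tensorHom_id, HopfObj.antipode_left]

theorem comul_assoc' (A : C) [ComonObj A] :
    Δ[A] ≫ Δ[A] ▷ A = Δ[A] ≫ A ◁ Δ[A] ≫ (α_ A A A).inv := by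
  simp

end

/-- A right crossed module over a Hopf algebra `A` in a braided category. -/
structure CrossedModule {C : Type u} [Category.{v} C] [MonoidalCategory C] [BraidedCategory C]
    (A : C) [HopfObj A] where
  /-- The underlying object. -/
  X : C
  /-- The right action. -/
  act : X ⊗ A ⟶ X
  /-- The right coaction. -/
  coact : X ⟶ X ⊗ A
  act_one : X ◁ η[A] ≫ act = (ρ_ X).hom
  act_mul : act ▷ A ≫ act = (α_ X A A).hom ≫ X ◁ μ[A] ≫ act
  coact_counit : coact ≫ X ◁ ε[A] = (ρ_ X).inv
  coact_comul : coact ≫ coact ▷ A = coact ≫ X ◁ Δ[A] ≫ (α_ X A A).inv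
  crossed : CrossedCompat μ[A] Δ[A] act coact

namespace CrossedModule

variable {C : Type u} [Category.{v} C] [MonoidalCategory C] [BraidedCategory C]
  {A : C} [HopfObj A]

/-- Morphisms of crossed modules are the maps of modules and comodules. -/
@[ext]
structure Hom (M N : CrossedModule A) where
  /-- The underlying morphism. -/
  hom : M.X ⟶ N.X
  act_hom : M.act ≫ hom = hom ▷ A ≫ N.act
  coact_hom : M.coact ≫ hom ▷ A = hom ≫ N.coact

instance : Category (CrossedModule A) where
  Hom M N := Hom M N
  id M := ⟨𝟙 M.X, by simp, by simp⟩
  comp f g := ⟨f.hom ≫ g.hom, by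
      rw [reassoc_of% f.act_hom, g.act_hom, comp_whiskerRight, Category.assoc], by
      rw [comp_whiskerRight, reassoc_of% f.coact_hom, g.coact_hom, Category.assoc]⟩
  id_comp _ := Hom.ext (Category.id_comp _)
  comp_id _ := Hom.ext (Category.comp_id _)
  assoc _ _ _ := Hom.ext (Category.assoc _ _ _)

@[ext]
theorem hom_ext {M N : CrossedModule A} {f g : M ⟶ N} (h : f.hom = g.hom) : f = g :=
  Hom.ext h

@[simp]
theorem id_hom (M : CrossedModule A) : Hom.hom (𝟙 M) = 𝟙 M.X := rfl

@[simp]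
theorem comp_hom {M N P : CrossedModule A} (f : M ⟶ N) (g : N ⟶ P) :
    (f ≫ g).hom = f.hom ≫ g.hom := rfl

/-- An isomorphism of underlying objects that is a crossed module map. -/
def mkIso {M N : CrossedModule A} (e : M.X ≅ N.X) (ha : M.act ≫ e.hom = e.hom ▷ A ≫ N.act)
    (hc : M.coact ≫ e.hom ▷ A = e.hom ≫ N.coact) : M ≅ N where
  hom := ⟨e.hom, ha, hc⟩
  inv := ⟨e.inv, by rw [← cancel_mono e.hom, Category.assoc, Category.assoc, ha]; simp, by
    rw [← cancel_epi e.hom, ← reassoc_of% hc]; simp⟩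
  hom_inv_id := hom_ext e.hom_inv_id
  inv_hom_id := hom_ext e.inv_hom_id

/-- The unit object with trivial crossed module structure. -/
def trivialModule : CrossedModule A where
  X := 𝟙_ C
  act := 𝟙_ C ◁ ε[A] ≫ (λ_ (𝟙_ C)).hom
  coact := (λ_ (𝟙_ C)).inv ≫ 𝟙_ C ◁ η[A]
  act_one := by
    rw [← whiskerLeft_comp_assoc, BimonObj.one_counit]; monoidal
  act_mul := unit_act_mul _ _ (Bimon.mul_counit A)
  coact_counit := by
    rw [Category.assoc, ← whiskerLeft_comp, BimonObj.one_counit]; monoidal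
  coact_comul := unit_coact_comul _ _ (Bimon.one_comul A)
  crossed := unit_crossed _ _ _ _ (ComonObj.comul_counit A) (ComonObj.counit_comul A)
    (MonObj.mul_one A) (MonObj.one_mul A)

/-- The tensor product, with the diagonal action and the codiagonal coaction. -/
def tensor (M N : CrossedModule A) : CrossedModule A where
  X := M.X ⊗ N.X
  act := tensorAct Δ[A] M.act N.act
  coact := tensorCoact μ[A] M.coact N.coact
  act_one := tensorAct_one _ _ _ _ (Bimon.one_comul A) M.act_one N.act_one
  act_mul := tensorAct_mul _ _ _ _ (BimonObj.mul_comul A) M.act_mul N.act_mul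
  coact_counit := tensorCoact_counit _ _ _ _ (Bimon.mul_counit A) M.coact_counit N.coact_counit
  coact_comul := tensorCoact_comul _ _ _ _ (BimonObj.mul_comul A) M.coact_comul N.coact_comul
  crossed := crossed_tensor _ _ _ _ _ _ (comul_assoc' A) (MonObj.mul_assoc A) M.crossed N.crossed

/-- The tensor product of morphisms. -/
def tensorMap {M M' N N' : CrossedModule A} (f : M ⟶ M') (g : N ⟶ N') :
    tensor M N ⟶ tensor M' N' where
  hom := f.hom ⊗ₘ g.hom
  act_hom := tensorAct_natural _ _ _ _ _ _ _ f.act_hom g.act_hom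
  coact_hom := tensorCoact_natural _ _ _ _ _ _ _ f.coact_hom g.coact_hom

instance : MonoidalCategory (CrossedModule A) where
  tensorObj := tensor
  tensorUnit := trivialModule
  tensorHom := tensorMap
  whiskerLeft M _ _ f := tensorMap (𝟙 M) f
  whiskerRight f N := tensorMap f (𝟙 N)
  associator M N P := mkIso (M := tensor (tensor M N) P) (N := tensor M (tensor N P))
    (α_ M.X N.X P.X) (tensorAct_assoc _ _ _ _ (comul_assoc' A))
    (tensorCoact_assoc _ _ _ _ (MonObj.mul_assoc A))
  leftUnitor M := mkIso (M := tensor trivialModule M) (λ_ M.X)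
    (leftUnitor_act _ _ _ (ComonObj.counit_comul A)) (leftUnitor_coact _ _ _ (MonObj.one_mul A))
  rightUnitor M := mkIso (M := tensor M trivialModule) (ρ_ M.X)
    (rightUnitor_act _ _ _ (ComonObj.comul_counit A)) (rightUnitor_coact _ _ _ (MonObj.mul_one A))
  tensorHom_def f g := hom_ext (show f.hom ⊗ₘ g.hom = (f.hom ⊗ₘ 𝟙 _) ≫ (𝟙 _ ⊗ₘ g.hom) by
    rw [tensorHom_id, id_tensorHom, MonoidalCategory.tensorHom_def])
  id_tensorHom_id M N := hom_ext (by simp [tensorMap]; rfl)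
  tensorHom_comp_tensorHom f g h k := hom_ext
    (show (f.hom ⊗ₘ g.hom) ≫ (h.hom ⊗ₘ k.hom) = (f.hom ≫ h.hom) ⊗ₘ (g.hom ≫ k.hom) by simp)
  whiskerLeft_id M N := hom_ext (by simp [tensorMap]; rfl)
  id_whiskerRight M N := hom_ext (by simp [tensorMap]; rfl)
  associator_naturality f g h := hom_ext
    (MonoidalCategory.associator_naturality f.hom g.hom h.hom)
  leftUnitor_naturality f := hom_ext
    (show (𝟙 (𝟙_ C) ⊗ₘ f.hom) ≫ (λ_ _).hom = (λ_ _).hom ≫ f.hom by simp)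
  rightUnitor_naturality f := hom_ext
    (show (f.hom ⊗ₘ 𝟙 (𝟙_ C)) ≫ (ρ_ _).hom = (ρ_ _).hom ≫ f.hom by simp)
  pentagon M N P Q := hom_ext (show ((α_ M.X N.X P.X).hom ⊗ₘ 𝟙 Q.X) ≫
    (α_ M.X (N.X ⊗ P.X) Q.X).hom ≫ (𝟙 M.X ⊗ₘ (α_ N.X P.X Q.X).hom) =
    (α_ (M.X ⊗ N.X) P.X Q.X).hom ≫ (α_ M.X N.X (P.X ⊗ Q.X)).hom by simp)
  triangle M N := hom_ext
    (show (α_ M.X (𝟙_ C) N.X).hom ≫ (𝟙 _ ⊗ₘ (λ_ N.X).hom) = (ρ_ M.X).hom ⊗ₘ 𝟙 _ by simp)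

theorem tensorObj_X (M N : CrossedModule A) : (M ⊗ N).X = (M.X ⊗ N.X : C) := rfl

theorem tensorUnit_X : (𝟙_ (CrossedModule A)).X = 𝟙_ C := rfl

/-- The braiding of crossed modules, as an isomorphism of the underlying objects. -/
noncomputable def braidIso [IsIso 𝒮[A]] (M N : CrossedModule A) : M.X ⊗ N.X ≅ N.X ⊗ M.X where
  hom := crossedBraid M.act N.coact
  inv := (β_ M.X N.X).inv ≫ braidAux (inv 𝒮[A]) M.act N.coact
  hom_inv_id := by
    rw [crossedBraid_eq, Category.assoc, Iso.hom_inv_id_assoc,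
      braidAux_comp μ[A] Δ[A] _ _ _ _ M.act_mul N.coact_comul, antipode_inv_conv_right,
      braidAux_unit _ _ _ _ M.act_one N.coact_counit]
  inv_hom_id := by
    have h := braidAux_comp μ[A] Δ[A] (inv 𝒮[A]) (𝟙 A) _ _ M.act_mul N.coact_comul
    rw [antipode_inv_conv_left, braidAux_unit _ _ _ _ M.act_one N.coact_counit] at h
    rw [crossedBraid_eq, Category.assoc, reassoc_of% h, Iso.inv_hom_id]

/-- The category of crossed modules is braided by `crossedBraid`. -/
noncomputable instance [IsIso 𝒮[A]] : BraidedCategory (CrossedModule A) where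
  braiding M N := mkIso (M := tensor M N) (N := tensor N M) (braidIso M N)
    (crossedBraid_act _ _ _ _ _ M.act_mul N.crossed)
    (crossedBraid_coact _ _ _ _ _ N.coact_comul M.crossed)
  braiding_naturality_right M N P f := hom_ext (by
    have h := crossedBraid_natural_right M.act N.coact P.coact f.hom f.coact_hom
    rw [← id_tensorHom, ← tensorHom_id] at h
    exact h)
  braiding_naturality_left {M N} f P := hom_ext (by
    have h := crossedBraid_natural_left M.act N.act P.coact f.hom f.act_hom
    rw [← id_tensorHom, ← tensorHom_id] at h
    exact h)
  hexagon_forward M N P := hom_ext (by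
    have h := hexagon_fwd μ[A] M.act N.coact P.coact M.act_mul
    rw [← id_tensorHom, ← tensorHom_id] at h
    exact h)
  hexagon_reverse M N P := hom_ext (by
    have h := hexagon_rev Δ[A] M.act N.act P.coact P.coact_comul
    rw [← id_tensorHom, ← tensorHom_id] at h
    exact h)

theorem braiding_hom [IsIso 𝒮[A]] (M N : CrossedModule A) :
    (β_ M N).hom.hom = crossedBraid M.act N.coact := rfl

/-- The underlying object of the cross product of `A` and `B`. -/
def crossProduct (B : CrossedModule A) : C := A ⊗ B.X

/-- A Hopf algebra structure on the object `A ⊗ B` is the cross product structure: the tensor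
product algebra and the tensor product coalgebra are formed with the braidings of crossed modules
`B ⊗ A ⟶ A ⊗ B`, `A` with coaction `Δ`, and `A ⊗ B ⟶ B ⊗ A`, `A` with action `μ`. -/
structure IsCrossProduct [IsIso 𝒮[A]] (B : CrossedModule A) [HopfObj B]
    (K : HopfObj (crossProduct B)) : Prop where
  one_eq : K.one = (λ_ (𝟙_ C)).inv ≫ (η[A] ⊗ₘ (η[B].hom : 𝟙_ C ⟶ B.X))
  mul_eq : K.mul = (α_ A B.X (A ⊗ B.X)).hom ≫ A ◁ ((α_ B.X A B.X).inv ≫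
    crossedBraid B.act Δ[A] ▷ B.X ≫ (α_ A B.X B.X).hom) ≫ (α_ A A (B.X ⊗ B.X)).inv ≫
    (μ[A] ⊗ₘ (μ[B].hom : B.X ⊗ B.X ⟶ B.X))
  counit_eq : K.counit = (ε[A] ⊗ₘ (ε[B].hom : B.X ⟶ 𝟙_ C)) ≫ (λ_ (𝟙_ C)).hom
  comul_eq : K.comul = (Δ[A] ⊗ₘ (Δ[B].hom : B.X ⟶ B.X ⊗ B.X)) ≫ (α_ A A (B.X ⊗ B.X)).hom ≫
    A ◁ ((α_ A B.X B.X).inv ≫ crossedBraid μ[A] B.coact ▷ B.X ≫ (α_ B.X A B.X).hom) ≫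
    (α_ A B.X (A ⊗ B.X)).inv
  antipode_eq : K.antipode = crossedBraid μ[A] B.coact ≫ (𝒮[B].hom ⊗ₘ 𝒮[A]) ≫
    crossedBraid B.act Δ[A]

end CrossedModule

end BraidedCross

open scoped MonObj ComonObj HopfObj
open BraidedCross

/-!
The idempotent `Π = i_A S p_A * id` (a convolution product) projects `H` onto its left
`A`-coinvariants. Its splitting `q : H ⟶ B`, `i : B ⟶ H` makes `B` two things at once: the subobject
of left coinvariants (`i_comul_pA`, `comp_q_i`) and the quotient of `H` by left multiplication with
`A` (`iA_mul_q`, `q_i_comp`). Left multiplication commutes with right multiplication, so the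
quotient `B` is a right `H`-module by `actH`, and dually the subobject `B` is a right `H`-comodule
by `coactH`. Restricting these along `iA` and `i`, and along `pA` and `q`, gives the action, the
multiplication, the coaction and the comultiplication of `B`; the module and comodule laws and
(co)associativity are all instances of `actH_mul` and `coactH_comul`.

The maps `θ = (i_A ⊗ i) ≫ μ` and `Δ ≫ (p_A ⊗ q)` are inverse to each other, by the definition of `Π`
and by coinvariance. Computing `(i ⊗ i_A) ≫ μ` and `Δ ≫ (q ⊗ p_A)` through `θ` yields exactly the
cross product maps `σ : B ⊗ A ⟶ A ⊗ B` and `τ : A ⊗ B ⟶ B ⊗ A` (`mul_thetaInv`, `theta_comul`).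
Their composite `σ ≫ τ` is therefore `(i ⊗ i_A) ≫ μ ≫ Δ ≫ (q ⊗ p_A)`, and expanding this by the
bialgebra axiom of `H` is the compatibility condition of a crossed module (`crossed`). The remaining
Hopf algebra axioms of `B` come from the bialgebra axiom of `H` in the same way, with one of its
factors read through `θ` where needed (`theta_actH`, `coactH_eq`); this is where the braiding of
crossed modules arises from the braiding of the ambient category. The lemmas `mul_comul_factor`,
`mul_comul_factor_right` and `mul_comul_factor_both` are the forms of the bialgebra axiom used.

The antipode of `B` is the restriction of `T = S_H * i_A p_A`. That `Π` and `T` descend to the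
quotient and land in the coinvariants is a statement about convolution products of an
antimultiplicative and a multiplicative map (`conv_mul_left`, `conv_mul_right`); the dual statements
follow in the opposite category. Transporting `S_H` along `θ` gives `τ ≫ (S_B ⊗ S_A) ≫ σ`
(`theta_antipode_thetaInv`). As `σ` and `τ` are invertible, `S_B` is invertible too, and the Hopf
algebra structure on `A ⊗ B` transported from `H` along `θ` is the cross product.
-/

/-! ### Products and convolutions in a bialgebra -/

namespace BraidedCross
section
variable {C : Type u} [Category.{v} C] [MonoidalCategory C] [BraidedCategory C]

/-- The bialgebra axiom for a product `f x * g y` to whose comultiplication `p ⊗ q` is applied,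
where the comultiplications of `f x` and `g y` factor as `F` and `G` followed by maps into `H`. -/
theorem mul_comul_factor {H X Y X₁ X₂ Y₁ Y₂ Z₁ Z₂ : C} {m : H ⊗ H ⟶ H} {D : H ⟶ H ⊗ H}
    (hmD : m ≫ D = (D ⊗ₘ D) ≫ tensorμ H H H H ≫ (m ⊗ₘ m))
    {f : X ⟶ H} {g : Y ⟶ H} {p : H ⟶ Z₁} {q : H ⟶ Z₂}
    {F : X ⟶ X₁ ⊗ X₂} {G : Y ⟶ Y₁ ⊗ Y₂} {f₁ : X₁ ⟶ H} {f₂ : X₂ ⟶ H} {g₁ : Y₁ ⟶ H} {g₂ : Y₂ ⟶ H}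
    {U : X₁ ⊗ Y₁ ⟶ Z₁} {V : X₂ ⊗ Y₂ ⟶ Z₂}
    (hf : f ≫ D = F ≫ (f₁ ⊗ₘ f₂)) (hg : g ≫ D = G ≫ (g₁ ⊗ₘ g₂))
    (hU : (f₁ ⊗ₘ g₁) ≫ m ≫ p = U) (hV : (f₂ ⊗ₘ g₂) ≫ m ≫ q = V) :
    (f ⊗ₘ g) ≫ m ≫ D ≫ (p ⊗ₘ q) = (F ⊗ₘ G) ≫ tensorμ X₁ X₂ Y₁ Y₂ ≫ (U ⊗ₘ V) := by
  subst hU hV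
  rw [reassoc_of% hmD, tensorHom_comp_tensorHom_assoc, hf, hg, ← tensorHom_comp_tensorHom_assoc,
    tensorμ_natural_assoc]
  simp only [tensorHom_comp_tensorHom]

/-- A form of the bialgebra axiom dual to `mul_comul_factor`: here the factorizations are those of
`m ≫ p` and `m ≫ q`, through maps out of `H`. -/
theorem mul_comul_factor_right {H X Y Z₁ Z₂ V₁ V₂ W₁ W₂ : C} {m : H ⊗ H ⟶ H} {D : H ⟶ H ⊗ H}
    (hmD : m ≫ D = (D ⊗ₘ D) ≫ tensorμ H H H H ≫ (m ⊗ₘ m))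
    {f : X ⟶ H} {g : Y ⟶ H} {p : H ⟶ Z₁} {q : H ⟶ Z₂}
    {p₁ : H ⟶ V₁} {q₁ : H ⟶ W₁} {p₂ : H ⟶ V₂} {q₂ : H ⟶ W₂}
    {F : X ⟶ V₁ ⊗ W₁} {G : Y ⟶ V₂ ⊗ W₂} {U : V₁ ⊗ V₂ ⟶ Z₁} {V : W₁ ⊗ W₂ ⟶ Z₂}
    (hU : m ≫ p = (p₁ ⊗ₘ p₂) ≫ U) (hV : m ≫ q = (q₁ ⊗ₘ q₂) ≫ V)
    (hf : f ≫ D ≫ (p₁ ⊗ₘ q₁) = F) (hg : g ≫ D ≫ (p₂ ⊗ₘ q₂) = G) :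
    (f ⊗ₘ g) ≫ m ≫ D ≫ (p ⊗ₘ q) = (F ⊗ₘ G) ≫ tensorμ V₁ W₁ V₂ W₂ ≫ (U ⊗ₘ V) := by
  subst hf hg
  rw [reassoc_of% hmD, tensorHom_comp_tensorHom_assoc, tensorHom_comp_tensorHom, hU, hV,
    ← tensorHom_comp_tensorHom (p₁ ⊗ₘ p₂), ← tensorμ_natural_assoc,
    tensorHom_comp_tensorHom_assoc]
  simp only [Category.assoc]

/-- A form of the bialgebra axiom in which both the comultiplications of `f` and `g` and the
resulting products are factored, so that all the objects inside can differ from `H`. -/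
theorem mul_comul_factor_both {H X Y X₁ X₂ Y₁ Y₂ Z₁ Z₂ V₁ V₂ W₁ W₂ : C} {m : H ⊗ H ⟶ H}
    {D : H ⟶ H ⊗ H} (hmD : m ≫ D = (D ⊗ₘ D) ≫ tensorμ H H H H ≫ (m ⊗ₘ m))
    {f : X ⟶ H} {g : Y ⟶ H} {p : H ⟶ Z₁} {q : H ⟶ Z₂}
    {F : X ⟶ X₁ ⊗ X₂} {G : Y ⟶ Y₁ ⊗ Y₂} {f₁ : X₁ ⟶ H} {f₂ : X₂ ⟶ H} {g₁ : Y₁ ⟶ H} {g₂ : Y₂ ⟶ H}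
    {a₁ : X₁ ⟶ V₁} {a₂ : X₂ ⟶ W₁} {b₁ : Y₁ ⟶ V₂} {b₂ : Y₂ ⟶ W₂}
    {F' : X ⟶ V₁ ⊗ W₁} {G' : Y ⟶ V₂ ⊗ W₂} {U : V₁ ⊗ V₂ ⟶ Z₁} {V : W₁ ⊗ W₂ ⟶ Z₂}
    (hf : f ≫ D = F ≫ (f₁ ⊗ₘ f₂)) (hg : g ≫ D = G ≫ (g₁ ⊗ₘ g₂))
    (hF : F ≫ (a₁ ⊗ₘ a₂) = F') (hG : G ≫ (b₁ ⊗ₘ b₂) = G')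
    (hU : (f₁ ⊗ₘ g₁) ≫ m ≫ p = (a₁ ⊗ₘ b₁) ≫ U) (hV : (f₂ ⊗ₘ g₂) ≫ m ≫ q = (a₂ ⊗ₘ b₂) ≫ V) :
    (f ⊗ₘ g) ≫ m ≫ D ≫ (p ⊗ₘ q) = (F' ⊗ₘ G') ≫ tensorμ V₁ W₁ V₂ W₂ ≫ (U ⊗ₘ V) := by
  subst hF hG
  rw [mul_comul_factor hmD hf hg hU hV, ← tensorHom_comp_tensorHom (a₁ ⊗ₘ b₁),
    ← tensorμ_natural_assoc, tensorHom_comp_tensorHom_assoc]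

/-- Multiplying `x ⊗ y` and `z ⊗ w` with the braided opposite multiplication on the first factors,
and then the two results, gives the product of `z`, `x y` and `w`. -/
theorem tensorμ_opposite_mul {H : C} {m : H ⊗ H ⟶ H}
    (hm : m ▷ H ≫ m = (α_ H H H).hom ≫ H ◁ m ≫ m) :
    tensorμ H H H H ≫ ((β_ H H).hom ≫ m ⊗ₘ m) ≫ m =
      m ▷ (H ⊗ H) ≫ (α_ H H H).inv ≫ (β_ H H).hom ▷ H ≫ m ▷ H ≫ m := by
  have hm' := hm
  rw [← Iso.inv_comp_eq] at hm'
  simp only [tensorμ, MonoidalCategory.tensorHom_def]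
  calc _ = 𝟙 _ ⊗≫ H ◁ (β_ H H).hom ▷ H ⊗≫ (β_ H H).hom ▷ H ▷ H ⊗≫
        (m ▷ (H ⊗ H) ≫ H ◁ m) ≫ m := by
        monoidal
    _ = 𝟙 _ ⊗≫ H ◁ (β_ H H).hom ▷ H ⊗≫ (β_ H H).hom ▷ H ▷ H ⊗≫ H ◁ H ◁ m ⊗≫
        (m ▷ H ≫ m) := by
        rw [← whisker_exchange]; monoidal
    _ = 𝟙 _ ⊗≫ H ◁ (β_ H H).hom ▷ H ⊗≫ (β_ H H).hom ▷ H ▷ H ⊗≫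
        H ◁ (H ◁ m ≫ m) ⊗≫ m := by
        rw [hm]; monoidal
    _ = 𝟙 _ ⊗≫ (𝟙 ((H ⊗ H) ⊗ H) ⊗≫ H ◁ (β_ H H).hom ⊗≫ (β_ H H).hom ▷ H ⊗≫ H ◁ m) ▷ H ⊗≫
        H ◁ m ⊗≫ m := by
        rw [← hm']; monoidal
    _ = 𝟙 _ ⊗≫ (𝟙 ((H ⊗ H) ⊗ H) ⊗≫ H ◁ (β_ H H).hom ⊗≫ (β_ H H).hom ▷ H ⊗≫ H ◁ m) ▷ H ⊗≫
        (H ◁ m ≫ m) := by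
        monoidal
    _ = _ := by rw [← push_l, ← hm']; monoidal

/-- The convolution product of an antimultiplicative map `f` and a multiplicative map `k` is left
invariant along a coalgebra map `u` on which it is trivial:
`f(a₁ h₁) k(a₂ h₂) = f(h₁) f(a₁) k(a₂) k(h₂) = ε(a) f(h₁) k(h₂)`, where `a` stands for `u a`. -/
theorem conv_mul_left {A H : C} {m : H ⊗ H ⟶ H} {D : H ⟶ H ⊗ H} {u : A ⟶ H} {d : A ⟶ A ⊗ A}
    {e : A ⟶ 𝟙_ C} {o : 𝟙_ C ⟶ H} {f k : H ⟶ H}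
    (hmD : m ≫ D = (D ⊗ₘ D) ≫ tensorμ H H H H ≫ (m ⊗ₘ m))
    (hm : m ▷ H ≫ m = (α_ H H H).hom ≫ H ◁ m ≫ m) (ho : H ◁ o ≫ m = (ρ_ H).hom)
    (hu : u ≫ D = d ≫ (u ⊗ₘ u))
    (hf : m ≫ f = (f ⊗ₘ f) ≫ (β_ H H).hom ≫ m) (hk : m ≫ k = (k ⊗ₘ k) ≫ m)
    (h : d ≫ (u ≫ f ⊗ₘ u ≫ k) ≫ m = e ≫ o) :
    u ▷ H ≫ m ≫ D ≫ (f ⊗ₘ k) ≫ m = e ▷ H ≫ (λ_ H).hom ≫ D ≫ (f ⊗ₘ k) ≫ m := by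
  have h1 := mul_comul_factor hmD (f := u) (g := 𝟙 H) (p := f) (q := k)
    (F := d) (G := D) (f₁ := u) (f₂ := u) (g₁ := 𝟙 H) (g₂ := 𝟙 H)
    (U := (u ≫ f ⊗ₘ f) ≫ (β_ H H).hom ≫ m) (V := (u ≫ k ⊗ₘ k) ≫ m) hu (by simp)
    (by rw [hf, tensorHom_comp_tensorHom_assoc, Category.id_comp])
    (by rw [hk, tensorHom_comp_tensorHom_assoc, Category.id_comp])
  rw [← tensorHom_comp_tensorHom, ← tensorμ_natural_assoc, tensorHom_comp_tensorHom_assoc] at h1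
  rw [← tensorHom_id, reassoc_of% h1, tensorμ_opposite_mul hm]
  generalize hb : D ≫ (f ⊗ₘ k) = b
  rw [reassoc_of% hb, MonoidalCategory.tensorHom_def', Category.assoc, ← comp_whiskerRight_assoc,
    Category.assoc, h]
  calc _ = 𝟙 _ ⊗≫ A ◁ b ⊗≫ e ▷ (H ⊗ H) ⊗≫ (o ▷ H ≫ (β_ H H).hom) ▷ H ⊗≫ m ▷ H ≫ m := by
        monoidal
    _ = 𝟙 _ ⊗≫ (A ◁ b ≫ e ▷ (H ⊗ H)) ⊗≫ (H ◁ o ≫ m) ▷ H ⊗≫ m := by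
        rw [braiding_naturality_left, braiding_tensorUnit_left]; monoidal
    _ = _ := by rw [whisker_exchange, ho]; monoidal

/-- The convolution product of an antimultiplicative map `f` and a multiplicative map `k`, followed
by a map `q` that is left invariant along `u ≫ f`, is right equivariant along `u`: `q(f(h₁ a₁) k(h₂
a₂)) = q(f(a₁) f(h₁) k(h₂) k(a₂)) = q(f(h₁) k(h₂) k(a))`, where `a` stands for `u a`. -/
theorem conv_mul_right {A B H : C} {m : H ⊗ H ⟶ H} {D : H ⟶ H ⊗ H} {u : A ⟶ H} {d : A ⟶ A ⊗ A}
    {e : A ⟶ 𝟙_ C} {f k : H ⟶ H} {q : H ⟶ B}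
    (hmD : m ≫ D = (D ⊗ₘ D) ≫ tensorμ H H H H ≫ (m ⊗ₘ m))
    (hm : m ▷ H ≫ m = (α_ H H H).hom ≫ H ◁ m ≫ m) (he : d ≫ e ▷ A = (λ_ A).inv)
    (hu : u ≫ D = d ≫ (u ⊗ₘ u))
    (hf : m ≫ f = (f ⊗ₘ f) ≫ (β_ H H).hom ≫ m) (hk : m ≫ k = (k ⊗ₘ k) ≫ m)
    (hq : (u ≫ f) ▷ H ≫ m ≫ q = e ▷ H ≫ (λ_ H).hom ≫ q) :
    H ◁ u ≫ m ≫ D ≫ (f ⊗ₘ k) ≫ m ≫ q =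
      (D ≫ (f ⊗ₘ k) ≫ m) ▷ A ≫ H ◁ (u ≫ k) ≫ m ≫ q := by
  have h1 := mul_comul_factor hmD (f := 𝟙 H) (g := u) (p := f) (q := k)
    (F := D) (G := d) (f₁ := 𝟙 H) (f₂ := 𝟙 H) (g₁ := u) (g₂ := u)
    (U := (f ⊗ₘ u ≫ f) ≫ (β_ H H).hom ≫ m) (V := (k ⊗ₘ u ≫ k) ≫ m) (by simp) hu
    (by rw [hf, tensorHom_comp_tensorHom_assoc, Category.id_comp])
    (by rw [hk, tensorHom_comp_tensorHom_assoc, Category.id_comp])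
  rw [← tensorHom_comp_tensorHom, ← tensorμ_natural_assoc, tensorHom_comp_tensorHom_assoc] at h1
  rw [← id_tensorHom, reassoc_of% h1, reassoc_of% tensorμ_opposite_mul hm]
  generalize hb : D ≫ (f ⊗ₘ k) = b
  rw [reassoc_of% hb, MonoidalCategory.tensorHom_def b, MonoidalCategory.tensorHom_def (u ≫ f)]
  calc _ = 𝟙 _ ⊗≫ (b ▷ A ≫ (H ⊗ H) ◁ d) ⊗≫ (H ⊗ H) ◁ (u ≫ f) ▷ A ⊗≫
        (H ⊗ H) ◁ H ◁ (u ≫ k) ⊗≫ m ▷ (H ⊗ H) ⊗≫ (β_ H H).hom ▷ H ⊗≫ (m ▷ H ≫ m) ≫ q := by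
        monoidal
    _ = 𝟙 _ ⊗≫ H ◁ d ⊗≫ (b ▷ (A ⊗ A)) ⊗≫ (H ⊗ H) ◁ (u ≫ f) ▷ A ⊗≫
        ((H ⊗ H) ◁ H ◁ (u ≫ k) ≫ m ▷ (H ⊗ H)) ⊗≫ (β_ H H).hom ▷ H ⊗≫ (m ▷ H ≫ m) ≫ q := by
        rw [← whisker_exchange]
        monoidal
    _ = 𝟙 _ ⊗≫ H ◁ d ⊗≫ (b ▷ (A ⊗ A)) ⊗≫ ((H ⊗ H) ◁ (u ≫ f) ▷ A ≫
        m ▷ (H ⊗ A)) ⊗≫ (H ⊗ H) ◁ (u ≫ k) ⊗≫ (β_ H H).hom ▷ H ⊗≫ H ◁ m ⊗≫ m ≫ q := by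
        rw [whisker_exchange, hm]
        monoidal
    _ = 𝟙 _ ⊗≫ H ◁ d ⊗≫ (b ≫ m) ▷ (A ⊗ A) ⊗≫ H ◁ (u ≫ f) ▷ A ⊗≫
        ((H ⊗ H) ◁ (u ≫ k) ≫ (β_ H H).hom ▷ H) ⊗≫ H ◁ m ⊗≫ m ≫ q := by
        rw [whisker_exchange]
        monoidal
    _ = 𝟙 _ ⊗≫ H ◁ d ⊗≫ (b ≫ m) ▷ (A ⊗ A) ⊗≫ (H ◁ (u ≫ f) ≫ (β_ H H).hom) ▷ A ⊗≫
        H ◁ (H ◁ (u ≫ k) ≫ m) ⊗≫ m ≫ q := by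
        rw [whisker_exchange]
        monoidal
    _ = 𝟙 _ ⊗≫ H ◁ d ⊗≫ (b ≫ m) ▷ (A ⊗ A) ⊗≫ (β_ H A).hom ▷ A ⊗≫
        ((u ≫ f) ▷ (H ⊗ A) ≫ H ◁ (H ◁ (u ≫ k) ≫ m)) ⊗≫ m ≫ q := by
        rw [braiding_naturality_right]
        monoidal
    _ = 𝟙 _ ⊗≫ H ◁ d ⊗≫ (b ≫ m) ▷ (A ⊗ A) ⊗≫ (β_ H A).hom ▷ A ⊗≫
        A ◁ (H ◁ (u ≫ k) ≫ m) ⊗≫ (u ≫ f) ▷ H ≫ m ≫ q := by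
        rw [← whisker_exchange]
        monoidal
    _ = 𝟙 _ ⊗≫ H ◁ d ⊗≫ (b ≫ m) ▷ (A ⊗ A) ⊗≫ (β_ H A).hom ▷ A ⊗≫
        (A ◁ (H ◁ (u ≫ k) ≫ m) ≫ e ▷ H) ⊗≫ q := by
        rw [hq]
        monoidal
    _ = 𝟙 _ ⊗≫ H ◁ d ⊗≫ (b ≫ m) ▷ (A ⊗ A) ⊗≫ ((β_ H A).hom ≫ e ▷ H) ▷ A ⊗≫
        (H ◁ (u ≫ k) ≫ m) ⊗≫ q := by
        rw [whisker_exchange]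
        monoidal
    _ = 𝟙 _ ⊗≫ H ◁ d ⊗≫ ((b ≫ m) ▷ (A ⊗ A) ≫ H ◁ e ▷ A) ⊗≫
        (H ◁ (u ≫ k) ≫ m) ⊗≫ q := by
        rw [← braiding_naturality_right, braiding_tensorUnit_right]
        monoidal
    _ = 𝟙 _ ⊗≫ H ◁ (d ≫ e ▷ A) ⊗≫ (b ≫ m) ▷ A ⊗≫ (H ◁ (u ≫ k) ≫ m) ⊗≫ q := by
        rw [← whisker_exchange]
        monoidal
    _ = _ := by
        rw [he]
        simp only [← hb]
        monoidal

end

section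
open Opposite
variable {C : Type u} [Category.{v} C] [MonoidalCategory C] [BraidedCategory C]

/-- The dual of `conv_mul_left`, read in the opposite category. -/
theorem conv_comul_left {A H : C} {m : H ⊗ H ⟶ H} {D : H ⟶ H ⊗ H} {u : H ⟶ A} {d : A ⊗ A ⟶ A}
    {e : 𝟙_ C ⟶ A} {o : H ⟶ 𝟙_ C} {f k : H ⟶ H}
    (hmD : m ≫ D = (D ⊗ₘ D) ≫ tensorμ H H H H ≫ (m ⊗ₘ m))
    (hm : D ≫ D ▷ H = D ≫ H ◁ D ≫ (α_ H H H).inv) (ho : D ≫ H ◁ o = (ρ_ H).inv)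
    (hu : m ≫ u = (u ⊗ₘ u) ≫ d)
    (hf : f ≫ D = D ≫ (β_ H H).hom ≫ (f ⊗ₘ f)) (hk : k ≫ D = D ≫ (k ⊗ₘ k))
    (h : D ≫ (f ≫ u ⊗ₘ k ≫ u) ≫ d = o ≫ e) :
    D ≫ (f ⊗ₘ k) ≫ m ≫ D ≫ u ▷ H = D ≫ (f ⊗ₘ k) ≫ m ≫ (λ_ H).inv ≫ e ▷ H := by
  have := congrArg Quiver.Hom.unop (conv_mul_left (C := Cᵒᵖ) (A := op A) (H := op H)
    (m := D.op) (D := m.op) (u := u.op) (d := d.op) (e := e.op) (o := o.op) (f := f.op)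
    (k := k.op) ?_ ?_ ?_ ?_ ?_ ?_ ?_)
  · simpa using this
  · simpa using congrArg Quiver.Hom.op hmD
  · simpa using congrArg Quiver.Hom.op hm
  · simpa using congrArg Quiver.Hom.op ho
  · simpa using congrArg Quiver.Hom.op hu
  · simpa using congrArg Quiver.Hom.op hf
  · simpa using congrArg Quiver.Hom.op hk
  · simpa using congrArg Quiver.Hom.op h

/-- The dual of `conv_mul_right`, read in the opposite category. -/
theorem conv_comul_right {A B H : C} {m : H ⊗ H ⟶ H} {D : H ⟶ H ⊗ H} {u : H ⟶ A}
    {d : A ⊗ A ⟶ A} {e : 𝟙_ C ⟶ A} {f k : H ⟶ H} {q : B ⟶ H}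
    (hmD : m ≫ D = (D ⊗ₘ D) ≫ tensorμ H H H H ≫ (m ⊗ₘ m))
    (hm : D ≫ D ▷ H = D ≫ H ◁ D ≫ (α_ H H H).inv) (he : e ▷ A ≫ d = (λ_ A).hom)
    (hu : m ≫ u = (u ⊗ₘ u) ≫ d)
    (hf : f ≫ D = D ≫ (β_ H H).hom ≫ (f ⊗ₘ f)) (hk : k ≫ D = D ≫ (k ⊗ₘ k))
    (hq : q ≫ D ≫ (f ≫ u) ▷ H = q ≫ (λ_ H).inv ≫ e ▷ H) :
    q ≫ D ≫ (f ⊗ₘ k) ≫ m ≫ D ≫ H ◁ u =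
      q ≫ D ≫ H ◁ (k ≫ u) ≫ (D ≫ (f ⊗ₘ k) ≫ m) ▷ A := by
  have := congrArg Quiver.Hom.unop (conv_mul_right (C := Cᵒᵖ) (A := op A) (H := op H) (B := op B)
    (m := D.op) (D := m.op) (u := u.op) (d := d.op) (e := e.op) (q := q.op) (f := f.op)
    (k := k.op) ?_ ?_ ?_ ?_ ?_ ?_ ?_)
  · simpa using this
  · simpa using congrArg Quiver.Hom.op hmD
  · simpa using congrArg Quiver.Hom.op hm
  · simpa using congrArg Quiver.Hom.op he
  · simpa using congrArg Quiver.Hom.op hu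
  · simpa using congrArg Quiver.Hom.op hf
  · simpa using congrArg Quiver.Hom.op hk
  · simpa using congrArg Quiver.Hom.op hq

end

/-! ### Hopf algebra projections and their coinvariants -/

/-- A Hopf algebra projection `pA : H ⟶ A` with section `iA`. -/
structure HopfProjection {C : Type u} [Category.{v} C] [MonoidalCategory C] [BraidedCategory C]
    (A H : C) [HopfObj A] [HopfObj H] where
  /-- The section. -/
  iA : A ⟶ H
  /-- The projection. -/
  pA : H ⟶ A
  iA_hom : IsBimonHom iA
  pA_hom : IsBimonHom pA
  iA_pA : iA ≫ pA = 𝟙 A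

namespace HopfProjection
variable {C : Type u} [Category.{v} C] [MonoidalCategory C] [BraidedCategory C]
  {A H : C} [HopfObj A] [HopfObj H] (P : HopfProjection A H)

attribute [instance] iA_hom pA_hom
attribute [simp] iA_pA

@[simp]
theorem iA_pA_assoc {X : C} (f : A ⟶ X) : P.iA ≫ P.pA ≫ f = f := by
  rw [← Category.assoc, P.iA_pA, Category.id_comp]

theorem antipode_mul (f : H ⟶ A) (g : A ⟶ H) [IsMonHom f] [IsMonHom g] :
    μ[H] ≫ f ≫ 𝒮[A] ≫ g = (f ≫ 𝒮[A] ≫ g ⊗ₘ f ≫ 𝒮[A] ≫ g) ≫ (β_ H H).hom ≫ μ[H] := by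
  rw [IsMonHom.mul_hom_assoc, reassoc_of% HopfObj.mul_antipode A]
  simp only [IsMonHom.mul_hom]
  rw [← braiding_naturality_assoc]
  simp only [tensorHom_comp_tensorHom_assoc]

theorem antipode_comul (f : H ⟶ A) (g : A ⟶ H) [IsComonHom f] [IsComonHom g] :
    (f ≫ 𝒮[A] ≫ g) ≫ Δ[H] = Δ[H] ≫ (β_ H H).hom ≫ (f ≫ 𝒮[A] ≫ g ⊗ₘ f ≫ 𝒮[A] ≫ g) := by
  simp only [Category.assoc, IsComonHom.hom_comul]
  rw [reassoc_of% HopfObj.antipode_comul A, IsComonHom.hom_comul_assoc]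
  rw [braiding_naturality_assoc, tensorHom_comp_tensorHom, tensorHom_comp_tensorHom]

theorem iA_antipode : P.iA ≫ 𝒮[H] = 𝒮[A] ≫ P.iA := HopfObj.hom_antipode _

theorem antipode_pA : 𝒮[H] ≫ P.pA = P.pA ≫ 𝒮[A] := (HopfObj.hom_antipode _).symm

theorem conv_antipode_iA : Δ[A] ≫ (𝒮[A] ≫ P.iA ⊗ₘ P.iA) ≫ μ[H] = ε[A] ≫ η[H] := by
  have : (𝒮[A] ≫ P.iA ⊗ₘ P.iA) = 𝒮[A] ▷ A ≫ (P.iA ⊗ₘ P.iA) := by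
    rw [← tensorHom_id, tensorHom_comp_tensorHom, Category.id_comp]
  rw [this, Category.assoc, ← IsMonHom.mul_hom, HopfObj.antipode_left_assoc, IsMonHom.one_hom]

theorem conv_iA_antipode : Δ[A] ≫ (P.iA ⊗ₘ 𝒮[A] ≫ P.iA) ≫ μ[H] = ε[A] ≫ η[H] := by
  have : (P.iA ⊗ₘ 𝒮[A] ≫ P.iA) = A ◁ 𝒮[A] ≫ (P.iA ⊗ₘ P.iA) := by
    rw [← id_tensorHom, tensorHom_comp_tensorHom, Category.id_comp]
  rw [this, Category.assoc, ← IsMonHom.mul_hom, HopfObj.antipode_right_assoc, IsMonHom.one_hom]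

theorem conv_pA_antipode : Δ[H] ≫ (P.pA ≫ 𝒮[A] ⊗ₘ P.pA) ≫ μ[A] = ε[H] ≫ η[A] := by
  have : (P.pA ≫ 𝒮[A] ⊗ₘ P.pA) = (P.pA ⊗ₘ P.pA) ≫ 𝒮[A] ▷ A := by
    rw [← tensorHom_id, tensorHom_comp_tensorHom, Category.comp_id]
  rw [this, Category.assoc, ← IsComonHom.hom_comul_assoc, HopfObj.antipode_left,
    IsComonHom.hom_counit_assoc]

/-- The idempotent that projects `H` to its left `A`-coinvariants. -/
def proj : H ⟶ H := Δ[H] ≫ (P.pA ≫ 𝒮[A] ≫ P.iA) ▷ H ≫ μ[H]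

theorem proj_eq : P.proj = Δ[H] ≫ (P.pA ≫ 𝒮[A] ≫ P.iA ⊗ₘ 𝟙 H) ≫ μ[H] := by
  rw [proj, tensorHom_id]

/-- `proj` is left `A`-invariant. -/
theorem iA_mul_proj : P.iA ▷ H ≫ μ[H] ≫ P.proj = ε[A] ▷ H ≫ (λ_ H).hom ≫ P.proj := by
  rw [proj_eq]
  exact conv_mul_left (d := Δ[A]) (o := η[H]) (BimonObj.mul_comul H) (MonObj.mul_assoc H)
    (MonObj.mul_one H) (IsComonHom.hom_comul _) (antipode_mul _ _) (by simp) (by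
      rw [P.iA_pA_assoc, Category.comp_id, P.conv_antipode_iA])

/-- `proj` has left `A`-coinvariant image. -/
theorem proj_comul_pA : P.proj ≫ Δ[H] ≫ P.pA ▷ H = P.proj ≫ (λ_ H).inv ≫ η[A] ▷ H := by
  have h := conv_comul_left (m := μ[H]) (D := Δ[H]) (u := P.pA) (d := μ[A]) (e := η[A])
    (o := ε[H]) (f := P.pA ≫ 𝒮[A] ≫ P.iA) (k := 𝟙 H) (BimonObj.mul_comul H) (comul_assoc' H)
    (ComonObj.comul_counit H) (IsMonHom.mul_hom _) (antipode_comul _ _) (by simp) (by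
      rw [Category.assoc, Category.assoc, P.iA_pA, Category.comp_id, Category.id_comp,
        P.conv_pA_antipode])
  simpa only [proj_eq, Category.assoc] using h

/-- A map into `H` with left `A`-coinvariant image is fixed by `proj`. -/
theorem comp_proj {X : C} {c : X ⟶ H} (h : c ≫ Δ[H] ≫ P.pA ▷ H = c ≫ (λ_ H).inv ≫ η[A] ▷ H) :
    c ≫ P.proj = c := by
  simp only [proj, comp_whiskerRight, Category.assoc]
  rw [reassoc_of% h, ← comp_whiskerRight_assoc, HopfObj.one_antipode, ← comp_whiskerRight_assoc,
    IsMonHom.one_hom]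
  simp

/-- A left `A`-invariant map from `H` is fixed by `proj`. -/
theorem proj_comp {X : C} {c : H ⟶ X} (h : P.iA ▷ H ≫ μ[H] ≫ c = ε[A] ▷ H ≫ (λ_ H).hom ≫ c) :
    P.proj ≫ c = c := by
  simp only [proj, comp_whiskerRight, Category.assoc]
  rw [h, ← comp_whiskerRight_assoc _ ε[A], HopfObj.antipode_counit, ← comp_whiskerRight_assoc,
    IsComonHom.hom_counit]
  simp

theorem proj_proj : P.proj ≫ P.proj = P.proj := P.proj_comp P.iA_mul_proj

end HopfProjection

/-- A Hopf algebra projection together with a splitting `q ≫ i` of the idempotent that projects `H`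
to its left `A`-coinvariants. -/
structure SplitHopfProjection {C : Type u} [Category.{v} C] [MonoidalCategory C]
    [BraidedCategory C] (A H : C) [HopfObj A] [HopfObj H] extends HopfProjection A H where
  /-- The object of coinvariants. -/
  B : C
  /-- The inclusion of the coinvariants. -/
  i : B ⟶ H
  /-- The projection to the coinvariants. -/
  q : H ⟶ B
  i_q : i ≫ q = 𝟙 B
  q_i : q ≫ i = toHopfProjection.proj

namespace SplitHopfProjection
variable {C : Type u} [Category.{v} C] [MonoidalCategory C] [BraidedCategory C]
  {A H : C} [HopfObj A] [HopfObj H] (P : SplitHopfProjection A H)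

attribute [simp] i_q

@[simp]
theorem i_q_assoc {X : C} (f : P.B ⟶ X) : P.i ≫ P.q ≫ f = f := by
  rw [← Category.assoc, P.i_q, Category.id_comp]

theorem iA_mul_q : P.iA ▷ H ≫ μ[H] ≫ P.q = ε[A] ▷ H ≫ (λ_ H).hom ≫ P.q := by
  have h := P.iA_mul_proj
  rw [← P.q_i] at h
  simpa using congrArg (· ≫ P.q) h

theorem i_comul_pA : P.i ≫ Δ[H] ≫ P.pA ▷ H = P.i ≫ (λ_ H).inv ≫ η[A] ▷ H := by
  have h := P.proj_comul_pA
  rw [← P.q_i] at h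
  simpa using congrArg (P.i ≫ ·) h

theorem comp_q_i {X : C} {c : X ⟶ H} (h : c ≫ Δ[H] ≫ P.pA ▷ H = c ≫ (λ_ H).inv ≫ η[A] ▷ H) :
    c ≫ P.q ≫ P.i = c := by
  rw [P.q_i, P.comp_proj h]

theorem q_i_comp {X : C} {c : H ⟶ X} (h : P.iA ▷ H ≫ μ[H] ≫ c = ε[A] ▷ H ≫ (λ_ H).hom ≫ c) :
    P.q ≫ P.i ≫ c = c := by
  rw [reassoc_of% P.q_i, P.proj_comp h]

/-- An element `h` of `H` is recovered as `p_A(h₁) q(h₂)`, as the antipode in `q` cancels `p_A`. -/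
theorem comul_mul_eq : Δ[H] ≫ (P.pA ≫ P.iA ⊗ₘ P.q ≫ P.i) ≫ μ[H] = 𝟙 H := by
  have hm := MonObj.mul_assoc H
  rw [← Iso.inv_comp_eq] at hm
  rw [P.q_i, HopfProjection.proj]
  calc _ = Δ[H] ≫ H ◁ Δ[H] ⊗≫ H ◁ (P.pA ≫ 𝒮[A] ≫ P.iA) ▷ H ⊗≫
        (H ◁ μ[H] ≫ (P.pA ≫ P.iA) ▷ H) ≫ μ[H] := by
        rw [MonoidalCategory.tensorHom_def']; monoidal
    _ = (Δ[H] ≫ H ◁ Δ[H]) ⊗≫ H ◁ (P.pA ≫ 𝒮[A] ≫ P.iA) ▷ H ⊗≫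
        (P.pA ≫ P.iA) ▷ H ▷ H ⊗≫ (H ◁ μ[H] ≫ μ[H]) := by
        rw [whisker_exchange]; monoidal
    _ = Δ[H] ≫ (Δ[H] ≫ H ◁ (P.pA ≫ 𝒮[A] ≫ P.iA) ≫ (P.pA ≫ P.iA) ▷ H ≫ μ[H]) ▷ H ≫ μ[H] := by
        rw [← hm, ComonObj.comul_assoc]; monoidal
    _ = Δ[H] ≫ (Δ[H] ≫ (P.pA ⊗ₘ P.pA) ≫ (P.iA ⊗ₘ 𝒮[A] ≫ P.iA) ≫ μ[H]) ▷ H ≫ μ[H] := by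
        rw [tensorHom_comp_tensorHom_assoc, MonoidalCategory.tensorHom_def', Category.assoc]
    _ = _ := by
        rw [← IsComonHom.hom_comul_assoc, P.conv_iA_antipode, IsComonHom.hom_counit_assoc]; simp

/-- The product of two coinvariants is coinvariant. -/
theorem i_mul_i : (P.i ⊗ₘ P.i) ≫ μ[H] ≫ P.q ≫ P.i = (P.i ⊗ₘ P.i) ≫ μ[H] := by
  have := P.comp_q_i (c := (P.i ⊗ₘ P.i) ≫ μ[H]) ?_
  · simpa using this
  have h := mul_comul_factor_right (BimonObj.mul_comul H) (f := P.i) (g := P.i) (p := P.pA)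
    (q := 𝟙 H) (p₁ := P.pA) (q₁ := 𝟙 H) (p₂ := P.pA) (q₂ := 𝟙 H) (U := μ[A]) (V := μ[H])
    (F := (λ_ P.B).inv ≫ η[A] ▷ P.B ≫ A ◁ P.i) (G := P.i ≫ (λ_ H).inv ≫ η[A] ▷ H)
    (IsMonHom.mul_hom _) (by simp)
    (by rw [tensorHom_id, P.i_comul_pA, ← whisker_exchange, leftUnitor_inv_naturality_assoc])
    (by rw [tensorHom_id, P.i_comul_pA])
  rw [tensorHom_id] at h
  rw [Category.assoc, h]
  simp only [tensorμ, MonoidalCategory.tensorHom_def]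
  calc _ = 𝟙 _ ⊗≫ η[A] ▷ P.B ▷ P.B ⊗≫ A ◁ P.i ▷ P.B ⊗≫ A ◁ H ◁ P.i ⊗≫
        A ◁ (H ◁ η[A] ≫ (β_ H A).hom) ▷ H ⊗≫ μ[A] ▷ (H ⊗ H) ≫ A ◁ μ[H] := by
        monoidal
    _ = 𝟙 _ ⊗≫ η[A] ▷ P.B ▷ P.B ⊗≫ A ◁ P.i ▷ P.B ⊗≫ A ◁ H ◁ P.i ⊗≫
        (A ◁ η[A] ≫ μ[A]) ▷ H ▷ H ⊗≫ A ◁ μ[H] := by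
        rw [braiding_naturality_right, braiding_tensorUnit_right]; monoidal
    _ = 𝟙 _ ⊗≫ (η[A] ▷ (P.B ⊗ P.B) ≫ A ◁ (P.i ▷ P.B ≫ H ◁ P.i ≫ μ[H])) := by
        rw [MonObj.mul_one]; monoidal
    _ = _ := by rw [← whisker_exchange]; monoidal

/-- The comultiplication of `H` descends to the quotient `B`. -/
theorem comul_q_q : P.q ≫ P.i ≫ Δ[H] ≫ (P.q ⊗ₘ P.q) = Δ[H] ≫ (P.q ⊗ₘ P.q) := by
  refine P.q_i_comp ?_
  have h := mul_comul_factor (BimonObj.mul_comul H) (f := P.iA) (g := 𝟙 H) (p := P.q) (q := P.q)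
    (F := Δ[A]) (G := Δ[H]) (f₁ := P.iA) (f₂ := P.iA) (g₁ := 𝟙 H) (g₂ := 𝟙 H)
    (U := ε[A] ▷ H ≫ (λ_ H).hom ≫ P.q) (V := ε[A] ▷ H ≫ (λ_ H).hom ≫ P.q) (by simp) (by simp)
    (by rw [tensorHom_id, P.iA_mul_q]) (by rw [tensorHom_id, P.iA_mul_q])
  rw [tensorHom_id] at h
  rw [h]
  simp only [tensorμ, MonoidalCategory.tensorHom_def]
  calc _ = 𝟙 _ ⊗≫ Δ[A] ▷ H ⊗≫ (A ⊗ A) ◁ Δ[H] ⊗≫ A ◁ (β_ A H).hom ▷ H ⊗≫ ε[A] ▷ H ▷ A ▷ H ⊗≫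
        (P.q ▷ (A ⊗ H) ≫ P.B ◁ (ε[A] ▷ H)) ⊗≫ P.B ◁ P.q := by
        monoidal
    _ = 𝟙 _ ⊗≫ Δ[A] ▷ H ⊗≫ (A ⊗ A) ◁ Δ[H] ⊗≫ A ◁ (β_ A H).hom ▷ H ⊗≫
        (ε[A] ▷ (H ⊗ A) ≫ 𝟙_ C ◁ (H ◁ ε[A])) ▷ H ⊗≫ P.q ▷ H ⊗≫ P.B ◁ P.q := by
        rw [← whisker_exchange]; monoidal
    _ = 𝟙 _ ⊗≫ Δ[A] ▷ H ⊗≫ (A ⊗ A) ◁ Δ[H] ⊗≫ A ◁ ((β_ A H).hom ≫ H ◁ ε[A]) ▷ H ⊗≫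
        ε[A] ▷ H ▷ H ⊗≫ P.q ▷ H ⊗≫ P.B ◁ P.q := by
        rw [← whisker_exchange]; monoidal
    _ = 𝟙 _ ⊗≫ (Δ[A] ▷ H ≫ (A ⊗ A) ◁ Δ[H]) ⊗≫ A ◁ ε[A] ▷ H ▷ H ⊗≫
        ε[A] ▷ H ▷ H ⊗≫ P.q ▷ H ⊗≫ P.B ◁ P.q := by
        rw [← braiding_naturality_left, braiding_tensorUnit_left]; monoidal
    _ = 𝟙 _ ⊗≫ A ◁ Δ[H] ⊗≫ (Δ[A] ≫ A ◁ ε[A]) ▷ H ▷ H ⊗≫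
        ε[A] ▷ H ▷ H ⊗≫ P.q ▷ H ⊗≫ P.B ◁ P.q := by
        rw [← whisker_exchange]; monoidal
    _ = 𝟙 _ ⊗≫ (A ◁ Δ[H] ≫ ε[A] ▷ (H ⊗ H)) ⊗≫ P.q ▷ H ⊗≫ P.B ◁ P.q := by
        rw [ComonObj.comul_counit]; monoidal
    _ = _ := by rw [whisker_exchange]; monoidal

/-- Replacing an element of `H` by its projection to the coinvariants does not change its products
in the quotient `B`; so `B` is a right `H`-module. -/
theorem q_i_mul : (P.q ≫ P.i) ▷ H ≫ μ[H] ≫ P.q = μ[H] ≫ P.q := by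
  have hm := MonObj.mul_assoc H
  calc _ = Δ[H] ▷ H ≫ (P.pA ≫ 𝒮[A]) ▷ H ▷ H ≫ P.iA ▷ H ▷ H ≫ (μ[H] ▷ H ≫ μ[H]) ≫ P.q := by
        rw [P.q_i, HopfProjection.proj]; monoidal
    _ = Δ[H] ▷ H ⊗≫ (P.pA ≫ 𝒮[A]) ▷ H ▷ H ⊗≫ (P.iA ▷ (H ⊗ H) ≫ H ◁ μ[H]) ≫ μ[H] ≫ P.q := by
        rw [hm]; monoidal
    _ = Δ[H] ▷ H ⊗≫ (P.pA ≫ 𝒮[A]) ▷ H ▷ H ⊗≫ A ◁ μ[H] ≫ P.iA ▷ H ≫ μ[H] ≫ P.q := by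
        rw [← whisker_exchange]; monoidal
    _ = Δ[H] ▷ H ⊗≫ (P.pA ≫ 𝒮[A]) ▷ H ▷ H ⊗≫ (A ◁ μ[H] ≫ ε[A] ▷ H) ≫ (λ_ H).hom ≫ P.q := by
        rw [P.iA_mul_q]; monoidal
    _ = (Δ[H] ≫ (P.pA ≫ 𝒮[A] ≫ ε[A]) ▷ H) ▷ H ⊗≫ μ[H] ≫ P.q := by
        rw [whisker_exchange]; monoidal
    _ = _ := by
        rw [HopfObj.antipode_counit, IsComonHom.hom_counit, ComonObj.counit_comul]; monoidal

/-- The left leg of the comultiplication of a coinvariant element is coinvariant; so `B` is a right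
`H`-comodule. -/
theorem comul_q_i : P.i ≫ Δ[H] ≫ (P.q ≫ P.i) ▷ H = P.i ≫ Δ[H] := by
  calc _ = P.i ≫ (Δ[H] ≫ Δ[H] ▷ H) ≫ P.pA ▷ H ▷ H ⊗≫ (𝒮[A] ≫ P.iA) ▷ H ▷ H ⊗≫ μ[H] ▷ H := by
        rw [P.q_i, HopfProjection.proj]; monoidal
    _ = P.i ≫ Δ[H] ≫ (H ◁ Δ[H] ≫ P.pA ▷ (H ⊗ H)) ⊗≫ (𝒮[A] ≫ P.iA) ▷ H ▷ H ⊗≫ μ[H] ▷ H := by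
        rw [comul_assoc']; monoidal
    _ = (P.i ≫ Δ[H] ≫ P.pA ▷ H) ≫ A ◁ Δ[H] ⊗≫ (𝒮[A] ≫ P.iA) ▷ H ▷ H ⊗≫ μ[H] ▷ H := by
        rw [whisker_exchange]; monoidal
    _ = P.i ≫ (λ_ H).inv ≫ (η[A] ▷ H ≫ A ◁ Δ[H]) ⊗≫ (𝒮[A] ≫ P.iA) ▷ H ▷ H ⊗≫ μ[H] ▷ H := by
        rw [P.i_comul_pA]; monoidal
    _ = P.i ≫ Δ[H] ⊗≫ ((η[A] ≫ 𝒮[A] ≫ P.iA) ▷ H ≫ μ[H]) ▷ H := by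
        rw [← whisker_exchange]; monoidal
    _ = _ := by
        rw [HopfObj.one_antipode_assoc, IsMonHom.one_hom, MonObj.one_mul]; monoidal

/-- The antipode of the coinvariants, extended to `H`: the convolution product of the antipode of
`H` and the projection `pA ≫ iA`. -/
def T : H ⟶ H := Δ[H] ≫ (𝒮[H] ⊗ₘ P.pA ≫ P.iA) ≫ μ[H]

/-- `T` is left `A`-invariant. -/
theorem q_i_T : P.q ≫ P.i ≫ P.T = P.T := by
  refine P.q_i_comp ?_
  refine conv_mul_left (o := η[H]) (d := Δ[A]) (BimonObj.mul_comul H) (MonObj.mul_assoc H)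
    (MonObj.mul_one H) (IsComonHom.hom_comul _) (HopfObj.mul_antipode _) (by simp) ?_
  rw [P.iA_antipode, P.iA_pA_assoc, P.conv_antipode_iA]

/-- `T` has left `A`-coinvariant image. -/
theorem T_q_i : P.T ≫ P.q ≫ P.i = P.T := by
  refine P.comp_q_i ?_
  have := conv_comul_left (o := ε[H]) (d := μ[A]) (u := P.pA) (e := η[A]) (f := 𝒮[H])
    (k := P.pA ≫ P.iA) (BimonObj.mul_comul H) (comul_assoc' H)
    (ComonObj.comul_counit H) (IsMonHom.mul_hom _) (HopfObj.antipode_comul _) (by simp) (by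
      rw [P.antipode_pA, Category.assoc, P.iA_pA, Category.comp_id, P.conv_pA_antipode])
  simpa [T] using this

/-- `T`, read in the quotient `B`, is right `A`-equivariant. -/
theorem iA_mul_T_q : H ◁ P.iA ≫ μ[H] ≫ P.T ≫ P.q = P.T ▷ A ≫ H ◁ P.iA ≫ μ[H] ≫ P.q := by
  have := conv_mul_right (e := ε[A]) (q := P.q) (k := P.pA ≫ P.iA) (BimonObj.mul_comul H)
    (MonObj.mul_assoc H) (ComonObj.counit_comul A) (IsComonHom.hom_comul P.iA)
    (HopfObj.mul_antipode _) (by simp) (by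
      rw [P.iA_antipode, comp_whiskerRight_assoc, P.iA_mul_q, ← comp_whiskerRight_assoc,
        HopfObj.antipode_counit])
  simpa [T] using this

/-- `T`, restricted to the coinvariants, is right `A`-coequivariant. -/
theorem i_T_comul_pA : P.i ≫ P.T ≫ Δ[H] ≫ H ◁ P.pA = P.i ≫ Δ[H] ≫ H ◁ P.pA ≫ P.T ▷ A := by
  have := conv_comul_right (e := η[A]) (q := P.i) (k := P.pA ≫ P.iA) (BimonObj.mul_comul H)
    (comul_assoc' H) (MonObj.one_mul A) (IsMonHom.mul_hom P.pA)
    (HopfObj.antipode_comul _) (by simp) (by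
      rw [P.antipode_pA, comp_whiskerRight, reassoc_of% P.i_comul_pA, ← comp_whiskerRight,
        HopfObj.one_antipode])
  simpa [T] using this

/-! ### The coinvariants as a crossed module -/

/-- The right `H`-action on the quotient `B` of `H`, induced by right multiplication. -/
def actH : P.B ⊗ H ⟶ P.B := P.i ▷ H ≫ μ[H] ≫ P.q

/-- The right `H`-coaction on the subobject `B` of `H`, restricted from the comultiplication. -/
def coactH : P.B ⟶ P.B ⊗ H := P.i ≫ Δ[H] ≫ P.q ▷ H

theorem mul_q : μ[H] ≫ P.q = P.q ▷ H ≫ P.actH := by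
  rw [actH, ← comp_whiskerRight_assoc, P.q_i_mul]

theorem i_comul : P.i ≫ Δ[H] = P.coactH ≫ P.i ▷ H := by
  rw [coactH, Category.assoc, Category.assoc, ← comp_whiskerRight, P.comul_q_i]

theorem i_comul' : P.i ≫ Δ[H] = P.coactH ≫ (P.i ⊗ₘ 𝟙 H) := by
  rw [P.i_comul, tensorHom_id]

theorem actH_mul : P.actH ▷ H ≫ P.actH = (α_ P.B H H).hom ≫ P.B ◁ μ[H] ≫ P.actH := by
  calc _ = P.i ▷ H ▷ H ≫ μ[H] ▷ H ≫ P.q ▷ H ≫ P.actH := by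
        simp [actH]
    _ = P.i ▷ H ▷ H ≫ (μ[H] ▷ H ≫ μ[H]) ≫ P.q := by rw [← P.mul_q]; simp
    _ = 𝟙 _ ⊗≫ (P.i ▷ (H ⊗ H) ≫ H ◁ μ[H]) ≫ μ[H] ≫ P.q := by
        rw [MonObj.mul_assoc]; monoidal
    _ = _ := by rw [← whisker_exchange, actH]; monoidal

theorem coactH_comul : P.coactH ≫ P.coactH ▷ H = P.coactH ≫ P.B ◁ Δ[H] ≫ (α_ P.B H H).inv := by
  calc _ = (P.coactH ≫ P.i ▷ H) ≫ Δ[H] ▷ H ≫ P.q ▷ H ▷ H := by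
        simp [coactH]
    _ = P.i ≫ (Δ[H] ≫ Δ[H] ▷ H) ≫ P.q ▷ H ▷ H := by rw [← P.i_comul]; simp
    _ = P.i ≫ Δ[H] ≫ (H ◁ Δ[H] ≫ P.q ▷ (H ⊗ H)) ⊗≫ 𝟙 _ := by
        rw [comul_assoc']; monoidal
    _ = _ := by rw [whisker_exchange, coactH]; monoidal

theorem actH_one : P.B ◁ η[H] ≫ P.actH = (ρ_ P.B).hom := by
  rw [actH, ← Category.assoc, whisker_exchange]
  simp

theorem coactH_counit : P.coactH ≫ P.B ◁ ε[H] = (ρ_ P.B).inv := by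
  rw [coactH, Category.assoc, Category.assoc, ← whisker_exchange, ComonObj.comul_counit_assoc]
  simp

/-- The action of `A` on the coinvariants: right multiplication on `B` as a quotient of `H`, which
is the adjoint action on `B` as a subobject of `H`. -/
def act : P.B ⊗ A ⟶ P.B := P.B ◁ P.iA ≫ P.actH

/-- The coaction of `A` on the coinvariants: the restricted comultiplication on `B` as a subobject
of `H`, which is the coadjoint coaction on `B` as a quotient of `H`. -/
def coact : P.B ⟶ P.B ⊗ A := P.coactH ≫ P.B ◁ P.pA

/-- The multiplication of the coinvariants. -/
def mulB : P.B ⊗ P.B ⟶ P.B := P.B ◁ P.i ≫ P.actH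

/-- The comultiplication of the coinvariants. -/
def comulB : P.B ⟶ P.B ⊗ P.B := P.coactH ≫ P.B ◁ P.q

theorem act_eq : P.act = (P.i ⊗ₘ P.iA) ≫ μ[H] ≫ P.q := by
  rw [act, actH, MonoidalCategory.tensorHom_def', Category.assoc]

theorem coact_eq : P.coact = P.i ≫ Δ[H] ≫ (P.q ⊗ₘ P.pA) := by
  simp [coact, coactH, MonoidalCategory.tensorHom_def]

theorem mulB_eq : P.mulB = (P.i ⊗ₘ P.i) ≫ μ[H] ≫ P.q := by
  rw [mulB, actH, MonoidalCategory.tensorHom_def', Category.assoc]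

theorem comulB_eq : P.comulB = P.i ≫ Δ[H] ≫ (P.q ⊗ₘ P.q) := by
  simp [comulB, coactH, MonoidalCategory.tensorHom_def]

theorem mulB_i : P.mulB ≫ P.i = (P.i ⊗ₘ P.i) ≫ μ[H] := by
  rw [mulB_eq, Category.assoc, Category.assoc, P.i_mul_i]

theorem q_comulB : P.q ≫ P.comulB = Δ[H] ≫ (P.q ⊗ₘ P.q) := by
  rw [comulB_eq, P.comul_q_q]

theorem act_one : P.B ◁ η[A] ≫ P.act = (ρ_ P.B).hom := by
  rw [act, ← whiskerLeft_comp_assoc, IsMonHom.one_hom, P.actH_one]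

theorem coact_counit : P.coact ≫ P.B ◁ ε[A] = (ρ_ P.B).inv := by
  rw [coact, Category.assoc, ← whiskerLeft_comp, IsComonHom.hom_counit, P.coactH_counit]

theorem act_mul : P.act ▷ A ≫ P.act = (α_ P.B A A).hom ≫ P.B ◁ μ[A] ≫ P.act := by
  calc _ = (P.B ◁ P.iA) ▷ A ≫ (P.actH ▷ A ≫ P.B ◁ P.iA) ≫ P.actH := by simp [act]
    _ = (P.B ◁ P.iA) ▷ A ≫ (P.B ⊗ H) ◁ P.iA ≫ P.actH ▷ H ≫ P.actH := by
        rw [← whisker_exchange]; simp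
    _ = (α_ P.B A A).hom ≫ P.B ◁ ((P.iA ⊗ₘ P.iA) ≫ μ[H]) ≫ P.actH := by
        rw [P.actH_mul, MonoidalCategory.tensorHom_def]; monoidal
    _ = _ := by rw [← IsMonHom.mul_hom, act, whiskerLeft_comp_assoc]

theorem coact_comul : P.coact ≫ P.coact ▷ A = P.coact ≫ P.B ◁ Δ[A] ≫ (α_ P.B A A).inv := by
  calc _ = P.coactH ≫ (P.B ◁ P.pA ≫ P.coactH ▷ A) ≫ (P.B ◁ P.pA) ▷ A := by simp [coact]
    _ = (P.coactH ≫ P.coactH ▷ H) ≫ (P.B ⊗ H) ◁ P.pA ≫ (P.B ◁ P.pA) ▷ A := by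
        rw [whisker_exchange]; simp
    _ = P.coactH ≫ P.B ◁ (Δ[H] ≫ (P.pA ⊗ₘ P.pA)) ≫ (α_ P.B A A).inv := by
        rw [P.coactH_comul, MonoidalCategory.tensorHom_def']; monoidal
    _ = _ := by rw [← IsComonHom.hom_comul, coact]; simp only [whiskerLeft_comp, Category.assoc]

theorem mulB_assoc : P.mulB ▷ P.B ≫ P.mulB = (α_ P.B P.B P.B).hom ≫ P.B ◁ P.mulB ≫ P.mulB := by
  calc _ = (P.B ◁ P.i) ▷ P.B ≫ (P.actH ▷ P.B ≫ P.B ◁ P.i) ≫ P.actH := by simp [mulB]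
    _ = (P.B ◁ P.i) ▷ P.B ≫ (P.B ⊗ H) ◁ P.i ≫ P.actH ▷ H ≫ P.actH := by
        rw [← whisker_exchange]; simp
    _ = (α_ P.B P.B P.B).hom ≫ P.B ◁ ((P.i ⊗ₘ P.i) ≫ μ[H]) ≫ P.actH := by
        rw [P.actH_mul, MonoidalCategory.tensorHom_def]; monoidal
    _ = _ := by rw [← mulB_i, mulB]; simp

theorem comulB_assoc : P.comulB ≫ P.B ◁ P.comulB =
    P.comulB ≫ P.comulB ▷ P.B ≫ (α_ P.B P.B P.B).hom := by
  symm
  calc _ = P.coactH ≫ (P.B ◁ P.q ≫ P.coactH ▷ P.B) ≫ (P.B ◁ P.q) ▷ P.B ≫ (α_ _ _ _).hom := by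
        simp [comulB]
    _ = (P.coactH ≫ P.coactH ▷ H) ≫ (P.B ⊗ H) ◁ P.q ≫ (P.B ◁ P.q) ▷ P.B ≫ (α_ _ _ _).hom := by
        rw [whisker_exchange]; simp
    _ = P.coactH ≫ P.B ◁ (Δ[H] ≫ (P.q ⊗ₘ P.q)) := by
        rw [P.coactH_comul, MonoidalCategory.tensorHom_def']; monoidal
    _ = _ := by rw [← q_comulB, comulB]; simp

/-- The comparison map `A ⊗ B ⟶ H`. -/
def theta : A ⊗ P.B ⟶ H := (P.iA ⊗ₘ P.i) ≫ μ[H]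

/-- The inverse of the comparison map. -/
def thetaInv : H ⟶ A ⊗ P.B := Δ[H] ≫ (P.pA ⊗ₘ P.q)

theorem thetaInv_theta : P.thetaInv ≫ P.theta = 𝟙 H := by
  rw [theta, thetaInv, Category.assoc, tensorHom_comp_tensorHom_assoc, P.comul_mul_eq]

theorem iA_comul_pA : P.iA ≫ Δ[H] ≫ P.pA ▷ H = Δ[A] ≫ A ◁ P.iA := by
  rw [IsComonHom.hom_comul_assoc, ← tensorHom_id, tensorHom_comp_tensorHom]
  simp

theorem theta_thetaInv : P.theta ≫ P.thetaInv = 𝟙 _ := by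
  have h := mul_comul_factor_right (BimonObj.mul_comul H) (f := P.iA) (g := P.i) (p := P.pA)
    (q := P.q) (p₁ := P.pA) (q₁ := 𝟙 H) (p₂ := P.pA) (q₂ := 𝟙 H) (U := μ[A]) (V := μ[H] ≫ P.q)
    (F := Δ[A] ≫ A ◁ P.iA) (G := P.i ≫ (λ_ H).inv ≫ η[A] ▷ H) (IsMonHom.mul_hom _) (by simp)
    (by rw [tensorHom_id, P.iA_comul_pA]) (by rw [tensorHom_id, P.i_comul_pA])
  rw [theta, thetaInv, Category.assoc, h]
  simp only [tensorμ, MonoidalCategory.tensorHom_def]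
  calc _ = 𝟙 _ ⊗≫ Δ[A] ▷ P.B ⊗≫ A ◁ (P.iA ▷ P.B ≫ H ◁ P.i) ⊗≫
        A ◁ (H ◁ η[A] ≫ (β_ H A).hom) ▷ H ⊗≫ μ[A] ▷ (H ⊗ H) ≫ A ◁ (μ[H] ≫ P.q) := by
        monoidal
    _ = 𝟙 _ ⊗≫ Δ[A] ▷ P.B ⊗≫ A ◁ (P.iA ▷ P.B ≫ H ◁ P.i) ⊗≫
        (A ◁ η[A] ≫ μ[A]) ▷ H ▷ H ⊗≫ A ◁ (μ[H] ≫ P.q) := by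
        rw [braiding_naturality_right, braiding_tensorUnit_right]; monoidal
    _ = 𝟙 _ ⊗≫ Δ[A] ▷ P.B ⊗≫ A ◁ A ◁ P.i ⊗≫ A ◁ (P.iA ▷ H ≫ μ[H] ≫ P.q) := by
        rw [MonObj.mul_one, ← whisker_exchange]; monoidal
    _ = 𝟙 _ ⊗≫ Δ[A] ▷ P.B ⊗≫ A ◁ (A ◁ P.i ≫ ε[A] ▷ H) ⊗≫ A ◁ P.q := by
        rw [P.iA_mul_q]; monoidal
    _ = 𝟙 _ ⊗≫ (Δ[A] ≫ A ◁ ε[A]) ▷ P.B ⊗≫ A ◁ (P.i ≫ P.q) := by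
        rw [whisker_exchange]; monoidal
    _ = _ := by rw [ComonObj.comul_counit, P.i_q]; monoidal

/-- The product of a coinvariant element with an element of `A`, in this order, is reordered by the
map `B ⊗ A ⟶ A ⊗ B` of the cross product. -/
theorem mul_thetaInv : (P.i ⊗ₘ P.iA) ≫ μ[H] ≫ P.thetaInv = crossedBraid P.act Δ[A] := by
  have h := mul_comul_factor_right (BimonObj.mul_comul H) (f := P.i) (g := P.iA) (p := P.pA)
    (q := P.q) (p₁ := P.pA) (q₁ := 𝟙 H) (p₂ := P.pA) (q₂ := 𝟙 H) (U := μ[A]) (V := μ[H] ≫ P.q)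
    (G := Δ[A] ≫ A ◁ P.iA) (F := P.i ≫ (λ_ H).inv ≫ η[A] ▷ H) (IsMonHom.mul_hom _) (by simp)
    (by rw [tensorHom_id, P.i_comul_pA]) (by rw [tensorHom_id, P.iA_comul_pA])
  rw [thetaInv, h, crossedBraid, P.act_eq]
  simp only [tensorμ, MonoidalCategory.tensorHom_def]
  calc _ = 𝟙 _ ⊗≫ (P.i ≫ (λ_ H).inv ≫ η[A] ▷ H) ▷ A ⊗≫ A ◁ H ◁ Δ[A] ⊗≫ A ◁ H ◁ A ◁ P.iA ⊗≫
        A ◁ (β_ H A).hom ▷ H ⊗≫ (μ[A] ▷ (H ⊗ H) ≫ A ◁ (μ[H] ≫ P.q)) := by monoidal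
    _ = 𝟙 _ ⊗≫ P.i ▷ A ⊗≫ (η[A] ▷ (H ⊗ A) ≫ A ◁ (H ◁ Δ[A] ⊗≫ H ◁ A ◁ P.iA ⊗≫
        (β_ H A).hom ▷ H)) ⊗≫ (A ⊗ A) ◁ (μ[H] ≫ P.q) ⊗≫ μ[A] ▷ P.B := by
        rw [← whisker_exchange]; monoidal
    _ = 𝟙 _ ⊗≫ P.i ▷ A ⊗≫ H ◁ Δ[A] ⊗≫ ((H ⊗ A) ◁ P.iA ≫
        (β_ H A).hom ▷ H) ⊗≫ (η[A] ▷ (A ⊗ H ⊗ H) ≫ A ◁ A ◁ (μ[H] ≫ P.q)) ⊗≫ μ[A] ▷ P.B := by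
        rw [← whisker_exchange]; monoidal
    _ = 𝟙 _ ⊗≫ (P.i ▷ A ≫ H ◁ Δ[A]) ⊗≫ (β_ H A).hom ▷ A ⊗≫ A ◁ H ◁ P.iA ⊗≫
        A ◁ (μ[H] ≫ P.q) ⊗≫ (η[A] ▷ A ≫ μ[A]) ▷ P.B := by
        rw [← whisker_exchange, whisker_exchange]; monoidal
    _ = 𝟙 _ ⊗≫ P.B ◁ Δ[A] ⊗≫ (P.i ▷ A ≫ (β_ H A).hom) ▷ A ⊗≫ A ◁ H ◁ P.iA ⊗≫
        A ◁ (μ[H] ≫ P.q) := by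
        rw [MonObj.one_mul, ← whisker_exchange]; monoidal
    _ = _ := by rw [braiding_naturality_left]; monoidal

/-- Taking the legs of the comultiplication in the opposite order amounts to the map `A ⊗ B ⟶ B ⊗ A`
of the cross product. -/
theorem theta_comul : P.theta ≫ Δ[H] ≫ (P.q ⊗ₘ P.pA) = crossedBraid μ[A] P.coact := by
  have h := mul_comul_factor (BimonObj.mul_comul H) (f := P.iA) (g := P.i) (p := P.q)
    (q := P.pA) (F := Δ[A]) (G := P.i ≫ Δ[H]) (f₁ := P.iA) (f₂ := P.iA) (g₁ := 𝟙 H) (g₂ := 𝟙 H)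
    (U := ε[A] ▷ H ≫ (λ_ H).hom ≫ P.q) (V := A ◁ P.pA ≫ μ[A]) (by simp) (by simp)
    (by rw [tensorHom_id, P.iA_mul_q])
    (by rw [IsMonHom.mul_hom, tensorHom_comp_tensorHom_assoc, P.iA_pA, Category.id_comp,
      id_tensorHom])
  rw [theta, Category.assoc, h, crossedBraid, P.coact_eq]
  simp only [tensorμ, MonoidalCategory.tensorHom_def]
  calc _ = 𝟙 _ ⊗≫ Δ[A] ▷ P.B ⊗≫ (A ◁ (A ◁ (P.i ≫ Δ[H]) ⊗≫ (β_ A H).hom ▷ H) ≫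
        ε[A] ▷ ((H ⊗ A) ⊗ H)) ⊗≫ (P.q ▷ (A ⊗ H) ≫ P.B ◁ (A ◁ P.pA)) ⊗≫ P.B ◁ μ[A] := by
        monoidal
    _ = 𝟙 _ ⊗≫ (Δ[A] ≫ ε[A] ▷ A) ▷ P.B ⊗≫ A ◁ (P.i ≫ Δ[H]) ⊗≫
        ((β_ A H).hom ≫ P.q ▷ A) ▷ H ⊗≫ (P.B ⊗ A) ◁ P.pA ⊗≫ P.B ◁ μ[A] := by
        rw [whisker_exchange]; monoidal
    _ = 𝟙 _ ⊗≫ A ◁ (P.i ≫ Δ[H] ≫ P.q ▷ H) ⊗≫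
        ((β_ A P.B).hom ▷ H ≫ (P.B ⊗ A) ◁ P.pA) ⊗≫ P.B ◁ μ[A] := by
        rw [ComonObj.counit_comul, ← braiding_naturality_right]; monoidal
    _ = _ := by rw [← whisker_exchange]; monoidal

theorem i_mul_iA : (P.i ⊗ₘ P.iA) ≫ μ[H] = crossedBraid P.act Δ[A] ≫ P.theta := by
  rw [← P.mul_thetaInv]
  simp [P.thetaInv_theta]

theorem comul_q_pA : Δ[H] ≫ (P.q ⊗ₘ P.pA) = P.thetaInv ≫ crossedBraid μ[A] P.coact := by
  rw [← P.theta_comul, reassoc_of% P.thetaInv_theta]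

/-- The bialgebra axiom for the product of a coinvariant element and an element of `A`: the right
hand side is that of the compatibility condition of a crossed module. -/
theorem mul_comul_act_coact : (P.i ⊗ₘ P.iA) ≫ μ[H] ≫ Δ[H] ≫ (P.q ⊗ₘ P.pA) =
    (P.coact ⊗ₘ Δ[A]) ≫ tensorμ P.B A A A ≫ (P.act ⊗ₘ μ[A]) := by
  refine mul_comul_factor_both (BimonObj.mul_comul H) P.i_comul' (IsComonHom.hom_comul P.iA)
    (a₁ := 𝟙 _) (a₂ := P.pA) (b₁ := 𝟙 _) (b₂ := 𝟙 _) ?_ (by simp) ?_ ?_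
  · rw [id_tensorHom, coact]
  · rw [P.act_eq]; simp
  · rw [IsMonHom.mul_hom, tensorHom_comp_tensorHom_assoc, P.iA_pA, Category.id_comp]

theorem crossed : CrossedCompat μ[A] Δ[A] P.act P.coact := by
  have h : crossedBraid P.act Δ[A] ≫ crossedBraid μ[A] P.coact =
      (P.coact ⊗ₘ Δ[A]) ≫ tensorμ P.B A A A ≫ (P.act ⊗ₘ μ[A]) := by
    rw [← P.mul_thetaInv, ← P.theta_comul, ← P.mul_comul_act_coact]
    simp only [Category.assoc]
    rw [reassoc_of% P.thetaInv_theta]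
  simpa only [CrossedCompat, crossedBraid, Category.assoc] using h

/-- The coinvariants as a crossed module. -/
def crossedModule : CrossedModule A where
  X := P.B
  act := P.act
  coact := P.coact
  act_one := P.act_one
  act_mul := P.act_mul
  coact_counit := P.coact_counit
  coact_comul := P.coact_comul
  crossed := P.crossed

end SplitHopfProjection

/-! ### The coinvariants as a Hopf algebra in crossed modules -/

theorem conv_assoc {C : Type u} [Category.{v} C] [MonoidalCategory C] {H M : C} [ComonObj H]
    [MonObj M] (f g h : H ⟶ M) :
    Δ[H] ≫ (Δ[H] ≫ (f ⊗ₘ g) ≫ μ[M] ⊗ₘ h) ≫ μ[M] =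
      Δ[H] ≫ (f ⊗ₘ Δ[H] ≫ (g ⊗ₘ h) ≫ μ[M]) ≫ μ[M] := by
  have hm := MonObj.mul_assoc M
  rw [← Iso.inv_comp_eq] at hm
  calc _ = (Δ[H] ≫ Δ[H] ▷ H) ≫ ((f ⊗ₘ g) ⊗ₘ h) ≫ μ[M] ▷ M ≫ μ[M] := by
        simp only [← tensorHom_id, Category.assoc, tensorHom_comp_tensorHom_assoc,
          Category.id_comp, Category.comp_id]
    _ = (Δ[H] ≫ H ◁ Δ[H]) ≫ (f ⊗ₘ (g ⊗ₘ h)) ≫ M ◁ μ[M] ≫ μ[M] := by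
        rw [← hm, ComonObj.comul_assoc]
        simp
    _ = _ := by
        simp only [← id_tensorHom, Category.assoc, tensorHom_comp_tensorHom_assoc,
          Category.id_comp, Category.comp_id]

namespace SplitHopfProjection
variable {C : Type u} [Category.{v} C] [MonoidalCategory C] [BraidedCategory C]
  {A H : C} [HopfObj A] [HopfObj H] (P : SplitHopfProjection A H)

theorem one_q_i : η[H] ≫ P.q ≫ P.i = η[H] := by
  refine P.comp_q_i ?_
  rw [Bimon.one_comul_assoc, ← tensorHom_id, tensorHom_comp_tensorHom, Category.comp_id,
    IsMonHom.one_hom, MonoidalCategory.tensorHom_def', ← leftUnitor_inv_naturality_assoc]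

theorem q_i_counit : P.q ≫ P.i ≫ ε[H] = ε[H] := by
  refine P.q_i_comp ?_
  rw [Bimon.mul_counit, ← tensorHom_id, tensorHom_comp_tensorHom_assoc, Category.id_comp,
    IsComonHom.hom_counit, MonoidalCategory.tensorHom_def, Category.assoc, leftUnitor_naturality]

theorem iA_q : P.iA ≫ P.q = ε[A] ≫ η[H] ≫ P.q := by
  calc _ = (ρ_ A).inv ≫ (A ◁ η[H] ≫ P.iA ▷ H) ≫ μ[H] ≫ P.q := by
        rw [whisker_exchange, Category.assoc, MonObj.mul_one_assoc]; monoidal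
    _ = 𝟙 _ ⊗≫ (A ◁ η[H] ≫ ε[A] ▷ H) ⊗≫ P.q := by
        rw [Category.assoc, P.iA_mul_q]; monoidal
    _ = _ := by rw [whisker_exchange]; monoidal

theorem i_pA : P.i ≫ P.pA = P.i ≫ ε[H] ≫ η[A] := by
  calc _ = P.i ≫ Δ[H] ≫ (P.pA ▷ H ≫ A ◁ ε[H]) ≫ (ρ_ A).hom := by
        rw [← whisker_exchange, Category.assoc, ComonObj.comul_counit_assoc]; monoidal
    _ = 𝟙 _ ⊗≫ P.i ⊗≫ (η[A] ▷ H ≫ A ◁ ε[H]) ⊗≫ 𝟙 _ := by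
        rw [Category.assoc, reassoc_of% P.i_comul_pA]; monoidal
    _ = _ := by rw [← whisker_exchange]; monoidal

/-- The unit of the coinvariants. -/
def oneB : 𝟙_ C ⟶ P.B := η[H] ≫ P.q

/-- The counit of the coinvariants. -/
def counitB : P.B ⟶ 𝟙_ C := P.i ≫ ε[H]

theorem one_act : (𝟙_ C ◁ ε[A] ≫ (λ_ (𝟙_ C)).hom) ≫ P.oneB = P.oneB ▷ A ≫ P.act := by
  symm
  calc _ = η[H] ▷ A ≫ H ◁ P.iA ≫ P.q ▷ H ≫ P.actH := by
        rw [oneB, act, whisker_exchange_assoc, comp_whiskerRight_assoc]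
    _ = 𝟙_ C ◁ P.iA ≫ η[H] ▷ H ≫ μ[H] ≫ P.q := by
        rw [← P.mul_q, whisker_exchange_assoc]
    _ = 𝟙_ C ◁ (P.iA ≫ P.q) ⊗≫ 𝟙 _ := by
        rw [MonObj.one_mul_assoc]; monoidal
    _ = _ := by rw [P.iA_q, oneB]; monoidal

theorem coact_counitB : P.coact ≫ P.counitB ▷ A =
    P.counitB ≫ (λ_ (𝟙_ C)).inv ≫ 𝟙_ C ◁ η[A] := by
  calc _ = (P.coactH ≫ P.i ▷ H) ≫ H ◁ P.pA ≫ ε[H] ▷ A := by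
        rw [counitB, coact, comp_whiskerRight, Category.assoc, Category.assoc,
          whisker_exchange_assoc]
    _ = P.i ≫ (Δ[H] ≫ ε[H] ▷ H) ≫ 𝟙_ C ◁ P.pA := by
        rw [← P.i_comul, whisker_exchange]; simp only [Category.assoc]
    _ = (P.i ≫ P.pA) ⊗≫ 𝟙 _ := by
        rw [ComonObj.counit_comul]; monoidal
    _ = _ := by rw [P.i_pA, counitB]; monoidal

theorem one_coact : ((λ_ (𝟙_ C)).inv ≫ 𝟙_ C ◁ η[A]) ≫ P.oneB ▷ A = P.oneB ≫ P.coact := by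
  rw [oneB, coact_eq, Category.assoc, Category.assoc, reassoc_of% P.one_q_i, Bimon.one_comul_assoc,
    tensorHom_comp_tensorHom, IsMonHom.one_hom P.pA, MonoidalCategory.tensorHom_def']

theorem act_counitB : P.act ≫ P.counitB = P.counitB ▷ A ≫ 𝟙_ C ◁ ε[A] ≫ (λ_ (𝟙_ C)).hom := by
  rw [counitB, act_eq, Category.assoc, Category.assoc, P.q_i_counit, Bimon.mul_counit,
    tensorHom_comp_tensorHom_assoc, IsComonHom.hom_counit P.iA, MonoidalCategory.tensorHom_def,
    Category.assoc]

theorem one_mulB : P.oneB ▷ P.B ≫ P.mulB = (λ_ P.B).hom := by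
  rw [oneB, mulB, ← whisker_exchange_assoc, comp_whiskerRight_assoc, ← mul_q,
    MonObj.one_mul_assoc, leftUnitor_naturality_assoc, P.i_q, Category.comp_id]

theorem mulB_one : P.B ◁ P.oneB ≫ P.mulB = (ρ_ P.B).hom := by
  rw [oneB, mulB, ← whiskerLeft_comp_assoc, Category.assoc, P.one_q_i, P.actH_one]

theorem comulB_counit : P.comulB ≫ P.B ◁ P.counitB = (ρ_ P.B).inv := by
  rw [counitB, comulB, Category.assoc, ← whiskerLeft_comp, P.q_i_counit, P.coactH_counit]

theorem counit_comulB : P.comulB ≫ P.counitB ▷ P.B = (λ_ P.B).inv := by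
  rw [counitB, comulB, Category.assoc, whisker_exchange, comp_whiskerRight_assoc,
    ← reassoc_of% P.i_comul, ComonObj.counit_comul_assoc, ← leftUnitor_inv_naturality,
    P.i_q_assoc]

/-- The right `H`-action is determined by the action of `A` and the multiplication of `B`. -/
theorem theta_actH : P.B ◁ P.theta ≫ P.actH =
    (α_ P.B A P.B).inv ≫ P.act ▷ P.B ≫ P.mulB := by
  calc _ = P.B ◁ (P.iA ⊗ₘ P.i) ≫ P.B ◁ μ[H] ≫ P.actH := by
        rw [theta, whiskerLeft_comp_assoc]
    _ = P.B ◁ (P.iA ⊗ₘ P.i) ≫ (α_ _ _ _).inv ≫ P.actH ▷ H ≫ P.actH := by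
        rw [P.actH_mul, Iso.inv_hom_id_assoc]
    _ = 𝟙 _ ⊗≫ P.B ◁ P.iA ▷ P.B ⊗≫ ((P.B ⊗ H) ◁ P.i ≫ P.actH ▷ H) ≫ P.actH := by
        rw [MonoidalCategory.tensorHom_def]; monoidal
    _ = _ := by rw [whisker_exchange, act, mulB]; monoidal

/-- The right `H`-coaction is determined by the coaction of `A` and the comultiplication of `B`. -/
theorem coactH_eq : P.coactH =
    P.comulB ≫ P.coact ▷ P.B ≫ (α_ P.B A P.B).hom ≫ P.B ◁ P.theta := by
  have h : P.coactH ≫ P.B ◁ P.thetaInv = P.comulB ≫ P.coact ▷ P.B ≫ (α_ P.B A P.B).hom := by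
    symm
    calc _ = P.coactH ≫ (P.B ◁ P.q ≫ P.coactH ▷ P.B) ≫ (P.B ◁ P.pA) ▷ P.B ≫ (α_ _ _ _).hom := by
          rw [comulB, coact]; simp
      _ = (P.coactH ≫ P.coactH ▷ H) ≫ (P.B ⊗ H) ◁ P.q ≫ (P.B ◁ P.pA) ▷ P.B ≫
          (α_ _ _ _).hom := by
          rw [whisker_exchange]; simp
      _ = _ := by
          rw [P.coactH_comul, thetaInv, MonoidalCategory.tensorHom_def']; monoidal
  rw [← reassoc_of% h, ← whiskerLeft_comp, P.thetaInv_theta, whiskerLeft_id, Category.comp_id]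

theorem mulB_act : tensorAct Δ[A] P.act P.act ≫ P.mulB = P.mulB ▷ A ≫ P.act := by
  symm
  calc _ = (P.B ◁ P.i) ▷ A ≫ (P.actH ▷ A ≫ P.B ◁ P.iA) ≫ P.actH := by simp [mulB, act]
    _ = (P.B ◁ P.i) ▷ A ≫ (P.B ⊗ H) ◁ P.iA ≫ P.actH ▷ H ≫ P.actH := by
        rw [← whisker_exchange]; simp
    _ = (α_ _ _ _).hom ≫ P.B ◁ ((P.i ⊗ₘ P.iA) ≫ μ[H]) ≫ P.actH := by
        rw [P.actH_mul, MonoidalCategory.tensorHom_def]; monoidal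
    _ = (α_ _ _ _).hom ≫ P.B ◁ crossedBraid P.act Δ[A] ≫ (α_ P.B A P.B).inv ≫
        P.act ▷ P.B ≫ P.mulB := by
        rw [P.i_mul_iA, whiskerLeft_comp_assoc, P.theta_actH]
    _ = 𝟙 _ ⊗≫ P.B ◁ P.B ◁ Δ[A] ⊗≫ P.B ◁ (β_ P.B A).hom ▷ A ⊗≫
        ((P.B ⊗ A) ◁ P.act ≫ P.act ▷ P.B) ≫ P.mulB := by
        rw [crossedBraid]; monoidal
    _ = _ := by
        rw [whisker_exchange]
        simp only [tensorAct, tensorμ, MonoidalCategory.tensorHom_def]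
        monoidal

theorem comulB_coact : P.comulB ≫ tensorCoact μ[A] P.coact P.coact = P.coact ≫ P.comulB ▷ A := by
  symm
  calc _ = P.coactH ≫ (P.B ◁ P.pA ≫ P.coactH ▷ A) ≫ (P.B ◁ P.q) ▷ A := by simp [comulB, coact]
    _ = (P.coactH ≫ P.coactH ▷ H) ≫ (P.B ⊗ H) ◁ P.pA ≫ (P.B ◁ P.q) ▷ A := by
        rw [whisker_exchange]; simp
    _ = P.coactH ≫ P.B ◁ (Δ[H] ≫ (P.q ⊗ₘ P.pA)) ≫ (α_ _ _ _).inv := by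
        rw [P.coactH_comul, MonoidalCategory.tensorHom_def']; monoidal
    _ = P.comulB ≫ P.coact ▷ P.B ≫ (α_ P.B A P.B).hom ≫ P.B ◁ (P.theta ≫ P.thetaInv) ≫
        P.B ◁ crossedBraid μ[A] P.coact ≫ (α_ _ _ _).inv := by
        rw [P.comul_q_pA, coactH_eq]; simp
    _ = 𝟙 _ ⊗≫ P.comulB ⊗≫ (P.coact ▷ P.B ≫ (P.B ⊗ A) ◁ P.coact) ⊗≫
        P.B ◁ (β_ A P.B).hom ▷ A ⊗≫ P.B ◁ P.B ◁ μ[A] ⊗≫ 𝟙 _ := by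
        rw [P.theta_thetaInv, crossedBraid]; monoidal
    _ = _ := by
        simp only [tensorCoact, tensorμ, MonoidalCategory.tensorHom_def]
        monoidal

theorem mulB_coact : tensorCoact μ[A] P.coact P.coact ≫ P.mulB ▷ A = P.mulB ≫ P.coact := by
  have h := mul_comul_factor_both (BimonObj.mul_comul H) P.i_comul' P.i_comul' (p := P.q)
    (q := P.pA) (a₁ := 𝟙 P.B) (a₂ := P.pA) (b₁ := 𝟙 P.B) (b₂ := P.pA) (F' := P.coact)
    (G' := P.coact) (U := P.mulB) (V := μ[A]) (by rw [id_tensorHom, coact])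
    (by rw [id_tensorHom, coact]) (by rw [P.mulB_eq]; simp)
    (by rw [IsMonHom.mul_hom]; simp)
  rw [P.coact_eq, reassoc_of% P.mulB_i, h, ← P.coact_eq, tensorCoact,
    MonoidalCategory.tensorHom_def' P.mulB]
  simp only [Category.assoc]

theorem act_comulB : P.act ≫ P.comulB = P.comulB ▷ A ≫ tensorAct Δ[A] P.act P.act := by
  have h := mul_comul_factor_both (BimonObj.mul_comul H) P.i_comul' (IsComonHom.hom_comul P.iA)
    (p := P.q) (q := P.q) (a₁ := 𝟙 P.B) (a₂ := P.q) (b₁ := 𝟙 A) (b₂ := 𝟙 A) (F' := P.comulB)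
    (G' := Δ[A]) (U := P.act) (V := P.act) (by rw [id_tensorHom, comulB])
    (by simp) (by rw [P.act_eq]; simp)
    (by rw [P.mul_q, act, tensorHom_id, id_tensorHom, whisker_exchange_assoc])
  rw [P.act_eq, Category.assoc, Category.assoc, P.q_comulB, h, tensorAct,
    MonoidalCategory.tensorHom_def P.comulB, ← P.act_eq]
  simp only [Category.assoc]

/-- The bialgebra axiom for `B`. In that of `H`, the right leg of the second comultiplication lies
in `H`; writing it as `A ⊗ B` turns the ambient braiding into the braiding of crossed modules. -/
theorem mulB_comulB : P.mulB ≫ P.comulB = (P.comulB ⊗ₘ P.comulB) ≫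
    ((α_ P.B P.B (P.B ⊗ P.B)).hom ≫ P.B ◁ (α_ P.B P.B P.B).inv ≫
      P.B ◁ crossedBraid P.act P.coact ▷ P.B ≫ P.B ◁ (α_ P.B P.B P.B).hom ≫
      (α_ P.B P.B (P.B ⊗ P.B)).inv) ≫ (P.mulB ⊗ₘ P.mulB) := by
  have h := mul_comul_factor_both (BimonObj.mul_comul H) P.i_comul' P.i_comul'
    (p := P.q) (q := P.q) (a₁ := 𝟙 P.B) (a₂ := P.q) (b₁ := 𝟙 P.B) (b₂ := 𝟙 H) (F' := P.comulB)
    (G' := P.coactH) (U := P.mulB) (V := P.actH) (by rw [id_tensorHom, comulB])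
    (by simp) (by rw [P.mulB_eq]; simp) (by rw [P.mul_q]; simp)
  rw [P.comulB_eq, reassoc_of% P.mulB_i, h, ← P.comulB_eq, coactH_eq]
  simp only [tensorμ, crossedBraid, MonoidalCategory.tensorHom_def]
  calc _ = 𝟙 _ ⊗≫ P.comulB ▷ P.B ⊗≫ (P.B ⊗ P.B) ◁ (P.comulB ≫ P.coact ▷ P.B) ⊗≫
        P.B ◁ ((P.B ⊗ P.B) ◁ P.theta ≫ (β_ P.B P.B).hom ▷ H) ⊗≫ P.mulB ▷ (P.B ⊗ H) ≫
        P.B ◁ P.actH := by monoidal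
    _ = 𝟙 _ ⊗≫ P.comulB ▷ P.B ⊗≫ (P.B ⊗ P.B) ◁ (P.comulB ≫ P.coact ▷ P.B) ⊗≫
        P.B ◁ (β_ P.B P.B).hom ▷ A ▷ P.B ⊗≫ ((P.B ⊗ P.B) ◁ (P.B ◁ P.theta) ≫
        P.mulB ▷ (P.B ⊗ H)) ≫ P.B ◁ P.actH := by
        rw [whisker_exchange]; monoidal
    _ = 𝟙 _ ⊗≫ P.comulB ▷ P.B ⊗≫ (P.B ⊗ P.B) ◁ (P.comulB ≫ P.coact ▷ P.B) ⊗≫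
        P.B ◁ (β_ P.B P.B).hom ▷ A ▷ P.B ⊗≫ P.mulB ▷ (P.B ⊗ A ⊗ P.B) ≫
        P.B ◁ (P.B ◁ P.theta ≫ P.actH) := by
        rw [whisker_exchange]; monoidal
    _ = 𝟙 _ ⊗≫ P.comulB ▷ P.B ⊗≫ (P.B ⊗ P.B) ◁ (P.comulB ≫ P.coact ▷ P.B) ⊗≫
        P.B ◁ (β_ P.B P.B).hom ▷ A ▷ P.B ⊗≫ (P.mulB ▷ ((P.B ⊗ A) ⊗ P.B) ≫
        P.B ◁ (P.act ▷ P.B)) ≫ P.B ◁ P.mulB := by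
        rw [theta_actH]; monoidal
    _ = _ := by rw [← whisker_exchange]; monoidal

theorem one_comulB : P.oneB ≫ P.comulB = (λ_ (𝟙_ C)).inv ≫ (P.oneB ⊗ₘ P.oneB) := by
  rw [oneB, Category.assoc, P.q_comulB, Bimon.one_comul_assoc, tensorHom_comp_tensorHom]

theorem mulB_counitB : P.mulB ≫ P.counitB = (P.counitB ⊗ₘ P.counitB) ≫ (λ_ (𝟙_ C)).hom := by
  rw [counitB, reassoc_of% P.mulB_i, Bimon.mul_counit, tensorHom_comp_tensorHom_assoc]

theorem one_counitB : P.oneB ≫ P.counitB = 𝟙 (𝟙_ C) := by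
  rw [oneB, counitB, Category.assoc, P.q_i_counit, BimonObj.one_counit]

/-- The antipode of the coinvariants. -/
def antipodeB : P.B ⟶ P.B := P.i ≫ P.T ≫ P.q

theorem antipodeB_i : P.antipodeB ≫ P.i = P.i ≫ P.T := by
  simp only [antipodeB, Category.assoc, P.T_q_i]

theorem q_antipodeB : P.q ≫ P.antipodeB = P.T ≫ P.q := by
  rw [antipodeB, reassoc_of% P.q_i_T]

theorem act_antipodeB : P.act ≫ P.antipodeB = P.antipodeB ▷ A ≫ P.act := by
  rw [act, Category.assoc, actH, Category.assoc, Category.assoc, P.q_antipodeB,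
    whisker_exchange_assoc, P.iA_mul_T_q, whisker_exchange_assoc, ← comp_whiskerRight_assoc,
    ← comp_whiskerRight_assoc, P.antipodeB_i]

theorem coact_antipodeB : P.coact ≫ P.antipodeB ▷ A = P.antipodeB ≫ P.coact := by
  rw [coact, coactH]
  simp only [Category.assoc]
  rw [reassoc_of% P.antipodeB_i, ← whisker_exchange, ← whisker_exchange_assoc,
    ← comp_whiskerRight, P.q_antipodeB, reassoc_of% P.i_T_comul_pA, comp_whiskerRight]

theorem conv_T_q_i : Δ[H] ≫ (P.T ⊗ₘ P.q ≫ P.i) ≫ μ[H] = ε[H] ≫ η[H] := by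
  rw [T, conv_assoc, P.comul_mul_eq, tensorHom_id, HopfObj.antipode_left]

theorem conv_id_T : Δ[H] ≫ (𝟙 H ⊗ₘ P.T) ≫ μ[H] = P.pA ≫ P.iA := by
  rw [T, ← conv_assoc, id_tensorHom, HopfObj.antipode_right]
  calc _ = (Δ[H] ≫ ε[H] ▷ H) ≫ 𝟙_ C ◁ (P.pA ≫ P.iA) ≫ η[H] ▷ H ≫ μ[H] := by
        rw [← tensorHom_id, ← tensorHom_id, ← id_tensorHom]
        simp only [Category.assoc, tensorHom_comp_tensorHom_assoc, Category.id_comp,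
          Category.comp_id]
    _ = _ := by rw [MonObj.one_mul, ComonObj.counit_comul]; simp

theorem antipodeB_left : P.comulB ≫ P.antipodeB ▷ P.B ≫ P.mulB = P.counitB ≫ P.oneB := by
  rw [mulB_eq, comulB_eq, ← tensorHom_id]
  simp only [Category.assoc, tensorHom_comp_tensorHom_assoc, P.antipodeB_i, P.q_i_T,
    Category.id_comp]
  rw [reassoc_of% P.conv_T_q_i, counitB, oneB, Category.assoc]

theorem antipodeB_right : P.comulB ≫ P.B ◁ P.antipodeB ≫ P.mulB = P.counitB ≫ P.oneB := by
  have h : (P.q ≫ P.i ⊗ₘ P.T) = (P.q ≫ P.i) ▷ H ≫ (𝟙 H ⊗ₘ P.T) := by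
    rw [← tensorHom_id, tensorHom_comp_tensorHom, Category.comp_id, Category.id_comp]
  rw [mulB_eq, comulB_eq, ← id_tensorHom]
  simp only [Category.assoc, tensorHom_comp_tensorHom_assoc, P.antipodeB_i, P.q_i_T,
    Category.id_comp]
  rw [h, Category.assoc, reassoc_of% P.comul_q_i, reassoc_of% P.conv_id_T, P.iA_q,
    IsComonHom.hom_counit_assoc P.pA, counitB, oneB, Category.assoc]

end SplitHopfProjection

/-! ### The cross product and the comparison isomorphism -/

theorem mul_assoc_tensor {C : Type u} [Category.{v} C] [MonoidalCategory C] {X Y Z M : C}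
    [MonObj M] (f : X ⟶ M) (g : Y ⟶ M) (h : Z ⟶ M) :
    ((f ⊗ₘ g) ≫ μ[M] ⊗ₘ h) ≫ μ[M] = (α_ X Y Z).hom ≫ (f ⊗ₘ (g ⊗ₘ h) ≫ μ[M]) ≫ μ[M] := by
  have hm := MonObj.mul_assoc M
  rw [← tensorHom_id] at hm
  rw [← Category.comp_id h, ← tensorHom_comp_tensorHom, Category.comp_id, Category.assoc, hm,
    associator_naturality_assoc, ← id_tensorHom, tensorHom_comp_tensorHom_assoc, Category.comp_id]

theorem comul_assoc_tensor {C : Type u} [Category.{v} C] [MonoidalCategory C] {X Y Z M : C}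
    [ComonObj M] (f : M ⟶ X) (g : M ⟶ Y) (h : M ⟶ Z) :
    Δ[M] ≫ (Δ[M] ≫ (f ⊗ₘ g) ⊗ₘ h) = Δ[M] ≫ (f ⊗ₘ Δ[M] ≫ (g ⊗ₘ h)) ≫ (α_ X Y Z).inv := by
  have hm : Δ[M] ≫ Δ[M] ▷ M = Δ[M] ≫ M ◁ Δ[M] ≫ (α_ M M M).inv := by simp
  rw [← tensorHom_id] at hm
  rw [← Category.id_comp h, ← tensorHom_comp_tensorHom, Category.id_comp, reassoc_of% hm,
    ← associator_inv_naturality, ← id_tensorHom, tensorHom_comp_tensorHom_assoc,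
    Category.id_comp]

/-- The crossed braiding is invertible for any module and comodule, crossed or not, when the
antipode is. It applies to `A` as a module by multiplication and as a comodule by comultiplication.
-/
theorem isIso_crossedBraid {C : Type u} [Category.{v} C] [MonoidalCategory C] [BraidedCategory C]
    {A X Y : C} [HopfObj A] [IsIso 𝒮[A]] {a : X ⊗ A ⟶ X} {c : Y ⟶ Y ⊗ A}
    (ha₁ : X ◁ η[A] ≫ a = (ρ_ X).hom) (ha : a ▷ A ≫ a = (α_ X A A).hom ≫ X ◁ μ[A] ≫ a)
    (hc₁ : c ≫ Y ◁ ε[A] = (ρ_ Y).inv) (hc : c ≫ c ▷ A = c ≫ Y ◁ Δ[A] ≫ (α_ Y A A).inv) :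
    IsIso (crossedBraid a c) := by
  have h₁ := braidAux_comp μ[A] Δ[A] (𝟙 A) (inv 𝒮[A]) a c ha hc
  rw [antipode_inv_conv_right, braidAux_unit _ _ _ _ ha₁ hc₁] at h₁
  have h₂ := braidAux_comp μ[A] Δ[A] (inv 𝒮[A]) (𝟙 A) a c ha hc
  rw [antipode_inv_conv_left, braidAux_unit _ _ _ _ ha₁ hc₁] at h₂
  have : IsIso (braidAux (𝟙 A) a c) := ⟨_, h₁, h₂⟩
  rw [crossedBraid_eq]
  infer_instance

/-- If `g : A ⟶ A` and `f ⊗ g` are invertible and the unit object is a retract of `A`, then `f` is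
invertible: `f` is a retract of its whiskering by `A`. -/
theorem isIso_of_isIso_tensorHom {C : Type u} [Category.{v} C] [MonoidalCategory C]
    {X Y A : C} (f : X ⟶ Y) (g : A ⟶ A) [IsIso g] [IsIso (f ⊗ₘ g)] {o : 𝟙_ C ⟶ A} {e : A ⟶ 𝟙_ C}
    (h : o ≫ e = 𝟙 _) : IsIso f := by
  have hf : IsIso (f ▷ A) := by
    have : f ▷ A = (f ⊗ₘ g) ≫ Y ◁ inv g := by
      rw [MonoidalCategory.tensorHom_def, Category.assoc, ← whiskerLeft_comp, IsIso.hom_inv_id,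
        whiskerLeft_id, Category.comp_id]
    rw [this]
    infer_instance
  refine ⟨(ρ_ Y).inv ≫ Y ◁ o ≫ inv (f ▷ A) ≫ X ◁ e ≫ (ρ_ X).hom, ?_, ?_⟩
  · rw [rightUnitor_inv_naturality_assoc, ← whisker_exchange_assoc, IsIso.hom_inv_id_assoc,
      ← whiskerLeft_comp_assoc, h]
    simp
  · simp only [Category.assoc]
    rw [← rightUnitor_naturality, whisker_exchange_assoc, IsIso.inv_hom_id_assoc,
      ← whiskerLeft_comp_assoc, h]
    simp

/-- Transport of a Hopf algebra structure along an isomorphism. -/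
@[reducible]
def hopfObjOfIso {C : Type u} [Category.{v} C] [MonoidalCategory C] [BraidedCategory C]
    {X Y : C} [HopfObj X] (e : X ≅ Y) : HopfObj Y where
  one := η[X] ≫ e.hom
  mul := (e.inv ⊗ₘ e.inv) ≫ μ[X] ≫ e.hom
  one_mul := (MonObj.ofIso e).one_mul
  mul_one := (MonObj.ofIso e).mul_one
  mul_assoc := (MonObj.ofIso e).mul_assoc
  counit := e.inv ≫ ε[X]
  comul := e.inv ≫ Δ[X] ≫ (e.hom ⊗ₘ e.hom)
  counit_comul := by
    rw [← tensorHom_id, Category.assoc, Category.assoc, tensorHom_comp_tensorHom,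
      Iso.hom_inv_id_assoc, Category.comp_id, MonoidalCategory.tensorHom_def,
      ComonObj.counit_comul_assoc, ← leftUnitor_inv_naturality, Iso.inv_hom_id_assoc]
  comul_counit := by
    rw [← id_tensorHom, Category.assoc, Category.assoc, tensorHom_comp_tensorHom,
      Iso.hom_inv_id_assoc, Category.comp_id, MonoidalCategory.tensorHom_def',
      ComonObj.comul_counit_assoc, ← rightUnitor_inv_naturality, Iso.inv_hom_id_assoc]
  comul_assoc := by
    have h : Δ[X] ≫ (e.hom ⊗ₘ Δ[X] ≫ (e.hom ⊗ₘ e.hom)) =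
        Δ[X] ≫ (Δ[X] ≫ (e.hom ⊗ₘ e.hom) ⊗ₘ e.hom) ≫ (α_ Y Y Y).hom := by
      have h' := congrArg (· ≫ (α_ Y Y Y).hom) (comul_assoc_tensor e.hom e.hom e.hom)
      simp only [Category.assoc, Iso.inv_hom_id, Category.comp_id] at h'
      exact h'.symm
    simp only [← id_tensorHom, ← tensorHom_id, Category.assoc, tensorHom_comp_tensorHom,
      tensorHom_comp_tensorHom_assoc, Iso.hom_inv_id_assoc, Category.comp_id, h]
  mul_comul := by
    simp only [Category.assoc, Iso.hom_inv_id_assoc, BimonObj.mul_comul_assoc,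
      tensorHom_comp_tensorHom_assoc, tensorHom_comp_tensorHom]
    simp only [← tensorHom_comp_tensorHom, Category.assoc, tensorμ_natural_assoc]
    simp
  one_comul := by
    simp [MonObj.tensorObj.one_def]
    rfl
  mul_counit := by simp
  one_counit := by simp
  antipode := e.inv ≫ 𝒮[X] ≫ e.hom
  antipode_left := by
    simp only [← tensorHom_id, Category.assoc,
      tensorHom_comp_tensorHom_assoc, Iso.hom_inv_id_assoc, Iso.hom_inv_id, Category.comp_id]
    simp
  antipode_right := by
    simp only [← id_tensorHom, Category.assoc,
      tensorHom_comp_tensorHom_assoc, Iso.hom_inv_id_assoc, Iso.hom_inv_id, Category.comp_id]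
    simp

theorem isBimonHom_hopfObjOfIso {C : Type u} [Category.{v} C] [MonoidalCategory C]
    [BraidedCategory C] {X Y : C} [HopfObj X] (e : X ≅ Y) :
    letI := hopfObjOfIso e
    IsBimonHom e.inv :=
  letI := hopfObjOfIso e
  { one_hom := show (η[X] ≫ e.hom) ≫ e.inv = η[X] by simp
    mul_hom := show ((e.inv ⊗ₘ e.inv) ≫ μ[X] ≫ e.hom) ≫ e.inv = (e.inv ⊗ₘ e.inv) ≫ μ[X] by simp
    hom_counit := rfl
    hom_comul := show e.inv ≫ Δ[X] = (e.inv ≫ Δ[X] ≫ (e.hom ⊗ₘ e.hom)) ≫ (e.inv ⊗ₘ e.inv) by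
      simp }

namespace SplitHopfProjection
variable {C : Type u} [Category.{v} C] [MonoidalCategory C] [BraidedCategory C]
  {A H : C} [HopfObj A] [HopfObj H] (P : SplitHopfProjection A H)

/-- The antipode of `H` on a coinvariant element `x` is `S_B(x₀) S_A(x₁)`, with the coaction of `A`.
-/
theorem coact_antipodeB_antipode :
    P.coact ≫ (P.antipodeB ≫ P.i ⊗ₘ 𝒮[A] ≫ P.iA) ≫ μ[H] = P.i ≫ 𝒮[H] := by
  have h : Δ[H] ≫ (P.pA ≫ P.iA ⊗ₘ P.pA ≫ 𝒮[A] ≫ P.iA) ≫ μ[H] = ε[H] ≫ η[H] := by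
    rw [← tensorHom_comp_tensorHom, Category.assoc, ← IsComonHom.hom_comul_assoc,
      P.conv_iA_antipode, IsComonHom.hom_counit_assoc]
  have hu : Δ[H] ≫ (𝒮[H] ⊗ₘ ε[H] ≫ η[H]) ≫ μ[H] = 𝒮[H] := by
    calc _ = (Δ[H] ≫ H ◁ ε[H]) ≫ 𝒮[H] ▷ 𝟙_ C ≫ H ◁ η[H] ≫ μ[H] := by
          rw [← tensorHom_id, ← id_tensorHom, ← id_tensorHom]
          simp only [Category.assoc, tensorHom_comp_tensorHom_assoc, Category.id_comp,
            Category.comp_id]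
      _ = _ := by rw [MonObj.mul_one, ComonObj.comul_counit]; simp
  rw [P.coact_eq, P.antipodeB_i]
  simp only [Category.assoc, tensorHom_comp_tensorHom_assoc, P.q_i_T]
  rw [T, conv_assoc, h, hu]

/-- The antipode of `H` on a product `a x` is `S(x) S(a)` up to the braiding; by
`coact_antipodeB_antipode` this is `S_B(x₀) S_A(x₁) S_A(a)`, and the last two factors combine to
`S_A(a x₁)`. -/
theorem theta_antipode : P.theta ≫ 𝒮[H] =
    crossedBraid μ[A] P.coact ≫ (P.antipodeB ⊗ₘ 𝒮[A]) ≫ (P.i ⊗ₘ P.iA) ≫ μ[H] := by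
  have h₁ : P.theta ≫ 𝒮[H] = (β_ A P.B).hom ≫ (P.i ≫ 𝒮[H] ⊗ₘ 𝒮[A] ≫ P.iA) ≫ μ[H] := by
    rw [theta, Category.assoc, HopfObj.mul_antipode, tensorHom_comp_tensorHom_assoc, P.iA_antipode,
      braiding_naturality_assoc]
  have h₂ : μ[A] ≫ 𝒮[A] ≫ P.iA =
      (β_ A A).hom ≫ (𝒮[A] ≫ P.iA ⊗ₘ 𝒮[A] ≫ P.iA) ≫ μ[H] := by
    rw [reassoc_of% HopfObj.mul_antipode A, IsMonHom.mul_hom, braiding_naturality_assoc,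
      tensorHom_comp_tensorHom_assoc]
  rw [h₁, ← P.coact_antipodeB_antipode, tensorHom_comp_tensorHom_assoc]
  generalize P.antipodeB ≫ P.i = s at *
  generalize hr : 𝒮[A] ≫ P.iA = r at *
  have hm := MonObj.mul_assoc H
  calc _ = (β_ A P.B).hom ≫ P.coact ▷ A ≫ ((s ⊗ₘ r) ⊗ₘ r) ≫ μ[H] ▷ H ≫ μ[H] := by
        simp only [← tensorHom_id, tensorHom_comp_tensorHom_assoc,
          Category.id_comp, Category.comp_id]
    _ = (β_ A P.B).hom ≫ P.coact ▷ A ⊗≫ s ▷ A ▷ A ⊗≫ H ◁ r ▷ A ⊗≫ H ◁ H ◁ r ⊗≫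
        (μ[H] ▷ H ≫ μ[H]) := by
        simp only [MonoidalCategory.tensorHom_def]; monoidal
    _ = ((β_ A P.B).hom ≫ P.coact ▷ A ⊗≫ 𝟙 (P.B ⊗ A ⊗ A)) ⊗≫ s ▷ A ▷ A ⊗≫
        H ◁ (r ▷ A ⊗≫ H ◁ r ⊗≫ μ[H]) ⊗≫ μ[H] := by
        rw [hm]; monoidal
    _ = 𝟙 _ ⊗≫ A ◁ P.coact ⊗≫ (β_ A P.B).hom ▷ A ⊗≫ (P.B ◁ (β_ A A).hom ≫ s ▷ (A ⊗ A)) ⊗≫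
        H ◁ (r ▷ A ⊗≫ H ◁ r ⊗≫ μ[H]) ⊗≫ μ[H] := by
        rw [← pull_r]; monoidal
    _ = 𝟙 _ ⊗≫ A ◁ P.coact ⊗≫ (β_ A P.B).hom ▷ A ⊗≫ s ▷ A ▷ A ⊗≫
        H ◁ ((β_ A A).hom ≫ (r ⊗ₘ r) ≫ μ[H]) ⊗≫ μ[H] := by
        rw [whisker_exchange, MonoidalCategory.tensorHom_def]; monoidal
    _ = 𝟙 _ ⊗≫ A ◁ P.coact ⊗≫ (β_ A P.B).hom ▷ A ⊗≫ (s ▷ (A ⊗ A) ≫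
        H ◁ μ[A]) ⊗≫ H ◁ r ⊗≫ μ[H] := by
        rw [← h₂]; monoidal
    _ = _ := by
        rw [← whisker_exchange, crossedBraid, MonoidalCategory.tensorHom_def]; monoidal

/-- The comparison isomorphism between the cross product and `H`. -/
@[simps]
def thetaIso : A ⊗ P.B ≅ H where
  hom := P.theta
  inv := P.thetaInv
  hom_inv_id := P.theta_thetaInv
  inv_hom_id := P.thetaInv_theta

theorem theta_antipode_thetaInv : P.theta ≫ 𝒮[H] ≫ P.thetaInv =
    crossedBraid μ[A] P.coact ≫ (P.antipodeB ⊗ₘ 𝒮[A]) ≫ crossedBraid P.act Δ[A] := by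
  rw [← P.mul_thetaInv, reassoc_of% P.theta_antipode]

theorem theta_one : η[H] ≫ P.thetaInv = (λ_ (𝟙_ C)).inv ≫ (η[A] ⊗ₘ P.oneB) := by
  rw [thetaInv, Bimon.one_comul_assoc, tensorHom_comp_tensorHom, IsMonHom.one_hom, oneB]

theorem theta_counit : P.theta ≫ ε[H] = (ε[A] ⊗ₘ P.counitB) ≫ (λ_ (𝟙_ C)).hom := by
  rw [theta, Category.assoc, Bimon.mul_counit, tensorHom_comp_tensorHom_assoc,
    IsComonHom.hom_counit, counitB]

/-- The multiplication of `H`, transported along `theta`, is that of the cross product. -/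
theorem theta_mul : (P.theta ⊗ₘ P.theta) ≫ μ[H] =
    (α_ A P.B (A ⊗ P.B)).hom ≫ A ◁ ((α_ P.B A P.B).inv ≫ crossedBraid P.act Δ[A] ▷ P.B ≫
      (α_ A P.B P.B).hom) ≫ (α_ A A (P.B ⊗ P.B)).inv ≫ (μ[A] ⊗ₘ P.mulB) ≫ P.theta := by
  have h₁ : (P.i ⊗ₘ P.theta) ≫ μ[H] = (α_ P.B A P.B).inv ≫ crossedBraid P.act Δ[A] ▷ P.B ≫
      (α_ A P.B P.B).hom ≫ (P.iA ⊗ₘ P.mulB ≫ P.i) ≫ μ[H] := by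
    rw [P.mulB_i, ← mul_assoc_tensor, ← theta, ← tensorHom_id, tensorHom_comp_tensorHom_assoc,
      ← P.i_mul_iA, Category.id_comp, mul_assoc_tensor, Iso.inv_hom_id_assoc, ← theta]
  have h₂ : (μ[A] ⊗ₘ P.mulB) ≫ P.theta = (α_ A A (P.B ⊗ P.B)).hom ≫
      (P.iA ⊗ₘ (P.iA ⊗ₘ P.mulB ≫ P.i) ≫ μ[H]) ≫ μ[H] := by
    rw [← mul_assoc_tensor, ← IsMonHom.mul_hom, theta, tensorHom_comp_tensorHom_assoc]
  rw [h₂, Iso.inv_hom_id_assoc, ← id_tensorHom, tensorHom_comp_tensorHom_assoc, Category.id_comp]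
  simp only [Category.assoc]
  rw [← h₁, ← mul_assoc_tensor, ← theta]

/-- The comultiplication of `H`, transported along `theta`, is that of the cross product. -/
theorem thetaInv_comul : Δ[H] ≫ (P.thetaInv ⊗ₘ P.thetaInv) =
    P.thetaInv ≫ (Δ[A] ⊗ₘ P.comulB) ≫ (α_ A A (P.B ⊗ P.B)).hom ≫
    A ◁ ((α_ A P.B P.B).inv ≫ crossedBraid μ[A] P.coact ▷ P.B ≫ (α_ P.B A P.B).hom) ≫
    (α_ A P.B (A ⊗ P.B)).inv := by
  have h₁ : Δ[H] ≫ (P.q ⊗ₘ P.thetaInv) = Δ[H] ≫ (P.pA ⊗ₘ P.q ≫ P.comulB) ≫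
      (α_ A P.B P.B).inv ≫ crossedBraid μ[A] P.coact ▷ P.B ≫ (α_ P.B A P.B).hom := by
    have := comul_assoc_tensor P.pA P.q P.q
    rw [P.q_comulB, ← reassoc_of% this, ← thetaInv, ← tensorHom_id,
      tensorHom_comp_tensorHom_assoc, ← P.comul_q_pA, Category.comp_id,
      reassoc_of% comul_assoc_tensor, Iso.inv_hom_id, Category.comp_id, ← thetaInv]
  have h₂ : P.thetaInv ≫ (Δ[A] ⊗ₘ P.comulB) =
      Δ[H] ≫ (P.pA ⊗ₘ Δ[H] ≫ (P.pA ⊗ₘ P.q ≫ P.comulB)) ≫ (α_ A A (P.B ⊗ P.B)).inv := by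
    rw [← comul_assoc_tensor, ← IsComonHom.hom_comul, thetaInv, Category.assoc,
      tensorHom_comp_tensorHom]
  rw [reassoc_of% h₂, Iso.inv_hom_id_assoc, ← id_tensorHom, tensorHom_comp_tensorHom_assoc,
    Category.comp_id]
  simp only [Category.assoc]
  rw [← h₁, ← comul_assoc_tensor, ← thetaInv]

/-- In `theta_antipode_thetaInv` every map but the antipode of the coinvariants is known to be
invertible. -/
theorem isIso_antipodeB [IsIso 𝒮[A]] [IsIso 𝒮[H]] : IsIso P.antipodeB := by
  have h₁ : IsIso (crossedBraid P.act Δ[A]) := isIso_crossedBraid P.act_one P.act_mul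
    (ComonObj.comul_counit A) (comul_assoc' A)
  have h₂ : IsIso (crossedBraid μ[A] P.coact) := isIso_crossedBraid (MonObj.mul_one A)
    (MonObj.mul_assoc A) P.coact_counit P.coact_comul
  have h₃ : IsIso (P.theta ≫ 𝒮[H] ≫ P.thetaInv) := by
    have : IsIso P.theta := inferInstanceAs (IsIso P.thetaIso.hom)
    have : IsIso P.thetaInv := inferInstanceAs (IsIso P.thetaIso.inv)
    infer_instance
  rw [P.theta_antipode_thetaInv] at h₃
  have h₄ : IsIso ((P.antipodeB ⊗ₘ 𝒮[A]) ≫ crossedBraid P.act Δ[A]) :=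
    IsIso.of_isIso_comp_left (crossedBraid μ[A] P.coact) _
  have h₅ : IsIso (P.antipodeB ⊗ₘ 𝒮[A]) :=
    IsIso.of_isIso_comp_right _ (crossedBraid P.act Δ[A])
  exact isIso_of_isIso_tensorHom P.antipodeB 𝒮[A] (BimonObj.one_counit A)

/-- The coinvariants as a Hopf algebra in the category of crossed modules. -/
noncomputable instance hopfObj [IsIso 𝒮[A]] : HopfObj P.crossedModule where
  one := ⟨P.oneB, P.one_act, P.one_coact⟩
  mul := ⟨P.mulB, P.mulB_act, P.mulB_coact⟩
  one_mul := CrossedModule.hom_ext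
    (show (P.oneB ⊗ₘ 𝟙 P.B) ≫ P.mulB = (λ_ P.B).hom by rw [tensorHom_id, one_mulB])
  mul_one := CrossedModule.hom_ext
    (show (𝟙 P.B ⊗ₘ P.oneB) ≫ P.mulB = (ρ_ P.B).hom by rw [id_tensorHom, mulB_one])
  mul_assoc := CrossedModule.hom_ext
    (show (P.mulB ⊗ₘ 𝟙 P.B) ≫ P.mulB = (α_ P.B P.B P.B).hom ≫ (𝟙 P.B ⊗ₘ P.mulB) ≫ P.mulB by
      rw [tensorHom_id, id_tensorHom, mulB_assoc])
  counit := ⟨P.counitB, P.act_counitB, P.coact_counitB⟩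
  comul := ⟨P.comulB, P.act_comulB, P.comulB_coact.symm⟩
  counit_comul := CrossedModule.hom_ext
    (show P.comulB ≫ (P.counitB ⊗ₘ 𝟙 P.B) = (λ_ P.B).inv by rw [tensorHom_id, counit_comulB])
  comul_counit := CrossedModule.hom_ext
    (show P.comulB ≫ (𝟙 P.B ⊗ₘ P.counitB) = (ρ_ P.B).inv by rw [id_tensorHom, comulB_counit])
  comul_assoc := CrossedModule.hom_ext
    (show P.comulB ≫ (𝟙 P.B ⊗ₘ P.comulB) =
        P.comulB ≫ (P.comulB ⊗ₘ 𝟙 P.B) ≫ (α_ P.B P.B P.B).hom by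
      rw [tensorHom_id, id_tensorHom, comulB_assoc])
  mul_comul := CrossedModule.hom_ext (P.mulB_comulB.trans (by
    rw [← id_tensorHom, ← id_tensorHom, ← id_tensorHom, ← tensorHom_id]; rfl))
  one_comul := CrossedModule.hom_ext P.one_comulB
  mul_counit := CrossedModule.hom_ext P.mulB_counitB
  one_counit := CrossedModule.hom_ext P.one_counitB
  antipode := ⟨P.antipodeB, P.act_antipodeB, P.coact_antipodeB⟩
  antipode_left := CrossedModule.hom_ext
    (show P.comulB ≫ (P.antipodeB ⊗ₘ 𝟙 P.B) ≫ P.mulB = P.counitB ≫ P.oneB by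
      rw [tensorHom_id, antipodeB_left])
  antipode_right := CrossedModule.hom_ext
    (show P.comulB ≫ (𝟙 P.B ⊗ₘ P.antipodeB) ≫ P.mulB = P.counitB ≫ P.oneB by
      rw [id_tensorHom, antipodeB_right])

theorem isIso_antipode [IsIso 𝒮[A]] [IsIso 𝒮[H]] : IsIso 𝒮[P.crossedModule] := by
  have := P.isIso_antipodeB
  let e : P.B ≅ P.B := asIso P.antipodeB
  exact (CrossedModule.mkIso (M := P.crossedModule) (N := P.crossedModule) e
    P.act_antipodeB P.coact_antipodeB).isIso_hom

/-- The Hopf algebra structure of `H`, transported along `theta`, is the cross product structure. -/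
theorem isCrossProduct [IsIso 𝒮[A]] :
    CrossedModule.IsCrossProduct P.crossedModule (hopfObjOfIso P.thetaIso.symm) where
  one_eq := P.theta_one
  mul_eq := by
    have h := congrArg (· ≫ P.thetaInv) P.theta_mul
    simp only [Category.assoc, P.theta_thetaInv, Category.comp_id] at h
    exact h
  counit_eq := P.theta_counit
  comul_eq := by
    refine (congrArg (P.theta ≫ ·) P.thetaInv_comul).trans ?_
    simp only [reassoc_of% P.theta_thetaInv]
    rfl
  antipode_eq := P.theta_antipode_thetaInv

end SplitHopfProjection
end BraidedCross

theorem mainTheorem3 {C : Type u} [Category.{v} C] [MonoidalCategory C] [BraidedCategory C]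
    [IsIdempotentComplete C] (A H : C) [HopfObj A] [HopfObj H] [IsIso 𝒮[A]] [IsIso 𝒮[H]]
    (iA : A ⟶ H) (pA : H ⟶ A) [IsBimonHom iA] [IsBimonHom pA] (hproj : iA ≫ pA = 𝟙 A) :
    ∃ (B : CrossedModule A) (_ : HopfObj B) (iB : B.X ⟶ H) (pB : H ⟶ B.X)
      (K : HopfObj (B.crossProduct)) (θ : B.crossProduct ≅ H),
      -- the antipode of `B` is invertible
      IsIso 𝒮[B] ∧
      -- `iB` and `pB` split the idempotent
      iB ≫ pB = 𝟙 B.X ∧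
      pB ≫ iB = Δ[H] ≫ (pA ≫ 𝒮[A] ≫ iA) ▷ H ≫ μ[H] ∧
      -- `K` is the cross product Hopf algebra, with invertible antipode
      CrossedModule.IsCrossProduct B K ∧
      IsIso K.antipode ∧
      -- `θ` is an isomorphism of Hopf algebras, given with its inverse by the formulas
      IsBimonHom θ.hom ∧
      θ.hom = (iA ⊗ₘ iB) ≫ μ[H] ∧
      θ.inv = Δ[H] ≫ (pA ⊗ₘ pB) := by
  let P₀ : HopfProjection A H := ⟨iA, pA, inferInstance, inferInstance, hproj⟩
  obtain ⟨B, i, q, hi, hq⟩ := IsIdempotentComplete.idempotents_split H P₀.proj P₀.proj_proj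
  let P : SplitHopfProjection A H := ⟨P₀, B, i, q, hi, hq⟩
  refine ⟨P.crossedModule, P.hopfObj, i, q, hopfObjOfIso P.thetaIso.symm, P.thetaIso,
    P.isIso_antipode, hi, hq, P.isCrossProduct, ?_, ?_, rfl, rfl⟩
  -- the transported antipode is conjugate to that of `H`
  · exact inferInstanceAs (IsIso (P.thetaIso.hom ≫ 𝒮[H] ≫ P.thetaIso.inv))
  · exact isBimonHom_hopfObjOfIso P.thetaIso.symm
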